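/- **Setting.** Graphs on $[n]$ are instances $\mathcal I=(A_{ij})_{i<j}\in\{0,1\}^{\binom n2}$. Let $0\le p<q\le 1$, $k\le n$. The uniform distribution $\nu$ is $G(n,p)$. The planted distribution $\mu$ is: choose a uniformly random $k$-set $K\subseteq[n]$ and take the union of a sample of $G(n,p)$ with an independent sample of $G(k,q)$ on $K$. For $\mathrm{obj}\in\mathbb R$ the densest-$k$-subgraph program $\mathcal S$ is $$\mathrm{obj}\le x^\top A x,\qquad x_i^2=x_i\ (i\in[n]),\qquad \sum_i x_i=k .$$ A *degree-$d$ SoS refutation* of $\mathcal S$ on $A$ is a polynomial identity $-1=a+(x^\top Ax-\mathrm{obj})\,b+\sum_j g_jq_j$, where the $g_j$ are the equality constraints, $a,b$ are sums of squares given by positive semidefinite coefficient matrices, and all terms have degree at most $2d$ in $x$. Its numbers are bounded by $R$ if all entries of these matrices and all coefficients of the $q_j$ are at most $R$ in absolute value. For a distribution $\Theta$ on sets $T$ of pairs, $\mathcal S$ is *$\delta$-robustly inferable* (w.r.t. $\mu,\Theta$) if some map $x$ from sub-instances to $\mathbb R^n$ satisfies $$\Pr_{\mathcal I\sim\mu,\;T\sim\Theta,\;\mathcal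 I'\sim\nu}\bigl[x(\mathcal I_T)\text{ is feasible for }\mathcal S\text{ on }\mathcal I_T\circ\mathcal I'_{\overline T}\bigr]\ge 1-\delta .$$ $\lambda^+_{\max}$ denotes the largest non-negative eigenvalue ($0$ if there is none). **Lemma.** There are absolute constants $c_1\in\mathbb N$, $c_1>1$, and $c,C>0$ such that the following holds for all $n\ge 2$, $d\ge1$, $k\le n$, $D>3d$, $0\le p<q\le1$, with $B=c_1d$. Suppose $$k^2(p+q)\ge C\,d\log n,\qquad \varepsilon>\frac{c\,d\log n}{D-3d},\qquad \mathrm{obj}\le(1-\varepsilon)(p+q)\binom k2 .$$ Call (R) the statement that, with probability at least $1-n^{-8B}$ over $\mathcal I\sim\nu$, $\mathcal S$ has a degree-$d$ SoS refutation with numbers bounded by $n^B$. 1. All constraints of $\mathcal S$ have degree at most $2d$ in the program variables and at most $1$ in the instance variables. 2. If (R) holds, or if $k^2(p+q)(\varepsilon+1-p)\ge C\,d\log n$, then there is a distribution $\Theta$ on sets of pairs such that $\mathcal S$ is $n^{-8B}$-robustly inferable with respect to $\mu$ and $\Theta$, and $\Pr_{T\sim\Theta}[\alpha\subseteq T]\le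 n^{-8B}$ for every set $\alpha$ of at least $D-3d$ pairs. 3. Suppose $2d\le k$ and $k+d\le n$. For every graph $A$ and every $\gamma\ge n^{-d}$: if there is an identity $\mathrm{obj}-\gamma-x^\top Ax=a+\sum_jg_jq_j$, where $a$ is a sum of squares and all terms have degree at most $2d$ in $x$ (with no bound on its numbers), then $\mathcal S$ has on $A$ a degree-$d$ SoS refutation with numbers bounded by $n^{B}$. 4. If (R) holds, then there is a symmetric $[n]^{\le d}\times[n]^{\le d}$ matrix $Q(\mathcal I)$ whose entries are polynomials of degree at most $2D$ in $\mathcal I$, with $$\mathbb E_{\nu}\,\lambda^+_{\max}(Q(\mathcal I))>0\quad\text{and}\quad\frac{\mathbb E_{\mu}\,\lambda^+_{\max}(Q(\mathcal I))}{\mathbb E_{\nu}\,\lambda^+_{\max}(Q(\mathcal I))}\ge n^{B/2}.$$ -/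

import Mathlib

open MvPolynomial

noncomputable section

/-! ### Polynomial systems with Boolean instances -/

/-- The real `0/1` vector of a Boolean instance. -/
def instVal {ι : Type} (I : ι → Bool) : ι → ℝ := fun e => if I e then 1 else 0

/-- A polynomial system in program variables `x₁, …, xₙ` (left summand) and instance variables
indexed by `ι` (right summand): the equalities `eqn j = 0` and one inequality `ineq ≥ 0`
(the objective constraint). -/
structure PolySystem (n : ℕ) (ι J : Type) where
  eqn : J → MvPolynomial (Fin n ⊕ ι) ℝ
  ineq : MvPolynomial (Fin n ⊕ ι) ℝ

/-- Degree in the program variables. -/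
def degProg {n : ℕ} {ι : Type} (P : MvPolynomial (Fin n ⊕ ι) ℝ) : ℕ :=
  P.weightedTotalDegree (Sum.elim (fun _ => 1) (fun _ => 0))

/-- Degree in the instance variables. -/
def degInst {n : ℕ} {ι : Type} (P : MvPolynomial (Fin n ⊕ ι) ℝ) : ℕ :=
  P.weightedTotalDegree (Sum.elim (fun _ => 0) (fun _ => 1))

/-- Substitute the instance, leaving a polynomial in the program variables. -/
def atInst {n : ℕ} {ι : Type} (I : ι → Bool) (P : MvPolynomial (Fin n ⊕ ι) ℝ) :
    MvPolynomial (Fin n) ℝ :=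
  aeval (Sum.elim X (fun e => C (instVal I e))) P

/-- `x` is feasible for the system on the instance `I`. -/
def PolySystem.Feasible {n : ℕ} {ι J : Type} (S : PolySystem n ι J) (I : ι → Bool)
    (x : Fin n → ℝ) : Prop :=
  (∀ j, eval x (atInst I (S.eqn j)) = 0) ∧ 0 ≤ eval x (atInst I S.ineq)

/-! ### Sum-of-squares refutations -/

/-- `[n]^{≤ d}`: words of length at most `d` over `[n]`. -/
abbrev Word (n d : ℕ) : Type := Σ j : Fin (d + 1), (Fin j → Fin n)

/-- The monomial of a word. -/
def Word.mono {n d : ℕ} (w : Word n d) : MvPolynomial (Fin n) ℝ := ∏ i, X (w.2 i)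

/-- `⟨M, x^{≤d} (x^{≤d})ᵀ⟩`; for positive semidefinite `M` these are exactly the sums of squares
of polynomials of degree at most `d`. -/
def gram {n d : ℕ} (M : Matrix (Word n d) (Word n d) ℝ) : MvPolynomial (Fin n) ℝ :=
  ∑ u, ∑ v, C (M u v) * (u.mono * v.mono)

/-- On the instance `I` the system `{g_j = 0, h ≥ 0}` has a sum-of-squares refutation
`-1 = a + h * b + ∑ g_j q_j`, with `a`, `b` sums of squares, all terms of degree at most `2d`
in the program variables, and with all numbers in it bounded by `R`.
(Replacing `h ≥ 0` by `h = z²` with a slack variable `z` gives the same refutations: modulo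
`z² = h` the part of a sum of squares in `(x, z)` that is even in `z` is `a + h * b`.) -/
def PolySystem.HasRefutation {n : ℕ} {ι J : Type} [Fintype J] (S : PolySystem n ι J)
    (d : ℕ) (R : ℝ) (I : ι → Bool) : Prop :=
  ∃ (l : ℕ) (A : Matrix (Word n d) (Word n d) ℝ) (B : Matrix (Word n l) (Word n l) ℝ)
    (q : J → MvPolynomial (Fin n) ℝ),
    2 * l + degProg S.ineq ≤ 2 * d ∧
    A.PosSemidef ∧ B.PosSemidef ∧
    (∀ j, degProg (S.eqn j) + (q j).totalDegree ≤ 2 * d) ∧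
    (∀ u v, |A u v| ≤ R) ∧ (∀ u v, |B u v| ≤ R) ∧ (∀ j m, |(q j).coeff m| ≤ R) ∧
    -1 = gram A + atInst I S.ineq * gram B + ∑ j, atInst I (S.eqn j) * q j

/-- On the instance `I` the degree-`2d` sum-of-squares relaxation certifies `h ≤ -γ` on the
solutions of the equalities `g_j = 0`: `-γ - h = a + ∑ g_j q_j`, with no bound on the numbers. -/
def PolySystem.HasCertificate {n : ℕ} {ι J : Type} [Fintype J] (S : PolySystem n ι J)
    (d : ℕ) (γ : ℝ) (I : ι → Bool) : Prop :=
  ∃ (A : Matrix (Word n d) (Word n d) ℝ) (q : J → MvPolynomial (Fin n) ℝ),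
    A.PosSemidef ∧
    (∀ j, degProg (S.eqn j) + (q j).totalDegree ≤ 2 * d) ∧
    C (-γ) - atInst I S.ineq = gram A + ∑ j, atInst I (S.eqn j) * q j

/-! ### Finite probability: distributions are given by their weights -/

open Classical in
/-- Probability of the event `E` under the weights `w`. -/
def prob {α : Type} [Fintype α] (w : α → ℝ) (E : α → Prop) : ℝ := ∑ a, if E a then w a else 0

/-- Expectation of `f` under the weights `w`. -/
def expect {α : Type} [Fintype α] (w : α → ℝ) (f : α → ℝ) : ℝ := ∑ a, w a * f a

/-- Independent Bernoulli coordinates: coordinate `e` is `true` with probability `r e`. -/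
def bernWeight {ι : Type} [Fintype ι] (r : ι → ℝ) (I : ι → Bool) : ℝ :=
  ∏ e, if I e then r e else 1 - r e

/-- `I_T ∘ I'`: the instance that agrees with `I` on `T` and with `I'` outside `T`. -/
def resample {ι : Type} [DecidableEq ι] (T : Finset ι) (I I' : ι → Bool) : ι → Bool :=
  fun e => if e ∈ T then I e else I' e

/-- `δ`-robust inference for the planted distribution `μ`, the product distribution `ν` and the
subsampling distribution `Θ`: some map `x` from sub-instances to `ℝⁿ` satisfies
`Pr_{I ∼ μ, T ∼ Θ, I' ∼ ν} [x(I_T) is feasible on I_T ∘ I'] ≥ 1 - δ`. -/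
def PolySystem.RobustlyInferable {n : ℕ} {ι J : Type} [Fintype ι] [DecidableEq ι]
    (S : PolySystem n ι J) (μ ν : (ι → Bool) → ℝ) (Θ : Finset ι → ℝ) (δ : ℝ) : Prop :=
  ∃ x : (T : Finset ι) → (T → Bool) → (Fin n → ℝ),
    1 - δ ≤ expect μ fun I => expect Θ fun T =>
      prob ν fun I' => S.Feasible (resample T I I') (x T fun e => I e)

/-! ### Matrix polynomials -/

/-- The largest non-negative eigenvalue `λ⁺_max` of a symmetric matrix
(`0` if all eigenvalues are negative). -/
def lamMaxPos {m : Type} [Fintype m] [DecidableEq m] (M : Matrix m m ℝ) : ℝ :=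
  sSup (insert 0 (spectrum ℝ M))

/-- Value of a matrix polynomial at an instance. -/
def evalMat {m ι : Type} (Q : Matrix m m (MvPolynomial ι ℝ)) (I : ι → Bool) : Matrix m m ℝ :=
  Q.map (eval (instVal I))

/-- There is a symmetric `[n]^{≤d} × [n]^{≤d}` matrix polynomial `Q` of degree at most `D'` in the
instance variables with `E_μ λ⁺_max(Q) / E_ν λ⁺_max(Q) ≥ r`. -/
def HasSpectralDistinguisher {ι : Type} [Fintype ι] [DecidableEq ι] (n d D' : ℕ)
    (μ ν : (ι → Bool) → ℝ) (r : ℝ) : Prop :=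
  ∃ Q : Matrix (Word n d) (Word n d) (MvPolynomial ι ℝ),
    Q.IsSymm ∧ (∀ u v, (Q u v).totalDegree ≤ D') ∧
    0 < expect ν (fun I => lamMaxPos (evalMat Q I)) ∧
    r ≤ expect μ (fun I => lamMaxPos (evalMat Q I)) / expect ν (fun I => lamMaxPos (evalMat Q I))

/-! ### Planted densest-`k`-subgraph -/

/-- The pairs `i < j` of vertices; a graph on `[n]` is a map `Edge n → Bool`. -/
abbrev Edge (n : ℕ) : Type := {e : Fin n × Fin n // e.1 < e.2}

/-- `G(n,p)`. -/
def erWeight (n : ℕ) (p : ℝ) : (Edge n → Bool) → ℝ := bernWeight fun _ => p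

/-- The planted distribution: a uniformly random `k`-set `K` of vertices, and on top of a sample of
`G(n,p)` the edges of an independent sample of `G(k,q)` on `K`; given `K` a pair inside `K` is
an edge with probability `1 - (1-p)(1-q)`, all other pairs with probability `p`, independently. -/
def plantedWeight (n k : ℕ) (p q : ℝ) (I : Edge n → Bool) : ℝ :=
  (∑ K ∈ (Finset.univ : Finset (Fin n)).powersetCard k,
    bernWeight (fun e : Edge n =>
      if e.1.1 ∈ K ∧ e.1.2 ∈ K then 1 - (1 - p) * (1 - q) else p) I) / (n.choose k : ℝ)

/-- The densest-`k`-subgraph program `obj ≤ xᵀ A x`, `xᵢ² = xᵢ`, `∑ xᵢ = k`, where `A` is the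
adjacency matrix, so that `xᵀ A x = 2 ∑_{i<j} A_{ij} xᵢ xⱼ`. -/
def dksSystem (n k : ℕ) (obj : ℝ) : PolySystem n (Edge n) (Option (Fin n)) where
  eqn
    | none => ∑ i, X (Sum.inl i) - C (k : ℝ)
    | some i => X (Sum.inl i) ^ 2 - X (Sum.inl i)
  ineq := C 2 * ∑ e : Edge n, X (Sum.inr e) * X (Sum.inl e.1.1) * X (Sum.inl e.1.2) - C obj

/-- The sum-of-squares hypothesis: a sample of `G(n,p)` has, with probability at least
`1 - n^{-8B}`, a degree-`d` refutation with numbers bounded by `n^B`. -/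
def dksRefutable (n k d B : ℕ) (p obj : ℝ) : Prop :=
  1 - 1 / (n : ℝ) ^ (8 * B) ≤
    prob (erWeight n p) fun I => (dksSystem n k obj).HasRefutation d ((n : ℝ) ^ B) I

end

noncomputable section

set_option linter.unusedSectionVars false

/-! ### Degrees of the program -/

section WeightedDegree

variable {σ : Type} (w : σ → ℕ)

/-! Write `B = 40 d`, `δ = n^{-8B}` and `θ = sampleRate n d D`, which is chosen so that `θ^{D-3d} =
δ`.

Robust inference. Let `T` contain each pair independently with probability `θ`; a set of `D-3d`
pairs survives with probability at most `δ`. The map returns a `k`-set with the most edges inside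
`T`. Resampled pairs can only add edges, so it is feasible as soon as the planted set keeps `obj/2`
edges in `T`, which is the lower tail of a binomial variable (`Regime.prob_edgesIn_lt_le`). When `p`
is close to `1` a Chernoff bound on the edges is too weak, and the few non-edges are counted
instead. That needs `(k choose 2)((1-p)+ε)` to be at least of order `d log n`. Refutability provides
this, because a fixed `k`-set is complete with probability `p^{(k choose 2)}`, and then no
refutation exists.

Bounded refutations. Modulo the truncated ideal of the slice, every polynomial of degree at most `t
≤ k` is homogeneous multilinear of degree `t`, with explicitly bounded multipliers (`Reduces`). The
squares of a certificate sum to at most `n^2` on the slice, and coefficients of homogeneous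
multilinear polynomials are controlled by their values there (`norm_coeff_le_of_slice`). This gives
a bounded Gram matrix. The identity is then rebuilt by bounded reductions. Their remainder is
homogeneous multilinear of degree `2d` and lies in the ideal, hence vanishes
(`eq_zero_of_homogeneous_mem`). Dividing by `γ` finishes.

Spectral distinguisher. For `p > 0`, suppose that no matrix of degree `2D` distinguishes with ratio
`r = n^{B/2}`. For a weight `g(K, I)` that is rarely negative, the functional `F ↦ E g(K,I) ⟨F(I),
x_K x_Kᵀ⟩` on matrices of degree at most `D` is then dominated by a multiple of `r E_ν λ⁺(F)` plus a
small multiple of the L² norm (`plantedForm_le`). By Hahn–Banach it extends to all matrix-valued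
functions with the same domination. The extensions `ℓ₁` (for `g = 1`) and `ℓ₂` (for the objective)
behave like a pseudo-expectation that can be evaluated on the refutation matrices `F₁`, `F₂`,
although these have no degree bound in the instance.

The link between `ℓ₁` and `ℓ₂` uses noise of rate `θ`. Domination yields `ℓ₁(noise F₁) ≥ 1 - o(1)`
and `ℓ₂(noise F₂) ≥ -o(1)`. Noise shrinks level `N` by `θ^N`, so `F₁`, `F₂` may be truncated at
degree `D-1`. On truncations the functionals are genuine planted expectations, where the refutation
identity would make their sum zero if truncation commuted with multiplication by a bit. The
commutator lives on two adjacent levels near `D`, where noise again makes it negligible. For the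
identity to pass through the noise, the objective is replaced by an affine function of the bits
whose conditional expectation given the noisy bits is the objective (`Regime.exists_lift`). Together
these give `1 ≤ o(1)`. -/

lemma weightedTotalDegree_le_iff {m : ℕ} {P : MvPolynomial σ ℝ} :
    P.weightedTotalDegree w ≤ m ↔ ∀ s ∈ P.support, Finsupp.weight w s ≤ m := by
  simp [weightedTotalDegree, Finset.sup_le_iff]

lemma weightedTotalDegree_add_le {m : ℕ} {P Q : MvPolynomial σ ℝ}
    (hP : P.weightedTotalDegree w ≤ m) (hQ : Q.weightedTotalDegree w ≤ m) :
    (P + Q).weightedTotalDegree w ≤ m := by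
  classical
  rw [weightedTotalDegree_le_iff] at *
  intro s hs
  rcases Finset.mem_union.1 (support_add hs) with h | h
  exacts [hP s h, hQ s h]

lemma weightedTotalDegree_neg_le {m : ℕ} {P : MvPolynomial σ ℝ}
    (hP : P.weightedTotalDegree w ≤ m) : (-P).weightedTotalDegree w ≤ m := by
  rw [weightedTotalDegree_le_iff] at *
  simpa using hP

lemma weightedTotalDegree_sub_le {m : ℕ} {P Q : MvPolynomial σ ℝ}
    (hP : P.weightedTotalDegree w ≤ m) (hQ : Q.weightedTotalDegree w ≤ m) :
    (P - Q).weightedTotalDegree w ≤ m := by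
  rw [sub_eq_add_neg]
  exact weightedTotalDegree_add_le w hP (weightedTotalDegree_neg_le w hQ)

lemma weightedTotalDegree_mul_le {m m' : ℕ} {P Q : MvPolynomial σ ℝ}
    (hP : P.weightedTotalDegree w ≤ m) (hQ : Q.weightedTotalDegree w ≤ m') :
    (P * Q).weightedTotalDegree w ≤ m + m' := by
  classical
  rw [weightedTotalDegree_le_iff] at *
  intro s hs
  obtain ⟨a, ha, b, hb, rfl⟩ := Finset.mem_add.1 (support_mul P Q hs)
  rw [map_add]
  exact add_le_add (hP a ha) (hQ b hb)

lemma weightedTotalDegree_sum_le {ι : Type} {m : ℕ} (s : Finset ι) {P : ι → MvPolynomial σ ℝ}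
    (hP : ∀ i ∈ s, (P i).weightedTotalDegree w ≤ m) :
    (∑ i ∈ s, P i).weightedTotalDegree w ≤ m := by
  classical
  induction s using Finset.induction_on with
  | empty => simp [weightedTotalDegree_le_iff]
  | insert a s ha ih =>
    rw [Finset.sum_insert ha]
    exact weightedTotalDegree_add_le w (hP a (by simp)) (ih fun i hi => hP i (by simp [hi]))

lemma weightedTotalDegree_C_le (c : ℝ) : (C c : MvPolynomial σ ℝ).weightedTotalDegree w ≤ 0 := by
  classical
  rw [weightedTotalDegree_le_iff]
  intro s hs
  rw [mem_support_iff, coeff_C] at hs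
  have : s = 0 := by by_contra h; exact hs (if_neg (Ne.symm h))
  simp [this]

lemma weightedTotalDegree_X_le (i : σ) :
    (X i : MvPolynomial σ ℝ).weightedTotalDegree w ≤ w i := by
  rw [weightedTotalDegree_le_iff]
  intro s hs
  rw [support_X, Finset.mem_singleton] at hs
  simp [hs, Finsupp.weight_single]

end WeightedDegree

variable {n k : ℕ} {obj : ℝ}

lemma weightedTotalDegree_dks_card_le (w : Fin n ⊕ Edge n → ℕ) (m : ℕ)
    (h : ∀ i, w (Sum.inl i) ≤ m) :
    ((dksSystem n k obj).eqn none).weightedTotalDegree w ≤ m := by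
  refine weightedTotalDegree_sub_le w (weightedTotalDegree_sum_le w _ fun i _ => ?_)
    ((weightedTotalDegree_C_le w _).trans (Nat.zero_le _))
  exact (weightedTotalDegree_X_le w _).trans (h i)

lemma weightedTotalDegree_dks_bool_le (w : Fin n ⊕ Edge n → ℕ) (m : ℕ)
    (h : ∀ i, w (Sum.inl i) ≤ m) (i : Fin n) :
    ((dksSystem n k obj).eqn (some i)).weightedTotalDegree w ≤ 2 * m := by
  have hX := (weightedTotalDegree_X_le w (Sum.inl i)).trans (h i)
  refine weightedTotalDegree_sub_le w ?_ (hX.trans (by omega))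
  rw [pow_two]
  exact (weightedTotalDegree_mul_le w hX hX).trans (by omega)

lemma weightedTotalDegree_dks_ineq_le (w : Fin n ⊕ Edge n → ℕ) (m m' : ℕ)
    (h : ∀ i, w (Sum.inl i) ≤ m) (h' : ∀ i, w (Sum.inr i) ≤ m') :
    (dksSystem n k obj).ineq.weightedTotalDegree w ≤ m' + 2 * m := by
  have hX i := (weightedTotalDegree_X_le w (Sum.inl i)).trans (h i)
  have hX' i := (weightedTotalDegree_X_le w (Sum.inr i)).trans (h' i)
  refine weightedTotalDegree_sub_le w ?_ ((weightedTotalDegree_C_le w _).trans (Nat.zero_le _))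
  refine (weightedTotalDegree_mul_le w (weightedTotalDegree_C_le w _)
    (weightedTotalDegree_sum_le w (m := m' + 2 * m) _ fun e _ => ?_)).trans (by omega)
  exact (weightedTotalDegree_mul_le w (weightedTotalDegree_mul_le w (hX' e) (hX _)) (hX _)).trans
    (by omega)

lemma degProg_dks_card_le : degProg ((dksSystem n k obj).eqn none) ≤ 1 :=
  weightedTotalDegree_dks_card_le _ 1 (by simp)

lemma degProg_dks_bool_le (i : Fin n) : degProg ((dksSystem n k obj).eqn (some i)) ≤ 2 :=
  weightedTotalDegree_dks_bool_le _ 1 (by simp) i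

lemma degProg_dks_ineq_le : degProg (dksSystem n k obj).ineq ≤ 2 :=
  weightedTotalDegree_dks_ineq_le _ 1 0 (by simp) (by simp)

lemma degInst_dks_eqn_le (j : Option (Fin n)) : degInst ((dksSystem n k obj).eqn j) ≤ 1 := by
  cases j with
  | none => exact (weightedTotalDegree_dks_card_le _ 0 (by simp)).trans (by omega)
  | some i => exact (weightedTotalDegree_dks_bool_le _ 0 (by simp) i).trans (by omega)

lemma degInst_dks_ineq_le : degInst (dksSystem n k obj).ineq ≤ 1 :=
  weightedTotalDegree_dks_ineq_le _ 0 1 (by simp) (by simp)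

/-! ### Values of the program -/

lemma atInst_dks_card (I : Edge n → Bool) :
    atInst I ((dksSystem n k obj).eqn none) = ∑ i, X i - C (k : ℝ) := by
  simp [atInst, dksSystem]

lemma atInst_dks_bool (I : Edge n → Bool) (i : Fin n) :
    atInst I ((dksSystem n k obj).eqn (some i)) = X i ^ 2 - X i := by
  simp [atInst, dksSystem]

lemma atInst_dks_ineq (I : Edge n → Bool) :
    atInst I (dksSystem n k obj).ineq =
      C 2 * ∑ e : Edge n, C (instVal I e) * X e.1.1 * X e.1.2 - C obj := by
  simp [atInst, dksSystem]

/-- The indicator vector of a vertex set. -/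
def indVec (K : Finset (Fin n)) : Fin n → ℝ := fun i => if i ∈ K then 1 else 0

/-- The pairs inside a vertex set. -/
def edgesIn (K : Finset (Fin n)) : Finset (Edge n) := {e | e.1.1 ∈ K ∧ e.1.2 ∈ K}

lemma mem_edgesIn {K : Finset (Fin n)} {e : Edge n} :
    e ∈ edgesIn K ↔ e.1.1 ∈ K ∧ e.1.2 ∈ K := by simp [edgesIn]

lemma card_edgesIn (K : Finset (Fin n)) : (edgesIn K).card = K.card.choose 2 := by
  rw [← Finset.card_powersetCard]
  refine Finset.card_bij (fun e _ => {e.1.1, e.1.2}) ?_ ?_ ?_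
  · intro e he
    rw [mem_edgesIn] at he
    rw [Finset.mem_powersetCard]
    refine ⟨?_, Finset.card_pair e.2.ne⟩
    intro x hx
    rcases Finset.mem_insert.1 hx with rfl | hx
    · exact he.1
    · rw [Finset.mem_singleton.1 hx]; exact he.2
  · rintro ⟨⟨a, b⟩, hab⟩ _ ⟨⟨c, d⟩, hcd⟩ _ h
    simp only at h hab hcd
    have ha : a ∈ ({c, d} : Finset (Fin n)) := by rw [← h]; simp
    have hb : b ∈ ({c, d} : Finset (Fin n)) := by rw [← h]; simp
    simp only [Finset.mem_insert, Finset.mem_singleton] at ha hb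
    rcases ha with rfl | rfl <;> rcases hb with rfl | rfl
    · exact absurd hab (lt_irrefl _)
    · rfl
    · exact absurd hab (not_lt.2 hcd.le)
    · exact absurd hab (lt_irrefl _)
  · intro s hs
    rw [Finset.mem_powersetCard] at hs
    obtain ⟨a, b, hab, rfl⟩ := Finset.card_eq_two.1 hs.2
    have ha := hs.1 (show a ∈ ({a, b} : Finset (Fin n)) by simp)
    have hb := hs.1 (show b ∈ ({a, b} : Finset (Fin n)) by simp)
    rcases lt_or_gt_of_ne hab with h | h
    · exact ⟨⟨(a, b), h⟩, mem_edgesIn.2 ⟨ha, hb⟩, rfl⟩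
    · exact ⟨⟨(b, a), h⟩, mem_edgesIn.2 ⟨hb, ha⟩, Finset.pair_comm _ _⟩

lemma eval_indVec_card (I : Edge n → Bool) {K : Finset (Fin n)} (hK : K.card = k) :
    eval (indVec K) (atInst I ((dksSystem n k obj).eqn none)) = 0 := by
  rw [atInst_dks_card]
  simp [indVec, hK]

lemma eval_indVec_bool (I : Edge n → Bool) (K : Finset (Fin n)) (i : Fin n) :
    eval (indVec K) (atInst I ((dksSystem n k obj).eqn (some i))) = 0 := by
  rw [atInst_dks_bool]
  by_cases h : i ∈ K <;> simp [indVec, h]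

lemma eval_indVec_eqn (I : Edge n → Bool) {K : Finset (Fin n)} (hK : K.card = k)
    (j : Option (Fin n)) :
    eval (indVec K) (atInst I ((dksSystem n k obj).eqn j)) = 0 := by
  cases j with
  | none => exact eval_indVec_card I hK
  | some i => exact eval_indVec_bool I K i

lemma eval_indVec_ineq (I : Edge n → Bool) (K : Finset (Fin n)) :
    eval (indVec K) (atInst I (dksSystem n k obj).ineq) =
      2 * ∑ e ∈ edgesIn K, instVal I e - obj := by
  rw [atInst_dks_ineq]
  simp only [map_sub, map_mul, eval_C, map_sum, eval_X, indVec]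
  rw [edgesIn, Finset.sum_filter]
  congr 2
  refine Finset.sum_congr rfl fun e _ => ?_
  by_cases h1 : e.1.1 ∈ K <;> by_cases h2 : e.1.2 ∈ K <;> simp [h1, h2]

lemma feasible_indVec (I : Edge n → Bool) {K : Finset (Fin n)} (hK : K.card = k)
    (h : obj ≤ 2 * ∑ e ∈ edgesIn K, instVal I e) :
    (dksSystem n k obj).Feasible I (indVec K) :=
  ⟨eval_indVec_eqn I hK, by rw [eval_indVec_ineq]; linarith⟩

lemma eval_gram {d : ℕ} (M : Matrix (Word n d) (Word n d) ℝ) (x : Fin n → ℝ) :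
    eval x (gram M) = ∑ u, ∑ v, M u v * (eval x u.mono * eval x v.mono) := by
  simp [gram]

lemma eval_gram_nonneg {d : ℕ} {M : Matrix (Word n d) (Word n d) ℝ} (hM : M.PosSemidef)
    (x : Fin n → ℝ) : 0 ≤ eval x (gram M) := by
  have := hM.dotProduct_mulVec_nonneg (fun u => eval x u.mono)
  rw [eval_gram]
  refine this.trans_eq ?_
  simp only [dotProduct, Matrix.mulVec, Finset.mul_sum, star_trivial]
  refine Finset.sum_congr rfl fun u _ => Finset.sum_congr rfl fun v _ => by ring

/-- A refutable instance has no feasible point. -/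
lemma PolySystem.HasRefutation.not_feasible {ι J : Type} [Fintype J] {S : PolySystem n ι J}
    {d : ℕ} {R : ℝ} {I : ι → Bool} (h : S.HasRefutation d R I) (x : Fin n → ℝ) :
    ¬ S.Feasible I x := by
  rintro ⟨hx, hx'⟩
  obtain ⟨l, A, B, q, -, hA, hB, -, -, -, -, he⟩ := h
  have := congrArg (eval x) he
  simp only [map_neg, map_one, map_add, map_mul, map_sum, hx, zero_mul, Finset.sum_const_zero,
    add_zero] at this
  have h1 := eval_gram_nonneg hA x
  have h2 := mul_nonneg hx' (eval_gram_nonneg hB x)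
  linarith

/-! ### Product weights on the cube -/

section Cube

variable {ι : Type} [Fintype ι] [DecidableEq ι]

lemma sum_prod_pi {β : Type} [Fintype β] (f : ι → β → ℝ) :
    ∑ x : ι → β, ∏ e, f e (x e) = ∏ e, ∑ y, f e y := by
  classical
  rw [Finset.prod_univ_sum, Fintype.piFinset_univ]

/-- The image of a product of two product weights under a coordinatewise map is a product weight. -/
lemma sum_sum_prod_comp {α β γ : Type} [Fintype α] [Fintype β] [Fintype γ] [DecidableEq γ]
    (u : ι → α → ℝ) (v : ι → β → ℝ) (φ : ι → α → β → γ) (F : (ι → γ) → ℝ) :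
    ∑ x : ι → α, ∑ y : ι → β, (∏ e, u e (x e)) * (∏ e, v e (y e)) * F (fun e => φ e (x e) (y e)) =
      ∑ z : ι → γ, (∏ e, ∑ a, ∑ b, if φ e a b = z e then u e a * v e b else 0) * F z := by
  classical
  have h (z : ι → γ) : (∏ e, ∑ a, ∑ b, if φ e a b = z e then u e a * v e b else 0) =
      ∑ x : ι → α, ∑ y : ι → β,
        if (fun e => φ e (x e) (y e)) = z then (∏ e, u e (x e)) * (∏ e, v e (y e)) else 0 := by
    refine (sum_prod_pi fun e a => ∑ b, if φ e a b = z e then u e a * v e b else 0).symm.trans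
      (Finset.sum_congr rfl fun x _ => ?_)
    refine (sum_prod_pi fun e b => if φ e (x e) b = z e then u e (x e) * v e b else 0).symm.trans
      (Finset.sum_congr rfl fun y _ => ?_)
    rw [Finset.prod_ite_zero, Finset.prod_mul_distrib]
    simp only [Finset.mem_univ, true_implies, funext_iff]
  simp_rw [h, Finset.sum_mul]
  conv_rhs => rw [Finset.sum_comm]
  refine Finset.sum_congr rfl fun x _ => ?_
  conv_rhs => rw [Finset.sum_comm]
  refine Finset.sum_congr rfl fun y _ => ?_
  simp only [ite_mul, zero_mul]
  rw [Finset.sum_ite_eq]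
  simp

/-- Bernoulli weight of a bit. -/
def bitWeight (r : ℝ) (b : Bool) : ℝ := if b then r else 1 - r

@[simp] lemma bitWeight_true (r : ℝ) : bitWeight r true = r := rfl
@[simp] lemma bitWeight_false (r : ℝ) : bitWeight r false = 1 - r := by simp [bitWeight]

lemma bernWeight_eq (r : ι → ℝ) (I : ι → Bool) : bernWeight r I = ∏ e, bitWeight (r e) (I e) := rfl

lemma bitWeight_nonneg {r : ℝ} (h0 : 0 ≤ r) (h1 : r ≤ 1) (b : Bool) : 0 ≤ bitWeight r b := by
  cases b <;> simp [h0, h1]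

lemma bernWeight_nonneg {r : ι → ℝ} (h0 : ∀ e, 0 ≤ r e) (h1 : ∀ e, r e ≤ 1) (I : ι → Bool) :
    0 ≤ bernWeight r I := by
  rw [bernWeight_eq]
  exact Finset.prod_nonneg fun e _ => bitWeight_nonneg (h0 e) (h1 e) _

lemma sum_bernWeight_mul_prod (r : ι → ℝ) (f : ι → Bool → ℝ) :
    ∑ I, bernWeight r I * ∏ e, f e (I e) = ∏ e, (r e * f e true + (1 - r e) * f e false) := by
  simp_rw [bernWeight_eq, ← Finset.prod_mul_distrib]
  rw [sum_prod_pi (fun e b => bitWeight (r e) b * f e b)]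
  simp

lemma sum_bernWeight (r : ι → ℝ) : ∑ I, bernWeight r I = 1 := by
  simpa using sum_bernWeight_mul_prod r (fun _ _ => 1)

lemma sum_bernWeight_mul_prod_finset (r : ι → ℝ) (S : Finset ι) (f : Bool → ℝ) :
    ∑ I, bernWeight r I * ∏ e ∈ S, f (I e) =
      ∏ e ∈ S, (r e * f true + (1 - r e) * f false) := by
  classical
  have h (I : ι → Bool) : ∏ e ∈ S, f (I e) = ∏ e, (if e ∈ S then f (I e) else 1) := by
    rw [Finset.prod_ite_mem, Finset.univ_inter]
  simp_rw [h]
  rw [sum_bernWeight_mul_prod r (fun e b => if e ∈ S then f b else 1)]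
  rw [← Finset.prod_subset (Finset.subset_univ S)]
  · exact Finset.prod_congr rfl fun e he => by simp [he]
  · intro e _ he
    simp [he]

end Cube

/-! ### Probabilities and expectations -/

section Prob

variable {α : Type} [Fintype α] {w : α → ℝ}

lemma prob_le_expect (hw : ∀ a, 0 ≤ w a) {E : α → Prop} {f : α → ℝ} (h0 : ∀ a, 0 ≤ f a)
    (h1 : ∀ a, E a → 1 ≤ f a) : prob w E ≤ expect w f := by
  classical
  refine Finset.sum_le_sum fun a _ => ?_
  split_ifs with h
  · exact le_mul_of_one_le_right (hw a) (h1 a h)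
  · exact mul_nonneg (hw a) (h0 a)

lemma prob_mono (hw : ∀ a, 0 ≤ w a) {E E' : α → Prop} (h : ∀ a, E a → E' a) :
    prob w E ≤ prob w E' := by
  classical
  refine Finset.sum_le_sum fun a _ => ?_
  by_cases h1 : E a
  · simp [h1, h a h1]
  · simp only [h1, if_false]
    split_ifs
    exacts [hw a, le_rfl]

lemma prob_add_prob_not (E : α → Prop) : prob w E + prob w (fun a => ¬ E a) = ∑ a, w a := by
  classical
  rw [prob, prob, ← Finset.sum_add_distrib]
  refine Finset.sum_congr rfl fun a _ => ?_
  by_cases h : E a <;> simp [h]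

lemma prob_nonneg (hw : ∀ a, 0 ≤ w a) (E : α → Prop) : 0 ≤ prob w E :=
  Finset.sum_nonneg fun a _ => by split_ifs; exacts [hw a, le_rfl]

lemma expect_mono (hw : ∀ a, 0 ≤ w a) {f g : α → ℝ} (h : ∀ a, f a ≤ g a) :
    expect w f ≤ expect w g :=
  Finset.sum_le_sum fun a _ => mul_le_mul_of_nonneg_left (h a) (hw a)

lemma expect_nonneg (hw : ∀ a, 0 ≤ w a) {f : α → ℝ} (h : ∀ a, 0 ≤ f a) : 0 ≤ expect w f :=
  Finset.sum_nonneg fun a _ => mul_nonneg (hw a) (h a)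

lemma expect_add (f g : α → ℝ) : expect w (fun a => f a + g a) = expect w f + expect w g := by
  simp [expect, mul_add, Finset.sum_add_distrib]

lemma expect_const_mul (c : ℝ) (f : α → ℝ) : expect w (fun a => c * f a) = c * expect w f := by
  simp only [expect, Finset.mul_sum]
  exact Finset.sum_congr rfl fun a _ => by ring

lemma expect_sum {β : Type} (s : Finset β) (f : β → α → ℝ) :
    expect w (fun a => ∑ b ∈ s, f b a) = ∑ b ∈ s, expect w (f b) := by
  simp only [expect, Finset.mul_sum]
  exact Finset.sum_comm

lemma expect_const (hw : ∑ a, w a = 1) (c : ℝ) : expect w (fun _ => c) = c := by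
  rw [expect, ← Finset.sum_mul, hw, one_mul]

lemma prob_eq_expect (E : α → Prop) [DecidablePred E] :
    prob w E = expect w (fun a => if E a then 1 else 0) := by
  classical
  refine Finset.sum_congr rfl fun a _ => ?_
  by_cases h : E a <;> simp [h]

/-- Cauchy–Schwarz for weighted sums. -/
lemma expect_mul_sq_le (hw : ∀ a, 0 ≤ w a) (f g : α → ℝ) :
    expect w (fun a => f a * g a) ^ 2 ≤
      expect w (fun a => f a ^ 2) * expect w (fun a => g a ^ 2) := by
  have h := Finset.sum_mul_sq_le_sq_mul_sq Finset.univ (fun a => √(w a) * f a)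
    (fun a => √(w a) * g a)
  have e1 (a : α) : √(w a) * f a * (√(w a) * g a) = w a * (f a * g a) := by
    rw [show √(w a) * f a * (√(w a) * g a) = (√(w a) * √(w a)) * (f a * g a) by ring,
      Real.mul_self_sqrt (hw a)]
  have e2 (f : α → ℝ) (a : α) : (√(w a) * f a) ^ 2 = w a * f a ^ 2 := by
    rw [mul_pow, Real.sq_sqrt (hw a)]
  simpa only [e1, e2, expect] using h

lemma expect_abs_le_sqrt (hw : ∀ a, 0 ≤ w a) (h1 : ∑ a, w a = 1) (f : α → ℝ) :
    expect w (fun a => |f a|) ≤ √(expect w (fun a => f a ^ 2)) := by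
  apply Real.le_sqrt_of_sq_le
  have := expect_mul_sq_le hw (fun a => |f a|) (fun _ => 1)
  simpa [expect_const h1] using this

end Prob

/-! ### Lower tail of a binomial distribution -/

section Tail

variable {ι : Type} [Fintype ι] [DecidableEq ι]

/-- Markov's inequality for `exp (s (x - ∑ I_e))`, whose expectation factorizes. -/
lemma prob_sum_lt_le_exp {r : ι → ℝ} (h0 : ∀ e, 0 ≤ r e) (h1 : ∀ e, r e ≤ 1) (S : Finset ι)
    {r₀ : ℝ} (hS : ∀ e ∈ S, r e = r₀) {s : ℝ} (hs : 0 ≤ s) (x : ℝ) :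
    prob (bernWeight r) (fun I => ∑ e ∈ S, instVal I e < x) ≤
      Real.exp (s * x) * (r₀ * Real.exp (-s) + (1 - r₀)) ^ S.card := by
  have key := sum_bernWeight_mul_prod_finset r S (fun b => Real.exp (-s * if b then 1 else 0))
  refine (prob_le_expect (bernWeight_nonneg h0 h1)
    (f := fun I => Real.exp (s * x) * ∏ e ∈ S, Real.exp (-s * if I e then 1 else 0))
    (fun I => by positivity) fun I hI => ?_).trans_eq ?_
  · rw [← Real.exp_sum, ← Real.exp_add, Real.one_le_exp_iff, ← Finset.mul_sum]
    have : s * ∑ e ∈ S, instVal I e ≤ s * x := mul_le_mul_of_nonneg_left hI.le hs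
    simp only [instVal] at this
    linarith
  · rw [expect_const_mul, expect, key]
    congr 1
    rw [Finset.prod_congr rfl (g := fun _ => r₀ * Real.exp (-s) + (1 - r₀)), Finset.prod_const]
    intro e he
    simp [hS e he]

/-- The product `(1 + s + s²/2)(1 - s + s²/2)` equals `1 + s⁴/4`, and the first factor is at most
`exp s`. -/
lemma exp_neg_le_quadratic {s : ℝ} (hs : 0 ≤ s) : Real.exp (-s) ≤ 1 - s + s ^ 2 / 2 := by
  have h := Real.quadratic_le_exp_of_nonneg hs
  rw [Real.exp_neg, inv_le_iff_one_le_mul₀ (Real.exp_pos s)]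
  have h2 : 0 ≤ 1 - s + s ^ 2 / 2 := by nlinarith [sq_nonneg (s - 1)]
  nlinarith [mul_le_mul_of_nonneg_left h h2, sq_nonneg (s ^ 2)]

/-- The threshold on `1 - p` below which the upper tail of the number of non-edges is used. -/
def tailEta : ℝ := Real.exp (-36)

lemma tailEta_pos : 0 < tailEta := Real.exp_pos _

lemma tailEta_le : tailEta ≤ 1 / 37 := by
  rw [tailEta, Real.exp_neg, ← one_div]
  exact one_div_le_one_div_of_le (by norm_num) (by linarith [Real.add_one_le_exp (36 : ℝ)])

/-- Applied with `h = (p+q)/2` and `δ = 1 - p`. If `δ` is at least `tailEta`, the deviation is a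
constant fraction of `h |S|` and an exponential moment with a small parameter suffices. If `δ` is
small, almost all pairs are edges and a large parameter is needed: the bound then comes from the
rarity of non-edges, and its exponent is linear in `δ + ε`. -/
lemma prob_sum_lt_le_exp_neg {r : ι → ℝ} (h0 : ∀ e, 0 ≤ r e) (h1 : ∀ e, r e ≤ 1) (S : Finset ι)
    {r₀ h δ ε t : ℝ} (hS : ∀ e ∈ S, r e = r₀) (hr0 : 0 ≤ r₀) (hr1 : r₀ ≤ 1)
    (hh : 0 < h) (hrh : r₀ ≤ 2 * h) (hδ : 0 ≤ δ) (hε : 0 ≤ ε)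
    (hrη : 1 - r₀ ≤ tailEta * ε + δ ^ 2)
    (hcase : (tailEta ≤ δ ∧ 144 * t ≤ h * tailEta ^ 2 * S.card) ∨
      (δ ≤ tailEta ∧ 1 / 2 ≤ h ∧ t ≤ 2 * (S.card * (δ + ε)))) :
    prob (bernWeight r)
        (fun I => ∑ e ∈ S, instVal I e < r₀ * S.card - h / 6 * (δ + ε) * S.card) ≤
      Real.exp (-t) := by
  have hη := tailEta_pos
  have hN : (0 : ℝ) ≤ S.card := Nat.cast_nonneg _
  have hbase (s : ℝ) : 0 ≤ r₀ * Real.exp (-s) + (1 - r₀) := by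
    have := mul_nonneg hr0 (Real.exp_pos (-s)).le
    linarith
  rcases hcase with ⟨hδη, ht⟩ | ⟨hδη, hh2, ht⟩
  -- With this `s` the deviation contributes `-h tailEta² |S| / 72` to the exponent and the
  -- second-order term at most half of that, by `r₀ ≤ 2h`; hence the factor `144`.
  · set s : ℝ := tailEta / 12 with hs
    have hs0 : 0 ≤ s := by positivity
    refine (prob_sum_lt_le_exp h0 h1 S hS hs0 _).trans ?_
    have hb : r₀ * Real.exp (-s) + (1 - r₀) ≤ Real.exp (-(r₀ * (s - s ^ 2 / 2))) := by
      refine le_trans ?_ (Real.add_one_le_exp _)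
      nlinarith [mul_le_mul_of_nonneg_left (exp_neg_le_quadratic hs0) hr0]
    refine (mul_le_mul_of_nonneg_left (pow_le_pow_left₀ (hbase s) hb _)
      (Real.exp_pos _).le).trans ?_
    rw [← Real.exp_nat_mul, ← Real.exp_add, Real.exp_le_exp]
    have e1 : h * tailEta * S.card ≤ h * (δ + ε) * S.card := by gcongr; linarith
    have e2 : s * (h * tailEta * S.card) ≤ s * (h * (δ + ε) * S.card) := by gcongr
    have e3 : s ^ 2 * (r₀ * S.card) ≤ s ^ 2 * (2 * h * S.card) := by gcongr
    have e4 : s ^ 2 * (h * S.card) = h * tailEta ^ 2 * S.card / 144 := by rw [hs]; ring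
    have e5 : s * (h * tailEta * S.card) = h * tailEta ^ 2 * S.card / 12 := by rw [hs]; ring
    nlinarith
  -- The parameter is `36`, matching `tailEta = exp (-36)`: the deviation gives `-6h(δ+ε)|S| ≤
  -- -3(δ+ε)|S|`, and the non-edges cost `(1-r₀) exp 36 ≤ δ + ε` per pair.
  · have hs0 : (0 : ℝ) ≤ 36 := by norm_num
    refine (prob_sum_lt_le_exp h0 h1 S hS hs0 _).trans ?_
    have hE : Real.exp (-36) * Real.exp 36 = 1 := by rw [← Real.exp_add]; simp
    have hb : r₀ * Real.exp (-36) + (1 - r₀) ≤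
        Real.exp (-36 + (1 - r₀) * Real.exp 36) := by
      rw [Real.exp_add]
      have h3 := mul_le_mul_of_nonneg_left (Real.add_one_le_exp ((1 - r₀) * Real.exp 36))
        (Real.exp_pos (-36)).le
      have h4 : Real.exp (-36) * ((1 - r₀) * Real.exp 36 + 1) =
        (1 - r₀) * (Real.exp (-36) * Real.exp 36) + Real.exp (-36) := by ring
      rw [h4, hE] at h3
      nlinarith [mul_le_mul_of_nonneg_right hr1 (Real.exp_pos (-36)).le]
    refine (mul_le_mul_of_nonneg_left (pow_le_pow_left₀ (hbase 36) hb _)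
      (Real.exp_pos _).le).trans ?_
    rw [← Real.exp_nat_mul, ← Real.exp_add, Real.exp_le_exp]
    have e1 : (1 - r₀) * Real.exp 36 ≤ ε + δ := by
      have h3 : 1 - r₀ ≤ Real.exp (-36) * (ε + δ) := by
        refine hrη.trans ?_
        rw [pow_two, mul_add]
        exact add_le_add le_rfl (mul_le_mul_of_nonneg_right hδη hδ)
      calc (1 - r₀) * Real.exp 36 ≤ Real.exp (-36) * (ε + δ) * Real.exp 36 := by gcongr
        _ = (Real.exp (-36) * Real.exp 36) * (ε + δ) := by ring
        _ = ε + δ := by rw [hE, one_mul]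
    have e2 := mul_le_mul_of_nonneg_left e1 hN
    have e3 : 1 / 2 * ((δ + ε) * S.card) ≤ h * ((δ + ε) * S.card) := by gcongr
    have e4 : r₀ * S.card ≤ 1 * S.card := by gcongr
    nlinarith

end Tail

/-! ### The parameter regime -/

/-- The assumptions on the parameters, with the absolute constants made explicit. -/
structure Regime (n k d D : ℕ) (p q ε obj : ℝ) : Prop where
  two_le_n : 2 ≤ n
  k_le_n : k ≤ n
  one_le_d : 1 ≤ d
  d_lt_D : 3 * d < D
  p_nonneg : 0 ≤ p
  p_lt_q : p < q
  q_le_one : q ≤ 1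
  le_density : 368640 / tailEta ^ 2 * (d * Real.log n) ≤ (k : ℝ) ^ 2 * (p + q)
  lt_eps : 640 / tailEta * d * Real.log n / ((D : ℝ) - 3 * d) < ε
  obj_le : obj ≤ (1 - ε) * (p + q) * (k.choose 2 : ℝ)

/-- The rate of the subsampling distribution. -/
def sampleRate (n d D : ℕ) : ℝ := Real.exp (-(320 * (d * Real.log n)) / ((D : ℝ) - 3 * d))

lemma four_mul_choose_two (k : ℕ) (hk : 2 ≤ k) : (k : ℝ) ^ 2 ≤ 4 * (k.choose 2 : ℝ) := by
  rw [Nat.cast_choose_two]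
  have : (2 : ℝ) ≤ k := by exact_mod_cast hk
  nlinarith

lemma choose_two_le_sq (k : ℕ) : 2 * (k.choose 2 : ℝ) ≤ (k : ℝ) ^ 2 := by
  rw [Nat.cast_choose_two]
  have : (0 : ℝ) ≤ k := Nat.cast_nonneg k
  nlinarith

namespace Regime

variable {n k d D : ℕ} {p q ε obj : ℝ} (h : Regime n k d D p q ε obj)
include h

lemma p_lt_one : p < 1 := h.p_lt_q.trans_le h.q_le_one
lemma q_pos : 0 < q := h.p_nonneg.trans_lt h.p_lt_q

lemma one_lt_n : (1 : ℝ) < n := by exact_mod_cast h.two_le_n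

lemma log_pos : 0 < Real.log n := Real.log_pos h.one_lt_n

lemma half_le_dlog : 1 / 2 ≤ d * Real.log n := by
  have h1 : (1 : ℝ) ≤ d := by exact_mod_cast h.one_le_d
  have h2 : Real.log 2 ≤ Real.log n :=
    Real.log_le_log (by norm_num) (by exact_mod_cast h.two_le_n)
  have h3 := Real.log_two_gt_d9
  nlinarith

lemma gap_pos : (0 : ℝ) < (D : ℝ) - 3 * d := by
  have : ((3 * d : ℕ) : ℝ) < D := by exact_mod_cast h.d_lt_D
  push_cast at this
  linarith

lemma eps_pos : 0 < ε := by
  refine lt_of_le_of_lt ?_ h.lt_eps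
  have h1 := h.gap_pos
  have h2 := h.log_pos
  have h3 := tailEta_pos
  positivity

lemma const_mul_le : 368640 * (d * Real.log n) ≤ 368640 / tailEta ^ 2 * (d * Real.log n) := by
  have h1 := h.half_le_dlog
  refine mul_le_mul_of_nonneg_right ?_ (by linarith)
  rw [le_div_iff₀ (pow_pos tailEta_pos 2)]
  have h2 := tailEta_pos
  have h3 := tailEta_le
  nlinarith

lemma two_le_k : 2 ≤ k := by
  by_contra hk
  have hk1 : (k : ℝ) ≤ 1 := by exact_mod_cast (by omega : k ≤ 1)
  have hk0 : (0 : ℝ) ≤ k := Nat.cast_nonneg k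
  have h1 := h.half_le_dlog
  have h2 := h.const_mul_le.trans h.le_density
  have h3 := h.p_lt_one
  have h4 := h.q_le_one
  have h5 : (k : ℝ) ^ 2 ≤ 1 := by nlinarith
  have h6 : (k : ℝ) ^ 2 * (p + q) ≤ 1 * (p + q) :=
    mul_le_mul_of_nonneg_right h5 (by linarith [h.p_nonneg, h.q_pos])
  linarith

lemma choose_pos : (0 : ℝ) < k.choose 2 := by
  exact_mod_cast Nat.choose_pos h.two_le_k

/-- The first case of `prob_sum_lt_le_exp_neg` with `t = 320 d log n`. The constant in the density
assumption is `368640 = 8 · 144 · 320`, where `8` pays for `k² ≤ 4 (k choose 2)` and for halving `p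
+ q`. -/
lemma density_bound : 144 * (320 * (d * Real.log n)) ≤
    (p + q) / 2 * tailEta ^ 2 * (k.choose 2 : ℝ) := by
  have h1 := h.le_density
  have h2 := four_mul_choose_two k h.two_le_k
  have h3 := pow_pos tailEta_pos 2
  have h4 : (k : ℝ) ^ 2 * (p + q) ≤ 4 * (k.choose 2 : ℝ) * (p + q) :=
    mul_le_mul_of_nonneg_right h2 (by linarith [h.p_nonneg, h.q_pos])
  rw [div_mul_eq_mul_div, div_le_iff₀ h3] at h1
  nlinarith

lemma sampleRate_pos : 0 < sampleRate n d D := Real.exp_pos _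

lemma sampleRate_lt_one : sampleRate n d D < 1 := by
  rw [sampleRate, Real.exp_lt_one_iff]
  exact div_neg_of_neg_of_pos (by linarith [h.half_le_dlog]) h.gap_pos

/-- This fixes the constant `640 / tailEta = 2 · 320 / tailEta`. The spare factor `2` lets two
rounds of sampling, of rate `θ²`, still lose at most `tailEta * ε`. -/
lemma one_sub_sampleRate_le : 1 - sampleRate n d D ≤ tailEta * ε / 2 := by
  have h1 := Real.add_one_le_exp (-(320 * (d * Real.log n)) / ((D : ℝ) - 3 * d))
  have h2 := h.lt_eps
  have h3 := tailEta_pos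
  have h4 : 320 * (d * Real.log n) / ((D : ℝ) - 3 * d) =
      tailEta / 2 * (640 / tailEta * d * Real.log n / ((D : ℝ) - 3 * d)) := by
    have := h.gap_pos.ne'
    field_simp
    ring
  rw [neg_div, h4] at h1
  rw [sampleRate, neg_div, h4]
  nlinarith

lemma exp_neg_eq : Real.exp (-(320 * (d * Real.log n))) = 1 / (n : ℝ) ^ (8 * (40 * d)) := by
  rw [Real.exp_neg, ← one_div]
  congr 1
  rw [show 320 * ((d : ℝ) * Real.log n) = ((8 * (40 * d) : ℕ) : ℝ) * Real.log n by
    push_cast; ring, Real.exp_nat_mul, Real.exp_log (by linarith [h.one_lt_n])]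

/-- The exponent in `sampleRate` is chosen to give equality at `m = D - 3d`, with `320 = 8 · 40`. -/
lemma sampleRate_pow_le {m : ℕ} (hm : D - 3 * d ≤ m) :
    sampleRate n d D ^ m ≤ 1 / (n : ℝ) ^ (8 * (40 * d)) := by
  rw [← h.exp_neg_eq, sampleRate, ← Real.exp_nat_mul, Real.exp_le_exp]
  have h1 : (D : ℝ) - 3 * d ≤ m := by
    have : (D : ℝ) ≤ m + (3 * d : ℕ) := by exact_mod_cast (by omega : D ≤ m + 3 * d)
    push_cast at this
    linarith
  have h2 := h.gap_pos
  rw [neg_div, mul_neg, neg_le_neg_iff]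
  calc 320 * (d * Real.log n) =
      ((D : ℝ) - 3 * d) * (320 * (d * Real.log n) / ((D : ℝ) - 3 * d)) := by
        rw [mul_div_assoc', mul_div_cancel_left₀ _ h2.ne']
    _ ≤ _ := by
        refine mul_le_mul_of_nonneg_right h1 (div_nonneg ?_ h2.le)
        linarith [h.half_le_dlog]

lemma obj_le_two_mul : obj ≤ 2 * (k.choose 2 : ℝ) := by
  refine h.obj_le.trans (mul_le_mul_of_nonneg_right ?_ h.choose_pos.le)
  have := h.eps_pos
  have := h.p_lt_one
  have := h.q_le_one
  have : 0 ≤ ε * (p + q) := mul_nonneg h.eps_pos.le (by linarith [h.p_nonneg, h.q_pos])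
  nlinarith

/-- Either `1 - p` is bounded below or the planted set has enough pairs for the upper tail of its
number of non-edges. -/
lemma large_or_many
    (hR : dksRefutable n k d (40 * d) p obj ∨
      368640 / tailEta ^ 2 * (d * Real.log n) ≤ (k : ℝ) ^ 2 * (p + q) * (ε + (1 - p))) :
    tailEta ≤ 1 - p ∨
      (1 - p ≤ tailEta ∧ 320 * (d * Real.log n) ≤ 2 * ((k.choose 2 : ℝ) * ((1 - p) + ε))) := by
  classical
  rcases le_total tailEta (1 - p) with hη | hη
  · exact Or.inl hη
  refine Or.inr ⟨hη, ?_⟩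
  have hε := h.eps_pos
  have hp1 := h.p_lt_one
  rcases hR with hR | hR
  · have hp : ∀ e : Edge n, 0 ≤ (fun _ : Edge n => p) e := fun _ => h.p_nonneg
    have hp' : ∀ e : Edge n, (fun _ : Edge n => p) e ≤ 1 := fun _ => hp1.le
    obtain ⟨K, -, hK⟩ := Finset.exists_subset_card_eq
      (show k ≤ (Finset.univ : Finset (Fin n)).card by simpa using h.k_le_n)
    have h1 := prob_add_prob_not (w := erWeight n p)
      (fun I => (dksSystem n k obj).HasRefutation d ((n : ℝ) ^ (40 * d)) I)
    rw [erWeight, sum_bernWeight] at h1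
    -- If `K` is complete, its indicator vector is feasible since `obj ≤ 2 (k choose 2)`, so the
    -- instance has no refutation. Hence `p^{(k choose 2)}` is at most the failure probability.
    have h2 : prob (bernWeight fun _ : Edge n => p) (fun I => ∀ e ∈ edgesIn K, I e = true) ≤
        prob (bernWeight fun _ : Edge n => p)
          (fun I => ¬ (dksSystem n k obj).HasRefutation d ((n : ℝ) ^ (40 * d)) I) := by
      refine prob_mono (bernWeight_nonneg hp hp') fun I hI hr => hr.not_feasible (indVec K) ?_
      refine feasible_indVec I hK ?_
      have : ∑ e ∈ edgesIn K, instVal I e = (k.choose 2 : ℝ) := by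
        rw [← hK, ← card_edgesIn, Finset.card_eq_sum_ones]
        push_cast
        exact Finset.sum_congr rfl fun e he => by simp [instVal, hI e he]
      rw [this]
      exact h.obj_le_two_mul
    have h3 : prob (bernWeight fun _ : Edge n => p) (fun I => ∀ e ∈ edgesIn K, I e = true) =
        p ^ (k.choose 2) := by
      have := sum_bernWeight_mul_prod_finset (fun _ : Edge n => p) (edgesIn K)
        (fun b => if b then 1 else 0)
      simp only [if_true, mul_one, Bool.false_eq_true, if_false, mul_zero, add_zero,
        Finset.prod_const, card_edgesIn, hK] at this
      rw [← this]
      refine Finset.sum_congr rfl fun I _ => ?_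
      rw [Finset.prod_ite_zero]
      split_ifs <;> simp
    have h4 : p ^ (k.choose 2) ≤ Real.exp (-(320 * (d * Real.log n))) := by
      rw [h.exp_neg_eq, ← h3]
      rw [dksRefutable, erWeight] at hR
      linarith
    have hη' := tailEta_le
    -- Valid because `1 - p ≤ tailEta ≤ 1/37`; it converts the bound on `p^{(k choose 2)}` into a
    -- lower bound on `2 (k choose 2)(1-p)`.
    have h5 : Real.exp (-(2 * (1 - p))) ≤ p := by
      have := exp_neg_le_quadratic (s := 2 * (1 - p)) (by linarith)
      nlinarith
    have h6 := (pow_le_pow_left₀ (Real.exp_pos _).le h5 (k.choose 2)).trans h4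
    rw [← Real.exp_nat_mul, Real.exp_le_exp] at h6
    have := mul_pos h.choose_pos hε
    nlinarith
  · have h1 := h.const_mul_le.trans hR
    have h2 := four_mul_choose_two k h.two_le_k
    have h3 : (k : ℝ) ^ 2 * ((p + q) * (ε + (1 - p))) ≤
        4 * (k.choose 2 : ℝ) * (2 * (ε + (1 - p))) := by
      refine mul_le_mul h2 ?_ ?_ (by linarith [h.choose_pos])
      · exact mul_le_mul_of_nonneg_right (by linarith [h.q_le_one]) (by linarith)
      · exact mul_nonneg (by linarith [h.p_nonneg, h.q_pos]) (by linarith)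
    have h4 := h.half_le_dlog
    nlinarith

/-- Lower tail of the number of edges inside a `k`-set. -/
lemma prob_edgesIn_lt_le
    (hR : dksRefutable n k d (40 * d) p obj ∨
      368640 / tailEta ^ 2 * (d * Real.log n) ≤ (k : ℝ) ^ 2 * (p + q) * (ε + (1 - p)))
    {K : Finset (Fin n)} (hK : K.card = k) {r : Edge n → ℝ} (h0 : ∀ e, 0 ≤ r e)
    (h1 : ∀ e, r e ≤ 1) {r₀ x : ℝ} (hr : ∀ e ∈ edgesIn K, r e = r₀) (hr0 : 0 ≤ r₀) (hr1 : r₀ ≤ 1)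
    (hrpq : r₀ ≤ p + q) (hrη : 1 - r₀ ≤ tailEta * ε + (1 - p) ^ 2)
    (hx : x ≤ r₀ * (k.choose 2 : ℝ) - (p + q) / 2 / 6 * ((1 - p) + ε) * (k.choose 2 : ℝ)) :
    prob (bernWeight r) (fun I => ∑ e ∈ edgesIn K, instVal I e < x) ≤
      1 / (n : ℝ) ^ (8 * (40 * d)) := by
  rw [← h.exp_neg_eq]
  have hp1 := h.p_lt_one
  have hcard : ((edgesIn K).card : ℝ) = (k.choose 2 : ℝ) := by rw [card_edgesIn, hK]
  refine (prob_mono (bernWeight_nonneg h0 h1) fun I hI => hI.trans_le hx).trans ?_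
  rw [← hcard]
  refine prob_sum_lt_le_exp_neg h0 h1 (edgesIn K) hr hr0 hr1 (by linarith [h.p_nonneg, h.q_pos])
    (by linarith) (by linarith) h.eps_pos.le hrη ?_
  rw [hcard]
  rcases h.large_or_many hR with h2 | ⟨h2, h3⟩
  · exact Or.inl ⟨h2, h.density_bound⟩
  · refine Or.inr ⟨h2, ?_, h3⟩
    have := tailEta_le
    linarith [h.p_lt_q]

end Regime

/-! ### Robust inference -/

/-- Probability of the pair `e` given the planted set `K`, with the planted edges thinned by `s`. -/
def plantRate {n : ℕ} (p q s : ℝ) (K : Finset (Fin n)) (e : Edge n) : ℝ :=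
  if e.1.1 ∈ K ∧ e.1.2 ∈ K then p + s * (q * (1 - p)) else p

/-- The planted distribution given `K`. -/
def plantCond {n : ℕ} (p q s : ℝ) (K : Finset (Fin n)) : (Edge n → Bool) → ℝ :=
  bernWeight (plantRate p q s K)

/-- Average over the `k`-sets. -/
def avgK (n k : ℕ) (f : Finset (Fin n) → ℝ) : ℝ :=
  (∑ K ∈ (Finset.univ : Finset (Fin n)).powersetCard k, f K) / (n.choose k : ℝ)

section AvgK

variable {n k : ℕ}

lemma expect_plantedWeight (p q : ℝ) (f : (Edge n → Bool) → ℝ) :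
    expect (plantedWeight n k p q) f = avgK n k fun K => expect (plantCond p q 1 K) f := by
  have h (K : Finset (Fin n)) : (fun e : Edge n =>
      if e.1.1 ∈ K ∧ e.1.2 ∈ K then 1 - (1 - p) * (1 - q) else p) = plantRate p q 1 K := by
    funext e
    rw [plantRate, show 1 - (1 - p) * (1 - q) = p + 1 * (q * (1 - p)) by ring]
  simp only [expect, plantedWeight, avgK, h, plantCond]
  simp_rw [div_mul_eq_mul_div, Finset.sum_mul]
  rw [← Finset.sum_div, Finset.sum_comm]

lemma choose_cast_pos (hk : k ≤ n) : (0 : ℝ) < n.choose k := by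
  exact_mod_cast Nat.choose_pos hk

lemma avgK_mono {f g : Finset (Fin n) → ℝ} (h : ∀ K, K.card = k → f K ≤ g K) :
    avgK n k f ≤ avgK n k g :=
  div_le_div_of_nonneg_right
    (Finset.sum_le_sum fun K hK => h K (Finset.mem_powersetCard.1 hK).2) (Nat.cast_nonneg _)

lemma avgK_const (hk : k ≤ n) (c : ℝ) : avgK n k (fun _ => c) = c := by
  rw [avgK, Finset.sum_const, Finset.card_powersetCard, Finset.card_univ, Fintype.card_fin,
    nsmul_eq_mul, mul_div_cancel_left₀ _ (choose_cast_pos hk).ne']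

lemma avgK_congr {f g : Finset (Fin n) → ℝ} (h : ∀ K, K.card = k → f K = g K) :
    avgK n k f = avgK n k g :=
  le_antisymm (avgK_mono fun K hK => (h K hK).le) (avgK_mono fun K hK => (h K hK).ge)

end AvgK

/-- Independent thinning multiplies the rates, so the part of the planted graph visible in `T` again
has a product law. -/
lemma expect_expect_and {ι : Type} [Fintype ι] [DecidableEq ι] (r : ι → ℝ) (s : ℝ)
    (F : (ι → Bool) → ℝ) :
    expect (bernWeight r) (fun I => expect (bernWeight fun _ => s) fun b =>
      F fun e => I e && b e) = expect (bernWeight fun e => r e * s) F := by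
  have := sum_sum_prod_comp (fun e => bitWeight (r e)) (fun _ : ι => bitWeight s)
    (fun _ a b => a && b) F
  simp only [expect, bernWeight_eq, Finset.mul_sum]
  refine Eq.trans (Finset.sum_congr rfl fun I _ => Finset.sum_congr rfl fun b _ => ?_)
    (this.trans (Finset.sum_congr rfl fun z _ => ?_))
  · ring
  · congr 1
    refine Finset.prod_congr rfl fun e _ => ?_
    cases z e
    · simp; ring
    · simp

/-- Finite sets as Boolean functions. -/
def finsetEquivBool (ι : Type) [Fintype ι] [DecidableEq ι] : Finset ι ≃ (ι → Bool) where
  toFun T e := decide (e ∈ T)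
  invFun b := {e | b e = true}
  left_inv T := by ext; simp
  right_inv b := by ext; simp

/-- The distribution of a random set that contains each element independently with probability
`s`. -/
def sampleWeight {ι : Type} [Fintype ι] [DecidableEq ι] (s : ℝ) (T : Finset ι) : ℝ :=
  bernWeight (fun _ => s) (finsetEquivBool ι T)

section Sample

variable {ι : Type} [Fintype ι] [DecidableEq ι]

lemma expect_sampleWeight (s : ℝ) (f : (ι → Bool) → ℝ) :
    expect (sampleWeight s) (fun T => f (finsetEquivBool ι T)) =
      expect (bernWeight fun _ => s) f :=
  Equiv.sum_comp (finsetEquivBool ι) fun b => bernWeight (fun _ => s) b * f b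

lemma sampleWeight_mem_stdSimplex {s : ℝ} (h0 : 0 ≤ s) (h1 : s ≤ 1) :
    sampleWeight s ∈ stdSimplex ℝ (Finset ι) :=
  ⟨fun _ => bernWeight_nonneg (fun _ => h0) (fun _ => h1) _,
    (Equiv.sum_comp (finsetEquivBool ι) (bernWeight fun _ => s)).trans (sum_bernWeight _)⟩

lemma prob_sampleWeight_subset (s : ℝ) (α : Finset ι) :
    prob (sampleWeight s) (fun T => α ⊆ T) = s ^ α.card := by
  classical
  rw [prob_eq_expect]
  have h1 := sum_bernWeight_mul_prod_finset (fun _ : ι => s) α (fun b => if b then 1 else 0)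
  simp only [if_true, mul_one, Bool.false_eq_true, if_false, mul_zero, add_zero,
    Finset.prod_const] at h1
  rw [← h1]
  refine Eq.trans ?_ (expect_sampleWeight s fun b => ∏ e ∈ α, if b e = true then (1 : ℝ) else 0)
  congr 1
  funext T
  rw [Finset.prod_ite_zero]
  simp [finsetEquivBool, Finset.subset_iff]

end Sample

/-- Number of edges of the sub-instance inside `S`. -/
def subScore {n : ℕ} (T : Finset (Edge n)) (y : T → Bool) (S : Finset (Fin n)) : ℝ :=
  ∑ e ∈ edgesIn S, if h : e ∈ T then (if y ⟨e, h⟩ then 1 else 0) else 0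

lemma exists_argmax_subScore {n k : ℕ} (hk : k ≤ n) (T : Finset (Edge n)) (y : T → Bool) :
    ∃ S : Finset (Fin n), S.card = k ∧ ∀ K : Finset (Fin n), K.card = k →
      subScore T y K ≤ subScore T y S := by
  have hne : ((Finset.univ : Finset (Fin n)).powersetCard k).Nonempty :=
    Finset.powersetCard_nonempty.2 (by simpa using hk)
  obtain ⟨S, hS, hmax⟩ := Finset.exists_max_image _ (subScore T y) hne
  exact ⟨S, (Finset.mem_powersetCard.1 hS).2, fun K hK =>
    hmax K (Finset.mem_powersetCard.2 ⟨Finset.subset_univ _, hK⟩)⟩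

section Rates

variable {n : ℕ} {p q s : ℝ} {K : Finset (Fin n)}

lemma plantRate_nonneg (hp : 0 ≤ p) (hp1 : p ≤ 1) (hq : 0 ≤ q) (hs : 0 ≤ s) (e : Edge n) :
    0 ≤ plantRate p q s K e := by
  rw [plantRate]
  split_ifs
  · have : 0 ≤ s * (q * (1 - p)) := mul_nonneg hs (mul_nonneg hq (by linarith))
    linarith
  · exact hp

lemma plantRate_le_one (hp1 : p ≤ 1) (hq : 0 ≤ q) (hq1 : q ≤ 1) (hs1 : s ≤ 1) (e : Edge n) :
    plantRate p q s K e ≤ 1 := by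
  rw [plantRate]
  split_ifs
  · have h1 : s * (q * (1 - p)) ≤ 1 * (q * (1 - p)) :=
      mul_le_mul_of_nonneg_right hs1 (mul_nonneg hq (by linarith))
    have h2 : q * (1 - p) ≤ 1 * (1 - p) := mul_le_mul_of_nonneg_right hq1 (by linarith)
    linarith
  · exact hp1

lemma plantRate_of_mem {e : Edge n} (he : e ∈ edgesIn K) :
    plantRate p q s K e = p + s * (q * (1 - p)) := if_pos (mem_edgesIn.1 he)

end Rates

namespace Regime

variable {n k d D : ℕ} {p q ε obj : ℝ} (h : Regime n k d D p q ε obj)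
include h

lemma plantCond_nonneg {s : ℝ} (hs : 0 ≤ s) (hs1 : s ≤ 1) (K : Finset (Fin n))
    (I : Edge n → Bool) : 0 ≤ plantCond p q s K I :=
  bernWeight_nonneg (plantRate_nonneg h.p_nonneg h.p_lt_one.le h.q_pos.le hs)
    (plantRate_le_one h.p_lt_one.le h.q_pos.le h.q_le_one hs1) I

/-- The planted density exceeds the objective with room to spare. -/
lemma gap_le {s : ℝ} (hs : 1 - s ≤ tailEta * ε) :
    (p + q) / 2 / 2 * ((1 - p) + ε) ≤ s * (p + q * (1 - p)) - (1 - ε) * ((p + q) / 2) := by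
  have h1 := h.eps_pos
  have h2 := tailEta_le
  have h3 := h.q_pos
  have h4 := h.p_nonneg
  have h5 := h.p_lt_q
  have h6 := h.q_le_one
  have h7 : 0 ≤ p + q * (1 - p) := by nlinarith
  have h8 : (1 - s) * (p + q * (1 - p)) ≤ tailEta * ε * (p + q * (1 - p)) :=
    mul_le_mul_of_nonneg_right hs h7
  have h9 : tailEta * ε * (p + q * (1 - p)) ≤ tailEta * ε * (p + q) :=
    mul_le_mul_of_nonneg_left (by nlinarith) (mul_nonneg tailEta_pos.le h1.le)
  have h10 : tailEta * (ε * (p + q)) ≤ 1 / 37 * (ε * (p + q)) :=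
    mul_le_mul_of_nonneg_right h2 (mul_nonneg h1.le (by linarith))
  -- At `s = 1` and `ε = 0` the two sides differ by `(2p(1-q) + (q-p)(1-p))/4`, which is where `p <
  -- q` enters. Half of the gain `ε(p+q)/2` absorbs the sampling loss.
  nlinarith [mul_nonneg h1.le (by linarith : 0 ≤ p + q), mul_nonneg h4 (sub_nonneg.2 h6),
    mul_nonneg (sub_nonneg.2 h5.le) (sub_nonneg.2 h.p_lt_one.le)]

lemma robustlyInferable
    (hR : dksRefutable n k d (40 * d) p obj ∨
      368640 / tailEta ^ 2 * (d * Real.log n) ≤ (k : ℝ) ^ 2 * (p + q) * (ε + (1 - p))) :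
    (dksSystem n k obj).RobustlyInferable (plantedWeight n k p q) (erWeight n p)
      (sampleWeight (sampleRate n d D)) (1 / (n : ℝ) ^ (8 * (40 * d))) := by
  classical
  choose S hS hmax using fun T : Finset (Edge n) => exists_argmax_subScore h.k_le_n T
  refine ⟨fun T y => indVec (S T y), ?_⟩
  rw [expect_plantedWeight]
  have hθ0 := h.sampleRate_pos
  have hθ1 := h.sampleRate_lt_one
  have hp := h.p_nonneg
  have hp1 := h.p_lt_one
  set θ := sampleRate n d D
  set N : ℝ := (k.choose 2 : ℝ)
  refine (avgK_const h.k_le_n _).symm.le.trans (avgK_mono fun K hK => ?_)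
  have hw := fun I => h.plantCond_nonneg zero_le_one le_rfl K I
  have hΘ := (sampleWeight_mem_stdSimplex (ι := Edge n) hθ0.le hθ1.le)
  let bad : (Edge n → Bool) → Prop := fun z => ∑ e ∈ edgesIn K, instVal z e < obj / 2
  -- The score counts only edges in `T`, and these persist after resampling. So the maximizer has at
  -- least as many edges in the new instance as `K` has in `T`.
  have hfeas (I : Edge n → Bool) (T : Finset (Edge n))
      (hb : ¬ bad fun e => I e && finsetEquivBool _ T e) (I' : Edge n → Bool) :
      (dksSystem n k obj).Feasible (resample T I I') (indVec (S T fun e => I e)) := by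
    refine feasible_indVec _ (hS _ _) ?_
    have h1 : subScore T (fun e => I e) (S T fun e => I e) ≤
        ∑ e ∈ edgesIn (S T fun e => I e), instVal (resample T I I') e := by
      refine Finset.sum_le_sum fun e _ => ?_
      by_cases he : e ∈ T
      · simp [he, instVal, resample]
      · simp only [he, dif_neg, not_false_eq_true, instVal]
        split_ifs <;> norm_num
    have h2 : subScore T (fun e => I e) K =
        ∑ e ∈ edgesIn K, instVal (fun e => I e && finsetEquivBool _ T e) e := by
      refine Finset.sum_congr rfl fun e _ => ?_
      by_cases he : e ∈ T <;> simp [he, instVal, finsetEquivBool]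
    have h3 := hmax T (fun e => I e) K hK
    have h4 := not_lt.1 hb
    linarith
  have hstep : expect (plantCond p q 1 K) (fun I => expect (sampleWeight θ) fun T =>
      1 - if bad (fun e => I e && finsetEquivBool _ T e) then 1 else 0) ≤
      expect (plantCond p q 1 K) (fun I => expect (sampleWeight θ) fun T =>
        prob (erWeight n p) fun I' =>
          (dksSystem n k obj).Feasible (resample T I I') (indVec (S T fun e => I e))) := by
    refine expect_mono hw fun I => expect_mono hΘ.1 fun T => ?_
    have hν := bernWeight_nonneg (ι := Edge n) (fun _ => hp) (fun _ => hp1.le)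
    split_ifs with hb
    · rw [sub_self]
      exact prob_nonneg hν _
    · rw [sub_zero]
      have := hfeas I T hb
      simp only [prob, this, if_true, erWeight]
      exact (sum_bernWeight _).ge
  refine le_trans ?_ hstep
  have hsplit : expect (plantCond p q 1 K) (fun I => expect (sampleWeight θ) fun T =>
      1 - if bad (fun e => I e && finsetEquivBool _ T e) then 1 else 0) =
      1 - prob (bernWeight fun e => plantRate p q 1 K e * θ) bad := by
    have h1 := expect_expect_and (plantRate p q 1 K) θ (fun z => 1 - if bad z then (1 : ℝ) else 0)
    have h2 (I : Edge n → Bool) := expect_sampleWeight θ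
      (fun b => 1 - if bad (fun e => I e && b e) then (1 : ℝ) else 0)
    simp_rw [h2, plantCond, h1]
    rw [prob_eq_expect]
    simp only [expect, mul_sub, Finset.sum_sub_distrib, mul_one, sum_bernWeight]
  rw [hsplit]
  have hθε : 1 - θ ≤ tailEta * ε := h.one_sub_sampleRate_le.trans (by
    have := mul_nonneg tailEta_pos.le h.eps_pos.le
    linarith)
  have hr0 (e : Edge n) := plantRate_nonneg (K := K) hp hp1.le h.q_pos.le zero_le_one e
  have hr1 (e : Edge n) := plantRate_le_one (K := K) hp1.le h.q_pos.le h.q_le_one (le_refl (1 : ℝ)) e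
  have hq := h.q_pos
  have hq1 := h.q_le_one
  have ha : 0 ≤ q * (1 - p) := mul_nonneg hq.le (by linarith)
  have hb : q * (1 - p) ≤ 1 - p := mul_le_of_le_one_left (by linarith) hq1
  have hsum : p + q * (1 - p) ≤ p + q := by nlinarith
  refine sub_le_sub_left (h.prob_edgesIn_lt_le hR hK (r₀ := (p + q * (1 - p)) * θ)
    (fun e => mul_nonneg (hr0 e) hθ0.le)
    (fun e => mul_le_one₀ (hr1 e) hθ0.le hθ1.le) (fun e he => ?_) (by positivity)
    (mul_le_one₀ (by linarith) hθ0.le hθ1.le) ?_ ?_ ?_) 1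
  · rw [plantRate_of_mem he, one_mul]
  · exact (mul_le_of_le_one_right (by linarith) hθ1.le).trans hsum
  -- Non-edges come from sampling, at rate at most `1 - θ ≤ tailEta * ε`, or from the planted graph,
  -- at rate `(1-p)(1-q) ≤ (1-p)²`.
  · have h1 : (1 - θ) * (p + q * (1 - p)) ≤ (1 - θ) * 1 :=
      mul_le_mul_of_nonneg_left (by linarith) (by linarith)
    have h2 : (1 - p) * (1 - q) ≤ (1 - p) * (1 - p) :=
      mul_le_mul_of_nonneg_left (by linarith [h.p_lt_q]) (by linarith)
    nlinarith
  · have h1 := h.obj_le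
    have h2 := mul_le_mul_of_nonneg_right (h.gap_le hθε) h.choose_pos.le
    have h3 : 0 ≤ (p + q) * ((1 - p) + ε) * N :=
      mul_nonneg (mul_nonneg (by linarith) (by linarith [h.eps_pos])) h.choose_pos.le
    simp only [N] at *
    nlinarith

end Regime

/-! ### The truncated ideal of the slice -/

section SliceIdeal

variable {n k : ℕ}

/-- Every monomial of `q`, multiplied by a polynomial of degree `c`, has degree at most `t`. -/
def FitsDegree (c t : ℕ) (q : MvPolynomial (Fin n) ℝ) : Prop :=
  ∀ s, coeff s q ≠ 0 → s.degree + c ≤ t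

namespace FitsDegree

variable {c t t' : ℕ} {q q' : MvPolynomial (Fin n) ℝ}

lemma zero : FitsDegree c t (0 : MvPolynomial (Fin n) ℝ) := fun s hs => absurd (coeff_zero s) hs

lemma mono (h : FitsDegree c t q) (ht : t ≤ t') : FitsDegree c t' q :=
  fun s hs => (h s hs).trans ht

lemma add (h : FitsDegree c t q) (h' : FitsDegree c t q') : FitsDegree c t (q + q') := by
  intro s hs
  by_cases h1 : coeff s q = 0
  · exact h' s fun h2 => hs (by rw [coeff_add, h1, h2, add_zero])
  · exact h s h1

lemma C_mul (h : FitsDegree c t q) (a : ℝ) : FitsDegree c t (C a * q) := by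
  intro s hs
  rw [coeff_C_mul] at hs
  exact h s (right_ne_zero_of_mul hs)

lemma mul (h : FitsDegree c t q) (h' : FitsDegree 0 t' q') : FitsDegree c (t + t') (q * q') := by
  classical
  intro s hs
  obtain ⟨a, ha, b, hb, rfl⟩ := Finset.mem_add.1 (support_mul q q' (mem_support_iff.2 hs))
  have h1 := h a (mem_support_iff.1 ha)
  have h2 := h' b (mem_support_iff.1 hb)
  rw [map_add]
  omega

lemma X (i : Fin n) : FitsDegree 0 1 (X i : MvPolynomial (Fin n) ℝ) := by
  intro s hs
  have : s = Finsupp.single i 1 := by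
    by_contra h
    exact hs (by rw [coeff_X, if_neg (Ne.symm h)])
  simp [this]

lemma one : FitsDegree 0 0 (1 : MvPolynomial (Fin n) ℝ) := by
  intro s hs
  have : s = 0 := by
    by_contra h
    exact hs (by rw [coeff_one, if_neg (Ne.symm h)])
  simp [this]

lemma sum {ι : Type} {s : Finset ι} {f : ι → MvPolynomial (Fin n) ℝ}
    (h : ∀ i ∈ s, FitsDegree c t (f i)) : FitsDegree c t (∑ i ∈ s, f i) := by
  classical
  induction s using Finset.induction_on with
  | empty => exact zero
  | insert a s ha ih =>
    rw [Finset.sum_insert ha]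
    exact (h a (by simp)).add (ih fun i hi => h i (by simp [hi]))

lemma of_totalDegree (h : c + q.totalDegree ≤ t) : FitsDegree c t q := by
  intro s hs
  have := le_totalDegree (mem_support_iff.2 hs)
  rw [Finsupp.degree_apply]
  change ∑ i ∈ s.support, s i ≤ _ at this
  omega

/-- The zero polynomial fits every bound, which is why `c ≤ t` has to be assumed here. -/
lemma totalDegree_le (h : FitsDegree c t q) (hc : c ≤ t) : c + q.totalDegree ≤ t := by
  have : q.totalDegree ≤ t - c := by
    refine Finset.sup_le fun s hs => ?_
    have := h s (mem_support_iff.1 hs)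
    rw [Finsupp.degree_apply] at this
    change ∑ i ∈ s.support, s i ≤ _
    omega
  omega

end FitsDegree

/-- `P` is a combination of the constraints of the slice `∑ xᵢ = k`, `xᵢ² = xᵢ` with all terms of
degree at most `t` and all coefficients of the multipliers at most `M`. -/
def SliceIdeal (k t : ℕ) (M : ℝ) (P : MvPolynomial (Fin n) ℝ) : Prop :=
  ∃ (q₀ : MvPolynomial (Fin n) ℝ) (q : Fin n → MvPolynomial (Fin n) ℝ),
    FitsDegree 1 t q₀ ∧ (∀ i, FitsDegree 2 t (q i)) ∧
    (∀ s, |coeff s q₀| ≤ M) ∧ (∀ i s, |coeff s (q i)| ≤ M) ∧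
    P = (∑ i, X i - C (k : ℝ)) * q₀ + ∑ i, (X i ^ 2 - X i) * q i

/-- `SliceIdeal` without a bound on the coefficients. -/
def SliceIdeal' (k t : ℕ) (P : MvPolynomial (Fin n) ℝ) : Prop :=
  ∃ (q₀ : MvPolynomial (Fin n) ℝ) (q : Fin n → MvPolynomial (Fin n) ℝ),
    FitsDegree 1 t q₀ ∧ (∀ i, FitsDegree 2 t (q i)) ∧
    P = (∑ i, X i - C (k : ℝ)) * q₀ + ∑ i, (X i ^ 2 - X i) * q i

lemma SliceIdeal.toUnbounded {t : ℕ} {M : ℝ} {P : MvPolynomial (Fin n) ℝ}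
    (h : SliceIdeal k t M P) : SliceIdeal' k t P := by
  obtain ⟨q₀, q, h1, h2, -, -, h5⟩ := h
  exact ⟨q₀, q, h1, h2, h5⟩

namespace SliceIdeal'

variable {t t' : ℕ} {P Q : MvPolynomial (Fin n) ℝ}

lemma zero : SliceIdeal' k t (0 : MvPolynomial (Fin n) ℝ) :=
  ⟨0, 0, .zero, fun _ => .zero, by simp⟩

lemma add (h : SliceIdeal' k t P) (h' : SliceIdeal' k t Q) : SliceIdeal' k t (P + Q) := by
  obtain ⟨q₀, q, h1, h2, rfl⟩ := h
  obtain ⟨r₀, r, h1', h2', rfl⟩ := h'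
  refine ⟨q₀ + r₀, q + r, h1.add h1', fun i => (h2 i).add (h2' i), ?_⟩
  simp only [Pi.add_apply, mul_add, Finset.sum_add_distrib]
  ring

lemma mul (h : SliceIdeal' k t P) (hQ : FitsDegree 0 t' Q) : SliceIdeal' k (t + t') (P * Q) := by
  obtain ⟨q₀, q, h1, h2, rfl⟩ := h
  refine ⟨q₀ * Q, fun i => q i * Q, h1.mul hQ, fun i => (h2 i).mul hQ, ?_⟩
  rw [add_mul, Finset.sum_mul]
  simp only [mul_assoc]

lemma C_mul (h : SliceIdeal' k t P) (a : ℝ) : SliceIdeal' k t (C a * P) := by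
  have := h.mul (Q := C a) (t' := 0) (by simpa using FitsDegree.one.C_mul a)
  rwa [mul_comm, add_zero] at this

lemma sum {ι : Type} {s : Finset ι} {f : ι → MvPolynomial (Fin n) ℝ}
    (h : ∀ i ∈ s, SliceIdeal' k t (f i)) : SliceIdeal' k t (∑ i ∈ s, f i) := by
  classical
  induction s using Finset.induction_on with
  | empty => exact zero
  | insert a s ha ih =>
    rw [Finset.sum_insert ha]
    exact (h a (by simp)).add (ih fun i hi => h i (by simp [hi]))

lemma eval_eq_zero (h : SliceIdeal' k t P) {x : Finset (Fin n)} (hx : x.card = k) :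
    eval (indVec x) P = 0 := by
  obtain ⟨q₀, q, -, -, rfl⟩ := h
  have h1 : eval (indVec x) (∑ i, X i - C (k : ℝ)) = 0 := by simp [indVec, hx]
  have h2 (i : Fin n) : eval (indVec x) (X i ^ 2 - X i) = 0 := by
    by_cases h : i ∈ x <;> simp [indVec, h]
  simp only [map_add, map_mul, map_sum, h1, h2, zero_mul, Finset.sum_const_zero, add_zero]

end SliceIdeal'

namespace SliceIdeal

variable {t t' : ℕ} {M M' : ℝ} {P Q : MvPolynomial (Fin n) ℝ}

lemma zero (hM : 0 ≤ M) : SliceIdeal k t M (0 : MvPolynomial (Fin n) ℝ) :=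
  ⟨0, 0, .zero, fun _ => .zero, by simpa, fun _ => by simpa, by simp⟩

lemma mono (h : SliceIdeal k t M P) (ht : t ≤ t') (hM : M ≤ M') : SliceIdeal k t' M' P := by
  obtain ⟨q₀, q, h1, h2, h3, h4, rfl⟩ := h
  exact ⟨q₀, q, h1.mono ht, fun i => (h2 i).mono ht, fun s => (h3 s).trans hM,
    fun i s => (h4 i s).trans hM, rfl⟩

lemma add (h : SliceIdeal k t M P) (h' : SliceIdeal k t M' Q) :
    SliceIdeal k t (M + M') (P + Q) := by
  obtain ⟨q₀, q, h1, h2, h3, h4, rfl⟩ := h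
  obtain ⟨r₀, r, h1', h2', h3', h4', rfl⟩ := h'
  refine ⟨q₀ + r₀, q + r, h1.add h1', fun i => (h2 i).add (h2' i), fun s => ?_, fun i s => ?_, ?_⟩
  · rw [coeff_add]
    exact (abs_add_le _ _).trans (add_le_add (h3 s) (h3' s))
  · rw [Pi.add_apply, coeff_add]
    exact (abs_add_le _ _).trans (add_le_add (h4 i s) (h4' i s))
  · simp only [Pi.add_apply, mul_add, Finset.sum_add_distrib]
    ring

lemma C_mul (h : SliceIdeal k t M P) (a : ℝ) : SliceIdeal k t (|a| * M) (C a * P) := by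
  obtain ⟨q₀, q, h1, h2, h3, h4, rfl⟩ := h
  refine ⟨C a * q₀, fun i => C a * q i, h1.C_mul a, fun i => (h2 i).C_mul a,
    fun s => ?_, fun i s => ?_, ?_⟩
  · rw [coeff_C_mul, abs_mul]
    exact mul_le_mul_of_nonneg_left (h3 s) (abs_nonneg a)
  · rw [coeff_C_mul, abs_mul]
    exact mul_le_mul_of_nonneg_left (h4 i s) (abs_nonneg a)
  · rw [mul_add, Finset.mul_sum]
    congr 1
    · ring
    · exact Finset.sum_congr rfl fun i _ => by ring

/-- Multiplication by a variable only shifts coefficients, so the bound `M` does not grow. -/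
lemma X_mul (h : SliceIdeal k t M P) (hM : 0 ≤ M) (j : Fin n) :
    SliceIdeal k (t + 1) M (X j * P) := by
  obtain ⟨q₀, q, h1, h2, h3, h4, rfl⟩ := h
  have hc (r : MvPolynomial (Fin n) ℝ) (hr : ∀ s, |coeff s r| ≤ M) (s) :
      |coeff s (r * X j)| ≤ M := by
    rw [coeff_mul_X']
    split_ifs
    · exact hr _
    · simpa
  refine ⟨q₀ * X j, fun i => q i * X j, h1.mul (.X j), fun i => (h2 i).mul (.X j),
    hc _ h3, fun i => hc _ (h4 i), ?_⟩
  rw [mul_add, Finset.mul_sum]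
  congr 1
  · ring
  · exact Finset.sum_congr rfl fun i _ => by ring

end SliceIdeal

/-! ### Reduction to homogeneous multilinear polynomials -/

/-- The multilinear monomial of a set. -/
def setMono (U : Finset (Fin n)) : MvPolynomial (Fin n) ℝ := ∏ i ∈ U, X i

lemma eval_setMono (U x : Finset (Fin n)) :
    eval (indVec x) (setMono U) = if U ⊆ x then 1 else 0 := by
  simp only [setMono, map_prod, eval_X, indVec]
  rw [Finset.prod_ite_zero]
  simp [Finset.subset_iff]

lemma fitsDegree_setMono (U : Finset (Fin n)) : FitsDegree 0 U.card (setMono U) := by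
  classical
  induction U using Finset.induction_on with
  | empty => exact FitsDegree.one
  | insert a U ha ih =>
    rw [setMono, Finset.prod_insert ha, Finset.card_insert_of_notMem ha, mul_comm]
    exact ih.mul (.X a)

lemma abs_coeff_setMono_le (U : Finset (Fin n)) (s) : |coeff s (setMono U)| ≤ 1 := by
  classical
  induction U using Finset.induction_on generalizing s with
  | empty =>
    rw [setMono, Finset.prod_empty, coeff_one]
    split_ifs <;> simp
  | insert a U ha ih =>
    rw [setMono, Finset.prod_insert ha, mul_comm, coeff_mul_X']
    split_ifs
    · exact ih _
    · simp

lemma fits_shift {c t m : ℕ} {q : MvPolynomial (Fin n) ℝ} (h : FitsDegree 0 m q)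
    (hm : m + c ≤ t) : FitsDegree c t q := fun s hs => by
  have := h s hs
  omega

lemma bool_mul_mem (i : Fin n) {U : Finset (Fin n)} {t : ℕ} (ht : U.card + 2 ≤ t) :
    SliceIdeal k t 1 ((X i ^ 2 - X i) * setMono U) := by
  classical
  refine ⟨0, Pi.single i (setMono U), .zero, fun j => ?_, by simp, fun j s => ?_, ?_⟩
  · by_cases h : j = i
    · subst h; simpa using fits_shift (fitsDegree_setMono U) ht
    · simpa [h] using FitsDegree.zero
  · by_cases h : j = i
    · subst h; simpa using abs_coeff_setMono_le U s
    · simp [h]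
  · rw [mul_zero, zero_add, Finset.sum_eq_single i]
    · simp
    · intro j _ h; simp [h]
    · simp

lemma card_mul_mem {U : Finset (Fin n)} {t : ℕ} (ht : U.card + 1 ≤ t) :
    SliceIdeal k t 1 ((∑ i, X i - C (k : ℝ)) * setMono U) :=
  ⟨setMono U, 0, fits_shift (fitsDegree_setMono U) ht, fun _ => .zero, abs_coeff_setMono_le U,
    by simp, by simp⟩

lemma X_mul_setMono_sub_mem (i : Fin n) (U : Finset (Fin n)) :
    SliceIdeal k (U.card + 1) 1 (X i * setMono U - setMono (insert i U)) := by
  classical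
  by_cases h : i ∈ U
  · have h1 : setMono U = X i * setMono (U.erase i) := by
      rw [setMono, setMono, Finset.mul_prod_erase _ _ h]
    rw [Finset.insert_eq_of_mem h, h1,
      show X i * (X i * setMono (U.erase i)) - X i * setMono (U.erase i) =
        (X i ^ 2 - X i) * setMono (U.erase i) by ring]
    refine bool_mul_mem i ?_
    have := Finset.card_erase_add_one h
    omega
  · rw [setMono, setMono, Finset.prod_insert h, sub_self]
    exact SliceIdeal.zero zero_le_one

/-- Each variable of `S` is multiplied in at the cost of at most one Boolean constraint with
coefficient `1`. The set `U` is in effect the union, but only its size matters. -/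
lemma setMono_mul_sub_mem (S T : Finset (Fin n)) :
    ∃ U : Finset (Fin n), U.card ≤ S.card + T.card ∧
      SliceIdeal k (S.card + T.card) S.card (setMono S * setMono T - setMono U) := by
  classical
  induction S using Finset.induction_on with
  | empty =>
    refine ⟨T, by simp, ?_⟩
    simpa [setMono] using SliceIdeal.zero (le_refl (0 : ℝ))
  | insert a S ha ih =>
    obtain ⟨U, hU, h⟩ := ih
    refine ⟨insert a U, ?_, ?_⟩
    · have := Finset.card_insert_le a U
      rw [Finset.card_insert_of_notMem ha]
      omega
    · have h1 := (h.X_mul (Nat.cast_nonneg _) a).add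
        ((X_mul_setMono_sub_mem (k := k) a U).mono (by omega : _ ≤ S.card + T.card + 1) le_rfl)
      rw [Finset.card_insert_of_notMem ha]
      refine (show X a * (setMono S * setMono T - setMono U) +
        (X a * setMono U - setMono (insert a U)) =
        setMono (insert a S) * setMono T - setMono (insert a U) from ?_) ▸
        h1.mono (by omega) (by push_cast; exact le_rfl)
      rw [setMono, setMono, setMono, setMono, setMono, Finset.prod_insert ha]
      ring

lemma prod_X_sub_mem (j : ℕ) (w : Fin j → Fin n) :
    ∃ U : Finset (Fin n), U.card ≤ j ∧ SliceIdeal k j j (∏ i, X (w i) - setMono U) := by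
  classical
  induction j with
  | zero =>
    refine ⟨∅, by simp, ?_⟩
    simpa [setMono] using SliceIdeal.zero (le_refl (0 : ℝ))
  | succ j ih =>
    obtain ⟨U, hU, h⟩ := ih fun i => w i.succ
    refine ⟨insert (w 0) U, (Finset.card_insert_le _ _).trans (by omega), ?_⟩
    have h1 := (h.X_mul (Nat.cast_nonneg _) (w 0)).add
      ((X_mul_setMono_sub_mem (k := k) (w 0) U).mono (by omega : _ ≤ j + 1) le_rfl)
    rw [Fin.prod_univ_succ]
    refine (show X (w 0) * (∏ i : Fin j, X (w i.succ) - setMono U) +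
      (X (w 0) * setMono U - setMono (insert (w 0) U)) =
      X (w 0) * ∏ i : Fin j, X (w i.succ) - setMono (insert (w 0) U) from by ring) ▸
      h1.mono le_rfl (by push_cast; exact le_rfl)

/-- `P` is, modulo the truncated ideal, a homogeneous multilinear polynomial of degree `t`. -/
def Reduces (k t : ℕ) (M : ℝ) (P : MvPolynomial (Fin n) ℝ) : Prop :=
  ∃ h : Finset (Fin n) → ℝ, SliceIdeal k t M
    (P - ∑ S ∈ (Finset.univ : Finset (Fin n)).powersetCard t, C (h S) * setMono S)

namespace Reduces

variable {t : ℕ} {M M' : ℝ} {P Q : MvPolynomial (Fin n) ℝ}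

lemma mono (h : Reduces k t M P) (hM : M ≤ M') : Reduces k t M' P := by
  obtain ⟨f, hf⟩ := h
  exact ⟨f, hf.mono le_rfl hM⟩

lemma zero : Reduces k t 0 (0 : MvPolynomial (Fin n) ℝ) :=
  ⟨0, by simpa using SliceIdeal.zero le_rfl⟩

lemma of_mem (h : SliceIdeal k t M P) : Reduces k t M P := ⟨0, by simpa using h⟩

lemma add (h : Reduces k t M P) (h' : Reduces k t M' Q) : Reduces k t (M + M') (P + Q) := by
  obtain ⟨f, hf⟩ := h
  obtain ⟨g, hg⟩ := h'
  refine ⟨f + g, ?_⟩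
  convert hf.add hg using 1
  simp only [Pi.add_apply, C_add, add_mul, Finset.sum_add_distrib]
  ring

lemma C_mul (h : Reduces k t M P) (a : ℝ) : Reduces k t (|a| * M) (C a * P) := by
  obtain ⟨f, hf⟩ := h
  refine ⟨fun S => a * f S, ?_⟩
  convert hf.C_mul a using 1
  rw [mul_sub, Finset.mul_sum]
  simp only [MvPolynomial.C_mul, mul_assoc]

lemma sum {ι : Type} {s : Finset ι} {f : ι → MvPolynomial (Fin n) ℝ} {M : ι → ℝ}
    (h : ∀ i ∈ s, Reduces k t (M i) (f i)) :
    Reduces k t (∑ i ∈ s, M i) (∑ i ∈ s, f i) := by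
  classical
  induction s using Finset.induction_on with
  | empty => exact zero
  | insert a s ha ih =>
    rw [Finset.sum_insert ha, Finset.sum_insert ha]
    exact (h a (by simp)).add (ih fun i hi => h i (by simp [hi]))

/-- Modulo the ideal, `(k - |U|) x_U = ∑_{i ∉ U} x_{U ∪ {i}}`, which raises the degree by one. While
`|U| < t ≤ k` the divisor is at least `1`, so coefficients do not blow up. Summing over the at most
`n` extensions, plus `1 + |U|` for the constraints used, costs a factor `n + 1` per step. -/
lemma setMono (htk : t ≤ k) (m : ℕ) (U : Finset (Fin n)) (hU : U.card + m = t) :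
    Reduces k t (((n : ℝ) + 1) ^ m) (setMono U) := by
  classical
  induction m generalizing U with
  | zero =>
    refine ⟨fun S => if S = U then 1 else 0, ?_⟩
    rw [Finset.sum_eq_single U]
    · simpa using SliceIdeal.zero (zero_le_one)
    · intro S _ hS; simp [hS]
    · intro h
      exact absurd (Finset.mem_powersetCard.2 ⟨Finset.subset_univ _, by omega⟩) h
  | succ m ih =>
    have hlt : U.card < k := by omega
    have hpos : (1 : ℝ) ≤ (k : ℝ) - U.card := by
      have : ((U.card + 1 : ℕ) : ℝ) ≤ k := by exact_mod_cast hlt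
      push_cast at this
      linarith
    set c : ℝ := ((k : ℝ) - U.card)⁻¹ with hc
    have hc1 : |c| ≤ 1 := by
      rw [abs_of_nonneg (by positivity)]
      exact inv_le_one_of_one_le₀ hpos
    have e : (_root_.setMono U : MvPolynomial (Fin n) ℝ) =
        C (-c) * ((∑ i, X i - C (k : ℝ)) * _root_.setMono U) +
        (C c * ∑ i ∈ U, (X i * _root_.setMono U - _root_.setMono U) +
         C c * ∑ i ∈ Uᶜ, _root_.setMono (insert i U)) := by
      have h1 : ∑ i ∈ Uᶜ, (_root_.setMono (insert i U) : MvPolynomial (Fin n) ℝ) =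
          (∑ i ∈ Uᶜ, X i) * _root_.setMono U := by
        rw [Finset.sum_mul]
        refine Finset.sum_congr rfl fun i hi => ?_
        rw [_root_.setMono, _root_.setMono, Finset.prod_insert (Finset.mem_compl.1 hi)]
      have h2 : (∑ i, X i : MvPolynomial (Fin n) ℝ) = ∑ i ∈ U, X i + ∑ i ∈ Uᶜ, X i :=
        (Finset.sum_add_sum_compl U _).symm
      have h3 : (C c * (C (k : ℝ) - C (U.card : ℝ)) : MvPolynomial (Fin n) ℝ) = 1 := by
        rw [← C_sub, ← MvPolynomial.C_mul, hc, inv_mul_cancel₀ (by linarith), C_1]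
      rw [h1, h2, Finset.sum_sub_distrib, ← Finset.sum_mul, Finset.sum_const, nsmul_eq_mul, C_neg]
      have h4 : ((U.card : ℕ) : MvPolynomial (Fin n) ℝ) = C (U.card : ℝ) := by simp
      rw [h4]
      linear_combination (-(_root_.setMono U : MvPolynomial (Fin n) ℝ)) * h3
    have hA : Reduces k t 1 (C (-c) * ((∑ i, X i - C (k : ℝ)) * _root_.setMono U)) :=
      ((of_mem (card_mul_mem (by omega))).C_mul (-c)).mono (by rwa [abs_neg, mul_one])
    have hB : Reduces k t ((U.card : ℝ)) (C c * ∑ i ∈ U,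
        (X i * _root_.setMono U - _root_.setMono U)) := by
      have := sum (k := k) (t := t) (s := U) (M := fun _ => 1)
        (f := fun i => X i * _root_.setMono U - _root_.setMono U) fun i hi => by
          have := (X_mul_setMono_sub_mem (k := k) i U).mono (by omega : _ ≤ t) le_rfl
          rw [Finset.insert_eq_of_mem hi] at this
          exact of_mem this
      refine (this.C_mul c).mono ?_
      simp only [Finset.sum_const, nsmul_eq_mul, mul_one]
      exact mul_le_of_le_one_left (Nat.cast_nonneg _) hc1
    have hD : Reduces k t ((Uᶜ.card : ℝ) * ((n : ℝ) + 1) ^ m)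
        (C c * ∑ i ∈ Uᶜ, _root_.setMono (insert i U)) := by
      have := sum (k := k) (t := t) (s := Uᶜ) (M := fun _ => ((n : ℝ) + 1) ^ m)
        (f := fun i => _root_.setMono (insert i U)) fun i hi => ih _ (by
          rw [Finset.card_insert_of_notMem (Finset.mem_compl.1 hi)]; omega)
      refine (this.C_mul c).mono ?_
      simp only [Finset.sum_const, nsmul_eq_mul]
      exact mul_le_of_le_one_left (mul_nonneg (Nat.cast_nonneg _) (by positivity)) hc1
    rw [e]
    refine (hA.add (hB.add hD)).mono ?_
    have hn : (U.card : ℝ) + Uᶜ.card = n := by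
      have := Finset.card_add_card_compl U
      rw [Fintype.card_fin] at this
      exact_mod_cast this
    have h1 : (1 : ℝ) ≤ ((n : ℝ) + 1) ^ m := one_le_pow₀ (by linarith [Nat.cast_nonneg (α := ℝ) n])
    rw [pow_succ]
    nlinarith [mul_le_mul_of_nonneg_left h1 (Nat.cast_nonneg (α := ℝ) U.card)]

/-- The bound for the reduction of a monomial. -/
def bound (n t : ℕ) : ℝ := t + ((n : ℝ) + 1) ^ t

lemma setMono_of_le (htk : t ≤ k) {U : Finset (Fin n)} (hU : U.card ≤ t) :
    Reduces k t (((n : ℝ) + 1) ^ t) (_root_.setMono U) := by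
  refine (setMono htk (t - U.card) U (by omega)).mono ?_
  exact pow_le_pow_right₀ (by linarith [Nat.cast_nonneg (α := ℝ) n]) (Nat.sub_le _ _)

lemma prod_X (htk : t ≤ k) {j : ℕ} (hj : j ≤ t) (w : Fin j → Fin n) :
    Reduces k t (bound n t) (∏ i, MvPolynomial.X (w i)) := by
  obtain ⟨U, hU, h⟩ := prod_X_sub_mem (k := k) j w
  have := (of_mem (h.mono hj (Nat.cast_le.2 hj))).add (setMono_of_le htk (hU.trans hj))
  rwa [sub_add_cancel] at this

lemma setMono_mul (htk : t ≤ k) {S T : Finset (Fin n)} (h : S.card + T.card ≤ t) :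
    Reduces k t (bound n t) (_root_.setMono S * _root_.setMono T) := by
  obtain ⟨U, hU, hm⟩ := setMono_mul_sub_mem (k := k) S T
  have := (of_mem (hm.mono h (Nat.cast_le.2 (by omega : S.card ≤ t)))).add
    (setMono_of_le htk (hU.trans h))
  rwa [sub_add_cancel] at this

end Reduces

/-- A polynomial of degree less than `|U|` has vanishing alternating sum over the subsets of `U`. -/
lemma sum_powerset_neg_one_pow_eval {q : MvPolynomial (Fin n) ℝ} {U : Finset (Fin n)}
    (hq : FitsDegree 1 U.card q) :
    ∑ V ∈ U.powerset, (-1 : ℝ) ^ V.card * eval (indVec V) q = 0 := by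
  classical
  simp_rw [eval_eq, Finset.mul_sum]
  rw [Finset.sum_comm]
  refine Finset.sum_eq_zero fun s hs => ?_
  have hdeg := hq s (mem_support_iff.1 hs)
  have hcard : s.support.card ≤ s.degree := by
    rw [Finsupp.degree_apply, Finset.card_eq_sum_ones]
    exact Finset.sum_le_sum fun i hi => Nat.one_le_iff_ne_zero.2 (Finsupp.mem_support_iff.1 hi)
  -- Each monomial of `q` misses some `i ∈ U`, so the terms of `V` and `V ∪ {i}` cancel.
  obtain ⟨i, hiU, his⟩ : ∃ i ∈ U, i ∉ s.support :=
    Finset.exists_mem_notMem_of_card_lt_card (by omega)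
  rw [← Finset.insert_erase hiU, Finset.sum_powerset_insert (Finset.notMem_erase i U),
    ← Finset.sum_add_distrib]
  refine Finset.sum_eq_zero fun V hV => ?_
  have hiV : i ∉ V := fun h => Finset.notMem_erase i U (Finset.mem_powerset.1 hV h)
  have h1 : ∏ j ∈ s.support, indVec (insert i V) j ^ s j =
      ∏ j ∈ s.support, indVec V j ^ s j := by
    refine Finset.prod_congr rfl fun j hj => ?_
    have : j ≠ i := fun h => his (h ▸ hj)
    simp [indVec, this]
  rw [h1, Finset.card_insert_of_notMem hiV, pow_succ]
  ring

/-- A homogeneous multilinear polynomial of degree `t ≤ k` in the ideal truncated at `t` vanishes. -/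
lemma eq_zero_of_homogeneous_mem {t : ℕ} (htk : t ≤ k) {h : Finset (Fin n) → ℝ}
    (hm : SliceIdeal' k t
      (∑ S ∈ (Finset.univ : Finset (Fin n)).powersetCard t, C (h S) * setMono S))
    {U : Finset (Fin n)} (hU : U.card = t) : h U = 0 := by
  classical
  obtain ⟨q₀, q, h1, -, he⟩ := hm
  -- The identity is evaluated at all vertices of the cube, not only on the slice: the Boolean terms
  -- vanish everywhere and the cardinality constraint becomes the scalar `|V| - k`.
  have hev (V : Finset (Fin n)) :
      ∑ S ∈ (Finset.univ : Finset (Fin n)).powersetCard t, h S * (if S ⊆ V then 1 else 0) =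
        ((V.card : ℝ) - k) * eval (indVec V) q₀ := by
    have := congrArg (eval (indVec V)) he
    have h2 (i : Fin n) : eval (indVec V) (X i ^ 2 - X i) = 0 := by
      by_cases h : i ∈ V <;> simp [indVec, h]
    have h3 : eval (indVec V) (∑ i, X i - C (k : ℝ)) = (V.card : ℝ) - k := by simp [indVec]
    simpa only [map_sum, map_mul, eval_C, eval_setMono, map_add, h2, h3, zero_mul,
      Finset.sum_const_zero, add_zero] using this
  have hsmall (V : Finset (Fin n)) (hV : V.card < t) : eval (indVec V) q₀ = 0 := by
    have h2 := hev V
    rw [Finset.sum_eq_zero] at h2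
    · have h3 : (V.card : ℝ) - k ≠ 0 := by
        have : (V.card : ℝ) < k := by exact_mod_cast hV.trans_le htk
        linarith
      exact (mul_eq_zero.1 h2.symm).resolve_left h3
    · intro S hS
      have : ¬ S ⊆ V := fun hSV => by
        have := Finset.card_le_card hSV
        rw [(Finset.mem_powersetCard.1 hS).2] at this
        omega
      simp [this]
  -- The multiplier `q₀` vanishes on all proper subsets of `U` and has degree below `|U|`, so it
  -- vanishes at `U` too. Dividing by `|U| - k` would not work here, since `t = k` is allowed.
  have hq : eval (indVec U) q₀ = 0 := by
    have h2 := sum_powerset_neg_one_pow_eval (U := U) (hU ▸ h1)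
    rw [Finset.sum_eq_single U] at h2
    · simpa using h2
    · intro V hV hne
      have hss := Finset.card_lt_card ((Finset.mem_powerset.1 hV).ssubset_of_ne hne)
      rw [hsmall V (by omega), mul_zero]
    · simp
  have h2 := hev U
  rw [hq, mul_zero, Finset.sum_eq_single U] at h2
  · simpa using h2
  · intro S hS hne
    have : ¬ S ⊆ U := fun hSU => hne
      (Finset.eq_of_subset_of_card_le hSU (by rw [(Finset.mem_powersetCard.1 hS).2, hU]))
    simp [this]
  · intro h3
    exact absurd (Finset.mem_powersetCard.2 ⟨Finset.subset_univ _, hU⟩) h3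

end SliceIdeal

/-! ### Coefficients of a homogeneous multilinear polynomial bounded on a slice -/

section SliceBound

variable {V E : Type} [DecidableEq V] [NormedAddCommGroup E] [NormedSpace ℝ E]

/-- The factor by which the coefficients can exceed the values. -/
def sliceFactor : ℕ → ℝ
  | 0 => 1
  | d + 1 => 1 + 2 * ((d + 1 : ℕ) : ℝ) * sliceFactor d

lemma one_le_sliceFactor (d : ℕ) : 1 ≤ sliceFactor d := by
  induction d with
  | zero => exact le_rfl
  | succ d ih =>
    rw [sliceFactor]
    have : (0 : ℝ) ≤ 2 * ((d + 1 : ℕ) : ℝ) * sliceFactor d := by positivity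
    linarith

lemma sliceFactor_le {n d : ℕ} (h : 2 * d ≤ n) : sliceFactor d ≤ ((n : ℝ) + 1) ^ d := by
  induction d with
  | zero => simp [sliceFactor]
  | succ d ih =>
    have h1 := ih (by omega)
    have h2 := one_le_sliceFactor d
    have h3 : 2 * ((d + 1 : ℕ) : ℝ) ≤ n := by exact_mod_cast h
    rw [sliceFactor, pow_succ]
    calc 1 + 2 * ((d + 1 : ℕ) : ℝ) * sliceFactor d
        ≤ sliceFactor d + n * sliceFactor d := by gcongr
      _ = sliceFactor d * (n + 1) := by ring
      _ ≤ _ := by gcongr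

lemma sum_powersetCard_insert {i : V} {x : Finset V} (hi : i ∉ x) (d : ℕ) (c : Finset V → E) :
    ∑ S ∈ (insert i x).powersetCard (d + 1), c S =
      ∑ S ∈ x.powersetCard (d + 1), c S + ∑ S ∈ x.powersetCard d, c (insert i S) := by
  rw [Finset.powersetCard_succ_insert hi, Finset.sum_union, Finset.sum_image]
  · intro S hS T hT h
    have h1 : i ∉ S := fun h => hi ((Finset.mem_powersetCard.1 hS).1 h)
    have h2 : i ∉ T := fun h => hi ((Finset.mem_powersetCard.1 hT).1 h)
    rw [← Finset.erase_insert h1, ← Finset.erase_insert h2, h]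
  · rw [Finset.disjoint_left]
    intro S hS hS'
    obtain ⟨T, -, rfl⟩ := Finset.mem_image.1 hS'
    exact hi ((Finset.mem_powersetCard.1 hS).1 (Finset.mem_insert_self _ _))

/-- If `c` changes by at most `b` when one element is swapped, then `c S - c T` is bounded by
`|S \ T| b`. -/
lemma norm_sub_le_of_swap {Ω : Finset V} {d : ℕ} {c : Finset V → E} {b : ℝ}
    (h : ∀ i ∈ Ω, ∀ j ∈ Ω, ∀ R ⊆ Ω, i ≠ j → i ∉ R → j ∉ R → R.card = d →
      ‖c (insert i R) - c (insert j R)‖ ≤ b) (m : ℕ) :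
    ∀ S ⊆ Ω, ∀ T ⊆ Ω, S.card = d + 1 → T.card = d + 1 → (S \ T).card = m →
      ‖c S - c T‖ ≤ m * b := by
  induction m with
  | zero =>
    intro S _ T _ hSc hTc hm
    have h1 : S ⊆ T := Finset.sdiff_eq_empty_iff_subset.1 (Finset.card_eq_zero.1 hm)
    rw [Finset.eq_of_subset_of_card_le h1 (by omega)]
    simp
  | succ m ih =>
    intro S hS T hT hSc hTc hm
    obtain ⟨i, hi⟩ : (S \ T).Nonempty := Finset.card_pos.1 (by omega)
    have hm' : (T \ S).card = m + 1 := by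
      rw [← hm]; exact Finset.card_sdiff_comm (by omega)
    obtain ⟨j, hj⟩ : (T \ S).Nonempty := Finset.card_pos.1 (by omega)
    rw [Finset.mem_sdiff] at hi hj
    have hij : i ≠ j := fun h => hi.2 (h ▸ hj.1)
    have hjR : j ∉ S.erase i := fun h => hj.2 (Finset.mem_of_mem_erase h)
    have h1 := h i (hS hi.1) j (hT hj.1) (S.erase i) ((Finset.erase_subset _ _).trans hS) hij
      (Finset.notMem_erase _ _) hjR (by rw [Finset.card_erase_of_mem hi.1]; omega)
    rw [Finset.insert_erase hi.1] at h1
    have h2 := ih (insert j (S.erase i))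
      (Finset.insert_subset (hT hj.1) ((Finset.erase_subset _ _).trans hS)) T hT
      (by rw [Finset.card_insert_of_notMem hjR, Finset.card_erase_of_mem hi.1]; omega) hTc (by
        have : insert j (S.erase i) \ T = (S \ T).erase i := by
          ext a
          simp only [Finset.mem_sdiff, Finset.mem_insert, Finset.mem_erase]
          constructor
          · rintro ⟨rfl | ⟨h1, h2⟩, h3⟩
            · exact absurd hj.1 h3
            · exact ⟨h1, h2, h3⟩
          · rintro ⟨h1, h2, h3⟩
            exact ⟨Or.inr ⟨h1, h2⟩, h3⟩
        rw [this, Finset.card_erase_of_mem (Finset.mem_sdiff.2 hi), hm]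
        rfl)
    calc ‖c S - c T‖ = ‖(c S - c (insert j (S.erase i))) + (c (insert j (S.erase i)) - c T)‖ := by
          rw [sub_add_sub_cancel]
      _ ≤ b + m * b := (norm_add_le _ _).trans (add_le_add h1 h2)
      _ = ((m + 1 : ℕ) : ℝ) * b := by push_cast; ring

/-- Induction on the degree. For fixed `i ≠ j`, the differences `c (R ∪ {i}) - c (R ∪ {j})` are the
coefficients of a polynomial of degree one less, on the ground set without `i, j` and the slice `k -
1`; its values are differences of two old ones, hence at most `2M`. The conditions `d ≤ k` and `k +
d ≤ |Ω|` are inherited. So all coefficients are close to each other, and their average over the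
`d`-subsets of one `k`-set is at most `M`. Values in a normed space allow all squares of a sum of
squares to be treated at once. -/
lemma norm_coeff_le_of_slice (d : ℕ) : ∀ (Ω : Finset V) (k : ℕ) (c : Finset V → E) (M : ℝ),
    d ≤ k → k + d ≤ Ω.card →
    (∀ x ⊆ Ω, x.card = k → ‖∑ S ∈ x.powersetCard d, c S‖ ≤ M) →
    ∀ S ⊆ Ω, S.card = d → ‖c S‖ ≤ sliceFactor d * M := by
  induction d with
  | zero =>
    intro Ω k c M _ hk hM S _ hS
    obtain ⟨x, hx, hxc⟩ := Finset.exists_subset_card_eq (show k ≤ Ω.card by omega)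
    have := hM x hx hxc
    rw [Finset.powersetCard_zero, Finset.sum_singleton] at this
    rw [Finset.card_eq_zero.1 hS, sliceFactor, one_mul]
    exact this
  | succ d ih =>
    intro Ω k c M hdk hk hM S hS hSc
    obtain ⟨k, rfl⟩ : ∃ k', k = k' + 1 := ⟨k - 1, by omega⟩
    have hM0 : 0 ≤ M := by
      obtain ⟨x, hx, hxc⟩ := Finset.exists_subset_card_eq (show k + 1 ≤ Ω.card by omega)
      exact (norm_nonneg _).trans (hM x hx hxc)
    have hswap : ∀ i ∈ Ω, ∀ j ∈ Ω, ∀ R ⊆ Ω, i ≠ j → i ∉ R → j ∉ R → R.card = d →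
        ‖c (insert i R) - c (insert j R)‖ ≤ sliceFactor d * (2 * M) := by
      intro i hi j hj R hR hij hiR hjR hRc
      refine ih ((Ω.erase i).erase j) k (fun R => c (insert i R) - c (insert j R)) (2 * M)
        (by omega) ?_ ?_ R ?_ hRc
      · rw [Finset.card_erase_of_mem (Finset.mem_erase.2 ⟨hij.symm, hj⟩),
          Finset.card_erase_of_mem hi]
        omega
      · intro x hx hxc
        have hix : i ∉ x := fun h => by have := hx h; simp at this
        have hjx : j ∉ x := fun h => by have := hx h; simp at this
        have hxΩ : x ⊆ Ω := (hx.trans (Finset.erase_subset _ _)).trans (Finset.erase_subset _ _)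
        have h1 := hM (insert i x) (Finset.insert_subset hi hxΩ)
          (by rw [Finset.card_insert_of_notMem hix, hxc])
        have h2 := hM (insert j x) (Finset.insert_subset hj hxΩ)
          (by rw [Finset.card_insert_of_notMem hjx, hxc])
        rw [sum_powersetCard_insert hix] at h1
        rw [sum_powersetCard_insert hjx] at h2
        rw [Finset.sum_sub_distrib, two_mul]
        refine le_trans ?_ ((norm_sub_le _ _).trans (add_le_add h1 h2))
        rw [add_sub_add_left_eq_sub]
      · intro a ha
        refine Finset.mem_erase.2 ⟨fun h => hjR (h ▸ ha), Finset.mem_erase.2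
          ⟨fun h => hiR (h ▸ ha), hR ha⟩⟩
    obtain ⟨x, hx, hxc⟩ := Finset.exists_subset_card_eq (show k + 1 ≤ Ω.card by omega)
    set b : ℝ := sliceFactor d * (2 * M) with hb
    have hb0 : 0 ≤ b := by
      have := one_le_sliceFactor d
      positivity
    have hclose (T) (hT : T ∈ x.powersetCard (d + 1)) : ‖c S - c T‖ ≤ ((d + 1 : ℕ) : ℝ) * b := by
      rw [Finset.mem_powersetCard] at hT
      refine (norm_sub_le_of_swap hswap _ S hS T (hT.1.trans hx) hSc hT.2 rfl).trans ?_
      gcongr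
      exact (Finset.card_le_card Finset.sdiff_subset).trans hSc.le
    set N : ℕ := (x.powersetCard (d + 1)).card with hN
    have hN1 : (1 : ℝ) ≤ N := by
      rw [hN, Finset.card_powersetCard, hxc]
      exact_mod_cast Nat.choose_pos hdk
    -- Compare `c S` with the average of the coefficients inside `x`; only `N ≥ 1` is used for the
    -- number of these coefficients.
    have hsum : (N : ℝ) • c S = ∑ T ∈ x.powersetCard (d + 1), (c S - c T) +
        ∑ T ∈ x.powersetCard (d + 1), c T := by
      rw [Finset.sum_sub_distrib, sub_add_cancel, Finset.sum_const, Nat.cast_smul_eq_nsmul]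
    have h1 : (N : ℝ) * ‖c S‖ ≤ N * (((d + 1 : ℕ) : ℝ) * b) + M := by
      rw [← Real.norm_of_nonneg (Nat.cast_nonneg N : (0 : ℝ) ≤ N), ← norm_smul, hsum,
        Real.norm_of_nonneg (Nat.cast_nonneg N : (0 : ℝ) ≤ N)]
      refine (norm_add_le _ _).trans (add_le_add ?_ (hM x hx hxc))
      refine (norm_sum_le _ _).trans ((Finset.sum_le_sum hclose).trans ?_)
      rw [Finset.sum_const, nsmul_eq_mul]
    have h2 : (N : ℝ) * ‖c S‖ ≤ N * (((d + 1 : ℕ) : ℝ) * b + M) := by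
      nlinarith
    have h3 := le_of_mul_le_mul_left h2 (by linarith)
    rw [sliceFactor]
    refine h3.trans_eq ?_
    rw [hb]
    ring

end SliceBound

/-! ### From certificates to refutations with bounded numbers -/

section Certificate

variable {n k d : ℕ} {obj : ℝ}

/-- The degree condition on a certificate is stated through `degProg`, so bounding the degree of its
multipliers needs lower bounds on the degrees of the constraints. -/
lemma one_le_degProg_card (hn : 0 < n) : 1 ≤ degProg ((dksSystem n k obj).eqn none) := by
  classical
  have h : Finsupp.single (Sum.inl ⟨0, hn⟩ : Fin n ⊕ Edge n) 1 ∈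
      ((dksSystem n k obj).eqn none).support := by
    rw [mem_support_iff]
    have h0 : (0 : Fin n ⊕ Edge n →₀ ℕ) ≠ Finsupp.single (Sum.inl ⟨0, hn⟩) 1 := by
      intro h; simpa using DFunLike.congr_fun h (Sum.inl ⟨0, hn⟩)
    change coeff _ (∑ i, X (Sum.inl i) - C (k : ℝ)) ≠ 0
    rw [coeff_sub, coeff_sum, coeff_C, if_neg h0]
    simp [coeff_X, Finsupp.single_left_inj]
  refine le_trans ?_ (le_weightedTotalDegree
    (Sum.elim (fun _ => 1) (fun _ => 0) : Fin n ⊕ Edge n → ℕ) h)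
  simp [Finsupp.weight_single]

lemma two_le_degProg_bool (i : Fin n) : 2 ≤ degProg ((dksSystem n k obj).eqn (some i)) := by
  classical
  have h : Finsupp.single (Sum.inl i : Fin n ⊕ Edge n) 2 ∈
      ((dksSystem n k obj).eqn (some i)).support := by
    rw [mem_support_iff]
    have h0 : Finsupp.single (Sum.inl i : Fin n ⊕ Edge n) 1 ≠ Finsupp.single (Sum.inl i) 2 := by
      intro h; simpa using DFunLike.congr_fun h (Sum.inl i)
    simp [dksSystem, coeff_X_pow, coeff_X, h0]
  refine le_trans ?_ (le_weightedTotalDegree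
    (Sum.elim (fun _ => 1) (fun _ => 0) : Fin n ⊕ Edge n → ℕ) h)
  simp [Finsupp.weight_single]

lemma sum_atInst_eqn_mul (I : Edge n → Bool) (q : Option (Fin n) → MvPolynomial (Fin n) ℝ) :
    ∑ j, atInst I ((dksSystem n k obj).eqn j) * q j =
      (∑ i, X i - C (k : ℝ)) * q none + ∑ i, (X i ^ 2 - X i) * q (some i) := by
  simp only [Fintype.sum_option, atInst_dks_card, atInst_dks_bool]

lemma fitsDegree_mono (w : Word n d) : FitsDegree 0 d w.mono := by
  refine FitsDegree.of_totalDegree ?_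
  rw [zero_add, Word.mono]
  refine (totalDegree_finsetProd _ _).trans ?_
  simp only [totalDegree_X, Finset.sum_const, Finset.card_univ, Fintype.card_fin, smul_eq_mul,
    mul_one]
  exact Nat.lt_succ_iff.1 w.1.2

/-- A quadratic form with Gram coefficients is the sum of the squares of its coordinates. This
translates between matrices and vector-valued polynomials. -/
lemma sum_C_inner_mul {ι : Type} {m : ℕ} (s : Finset ι) (x : ι → EuclideanSpace ℝ (Fin m))
    (f : ι → MvPolynomial (Fin n) ℝ) :
    ∑ i ∈ s, ∑ j ∈ s, C (inner ℝ (x i) (x j)) * (f i * f j) =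
      ∑ a, (∑ i ∈ s, C (x i a) * f i) ^ 2 := by
  have h (a : Fin m) : (∑ i ∈ s, C (x i a) * f i) ^ 2 =
      ∑ i ∈ s, ∑ j ∈ s, C (x j a * x i a) * (f i * f j) := by
    rw [pow_two, Finset.sum_mul_sum]
    refine Finset.sum_congr rfl fun i _ => Finset.sum_congr rfl fun j _ => ?_
    rw [C_mul]
    ring
  simp_rw [h]
  conv_rhs => rw [Finset.sum_comm]
  refine Finset.sum_congr rfl fun i _ => ?_
  conv_rhs => rw [Finset.sum_comm]
  refine Finset.sum_congr rfl fun j _ => ?_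
  rw [← Finset.sum_mul, ← map_sum]
  simp [PiLp.inner_apply]

lemma gram_smul (c : ℝ) (M : Matrix (Word n d) (Word n d) ℝ) : gram (c • M) = C c * gram M := by
  simp only [gram, Matrix.smul_apply, smul_eq_mul, C_mul, Finset.mul_sum, mul_assoc]

lemma filter_subset_powersetCard (x : Finset (Fin n)) (d : ℕ) :
    ((Finset.univ : Finset (Fin n)).powersetCard d).filter (· ⊆ x) = x.powersetCard d := by
  ext S
  simp [Finset.mem_powersetCard, and_comm]

lemma exists_word_mono_eq {S : Finset (Fin n)} (hS : S.card = d) :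
    ∃ w : Word n d, w.mono = setMono S := by
  refine ⟨⟨Fin.last d, fun i => S.orderEmbOfFin hS i⟩, ?_⟩
  rw [Word.mono, setMono]
  refine Finset.prod_bij (fun i _ => S.orderEmbOfFin hS i)
    (fun i _ => Finset.orderEmbOfFin_mem S hS i)
    (fun i _ j _ h => (S.orderEmbOfFin hS).injective h) (fun b hb => ?_) fun _ _ => rfl
  have : b ∈ Set.range (S.orderEmbOfFin hS) := by
    rw [Finset.range_orderEmbOfFin]; exact hb
  obtain ⟨i, hi⟩ := this
  exact ⟨i, Finset.mem_univ _, hi⟩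

/-- Modulo the truncated ideal of the slice, a sum of squares whose values on the slice are at most
`M ^ 2` is a sum of squares of homogeneous multilinear polynomials with bounded coefficients. -/
lemma exists_bounded_gram (hdk : d ≤ k) (hkd : k + d ≤ n)
    {A : Matrix (Word n d) (Word n d) ℝ} (hA : A.PosSemidef) {M : ℝ} (hM : 0 ≤ M)
    (hval : ∀ x : Finset (Fin n), x.card = k → eval (indVec x) (gram A) ≤ M ^ 2) :
    ∃ (m : ℕ) (c : Finset (Fin n) → EuclideanSpace ℝ (Fin m)),
      (∀ S, S.card = d → ‖c S‖ ≤ sliceFactor d * M) ∧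
      SliceIdeal' k (2 * d) (gram A -
        ∑ S ∈ (Finset.univ : Finset (Fin n)).powersetCard d,
          ∑ T ∈ (Finset.univ : Finset (Fin n)).powersetCard d,
            C (inner ℝ (c S) (c T)) * (setMono S * setMono T)) := by
  classical
  obtain ⟨m, v, rfl⟩ := Matrix.posSemidef_iff_eq_sum_vecMulVec.1 hA
  have hred (w : Word n d) := Reduces.prod_X (k := k) hdk (Nat.lt_succ_iff.1 w.1.2) w.2
  choose r hr using hred
  set c : Finset (Fin n) → EuclideanSpace ℝ (Fin m) :=
    fun S => WithLp.toLp 2 fun a => ∑ w, v a w * r w S with hc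
  set pc := (Finset.univ : Finset (Fin n)).powersetCard d with hpc
  let P : Fin m → MvPolynomial (Fin n) ℝ := fun a => ∑ w, C (v a w) * w.mono
  let P' : Fin m → MvPolynomial (Fin n) ℝ := fun a => ∑ S ∈ pc, C (c S a) * setMono S
  have hgram : gram (∑ a, Matrix.vecMulVec (v a) (star (v a))) = ∑ a, P a ^ 2 := by
    have := sum_C_inner_mul (n := n) Finset.univ
      (fun w => (WithLp.toLp 2 fun a => v a w : EuclideanSpace ℝ (Fin m))) fun w : Word n d => w.mono
    refine Eq.trans ?_ this
    refine Finset.sum_congr rfl fun u _ => Finset.sum_congr rfl fun w _ => ?_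
    congr 2
    simp [Matrix.sum_apply, Matrix.vecMulVec_apply, PiLp.inner_apply, mul_comm]
  -- Replacing each word by its reduced form, linearly, keeps the same polynomial modulo the ideal
  -- truncated at `d`. The vectors `c S` collect the coefficients of all squares, and no bound on
  -- the original matrix is needed.
  have hdiff (a : Fin m) : SliceIdeal' k d (P a - P' a) := by
    have h1 : P a - P' a = ∑ w, C (v a w) * (w.mono - ∑ S ∈ pc, C (r w S) * setMono S) := by
      simp only [P, P', mul_sub, Finset.sum_sub_distrib, Finset.mul_sum]
      congr 1
      rw [Finset.sum_comm]
      refine Finset.sum_congr rfl fun S _ => ?_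
      simp only [hc, map_sum, Finset.sum_mul, C_mul, mul_assoc]
    rw [h1]
    exact SliceIdeal'.sum fun w _ => (hr w).toUnbounded.C_mul _
  have hfit (a : Fin m) : FitsDegree 0 d (P a + P' a) := by
    refine FitsDegree.add (FitsDegree.sum fun w _ => (fitsDegree_mono w).C_mul _)
      (FitsDegree.sum fun S hS => FitsDegree.C_mul ?_ _)
    have := fitsDegree_setMono S
    rwa [(Finset.mem_powersetCard.1 hS).2] at this
  refine ⟨m, c, fun S hS => ?_, ?_⟩
  · refine norm_coeff_le_of_slice d Finset.univ k c M hdk (by simpa using hkd) (fun x _ hx => ?_) S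
      (Finset.subset_univ _) hS
    refine le_of_sq_le_sq ?_ hM
    refine le_trans (le_of_eq ?_) (hval x hx)
    rw [hgram, EuclideanSpace.norm_sq_eq, map_sum]
    refine Finset.sum_congr rfl fun a _ => ?_
    have h1 : eval (indVec x) (P a) = eval (indVec x) (P' a) := by
      have := (hdiff a).eval_eq_zero hx
      rwa [map_sub, sub_eq_zero] at this
    rw [map_pow, h1, Real.norm_eq_abs, sq_abs]
    congr 1
    simp only [P', map_sum, map_mul, eval_C, eval_setMono, mul_ite, mul_one, mul_zero]
    rw [← Finset.sum_filter, hpc, filter_subset_powersetCard]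
    simp
  · rw [hgram, sum_C_inner_mul, ← Finset.sum_sub_distrib]
    refine SliceIdeal'.sum fun a _ => ?_
    -- `P² - P'² = (P + P')(P - P')`, an ideal element of degree `d` times a polynomial of degree
    -- `d`.
    have := (hdiff a).mul (hfit a)
    rwa [mul_comm, ← sq_sub_sq, ← two_mul] at this

/-- Realizing a sum of squares of homogeneous multilinear polynomials by a Gram matrix. -/
lemma exists_gram_eq {m : ℕ} (c : Finset (Fin n) → EuclideanSpace ℝ (Fin m)) {b : ℝ}
    (hb : ∀ S, S.card = d → ‖c S‖ ≤ b) :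
    ∃ A : Matrix (Word n d) (Word n d) ℝ, A.PosSemidef ∧
      (∀ u v, |A u v| ≤ ((n.choose d : ℝ) * b) ^ 2) ∧
      gram A = ∑ S ∈ (Finset.univ : Finset (Fin n)).powersetCard d,
          ∑ T ∈ (Finset.univ : Finset (Fin n)).powersetCard d,
            C (inner ℝ (c S) (c T)) * (setMono S * setMono T) := by
  classical
  have hw (S : Finset (Fin n)) : ∃ w : Word n d, S.card = d → w.mono = setMono S := by
    by_cases hS : S.card = d
    · obtain ⟨w, hw⟩ := exists_word_mono_eq hS
      exact ⟨w, fun _ => hw⟩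
    · exact ⟨⟨0, Fin.elim0⟩, fun h => absurd h hS⟩
  choose cw hcw using hw
  set pc := (Finset.univ : Finset (Fin n)).powersetCard d with hpc
  -- One word is chosen for each `d`-set. Summing over the sets assigned to `w` avoids proving that
  -- the choice is injective, at the price of the factor `n.choose d` in the bound.
  let y : Word n d → EuclideanSpace ℝ (Fin m) := fun w => ∑ S ∈ pc, if cw S = w then c S else 0
  have hy (w : Word n d) : ‖y w‖ ≤ (n.choose d : ℝ) * b := by
    refine (norm_sum_le _ _).trans ?_
    have : ∀ S ∈ pc, ‖if cw S = w then c S else 0‖ ≤ b := fun S hS => by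
      have h1 := hb S (Finset.mem_powersetCard.1 hS).2
      split_ifs
      · exact h1
      · simpa using (norm_nonneg _).trans h1
    refine (Finset.sum_le_sum this).trans ?_
    rw [Finset.sum_const, hpc, Finset.card_powersetCard, Finset.card_univ, Fintype.card_fin,
      nsmul_eq_mul]
  refine ⟨Matrix.gram ℝ y, Matrix.posSemidef_gram ℝ y, fun u v => ?_, ?_⟩
  · rw [pow_two]
    exact (abs_real_inner_le_norm _ _).trans
      (mul_le_mul (hy u) (hy v) (norm_nonneg _) ((norm_nonneg _).trans (hy u)))
  · have h1 := sum_C_inner_mul (n := n) Finset.univ y fun w : Word n d => w.mono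
    rw [sum_C_inner_mul]
    refine h1.trans (Finset.sum_congr rfl fun a _ => ?_)
    congr 1
    simp only [y, WithLp.ofLp_sum, Finset.sum_apply, map_sum, Finset.sum_mul]
    rw [Finset.sum_comm]
    refine Finset.sum_congr rfl fun S hS => ?_
    rw [Finset.sum_eq_single (cw S)]
    · rw [if_pos rfl, hcw S (Finset.mem_powersetCard.1 hS).2]
    · intro w _ hne
      rw [if_neg (Ne.symm hne)]
      simp
    · simp

lemma gram_zero_words (c : ℝ) : gram (fun _ _ => c : Matrix (Word n 0) (Word n 0) ℝ) = C c := by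
  have hu (w : Word n 0) : w = ⟨0, Fin.elim0⟩ := by
    obtain ⟨j, w⟩ := w
    obtain rfl : j = 0 := Subsingleton.elim (α := Fin 1) _ _
    congr
    funext i
    exact i.elim0
  unfold gram
  rw [Fintype.sum_eq_single ⟨0, Fin.elim0⟩ fun w hw => absurd (hu w) hw,
    Fintype.sum_eq_single ⟨0, Fin.elim0⟩ fun w hw => absurd (hu w) hw]
  simp [Word.mono]

lemma reduces_ineq (h2 : 2 ≤ 2 * d) (h2dk : 2 * d ≤ k) (I : Edge n → Bool) {γ : ℝ}
    (hγ : 0 ≤ obj - γ) :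
    Reduces k (2 * d) ((obj - γ + (n : ℝ) ^ 2) * Reduces.bound n (2 * d))
      (C (-γ) - atInst I (dksSystem n k obj).ineq) := by
  classical
  have hpow : (0 : ℝ) ≤ ((n : ℝ) + 1) ^ (2 * d) := by positivity
  have h1 : Reduces k (2 * d) ((obj - γ) * Reduces.bound n (2 * d))
      (C (obj - γ) * setMono (∅ : Finset (Fin n))) := by
    refine ((Reduces.setMono_of_le h2dk (U := ∅) (by simp)).C_mul (obj - γ)).mono ?_
    rw [abs_of_nonneg hγ, Reduces.bound]
    refine mul_le_mul_of_nonneg_left ?_ hγ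
    linarith [Nat.cast_nonneg (α := ℝ) (2 * d)]
  have hb : 0 ≤ Reduces.bound n (2 * d) := by
    rw [Reduces.bound]
    positivity
  have h3 (e : Edge n) : Reduces k (2 * d) (Reduces.bound n (2 * d))
      (C (instVal I e) * (setMono {e.1.1} * setMono {e.1.2})) := by
    refine ((Reduces.setMono_mul h2dk (S := {e.1.1}) (T := {e.1.2})
      (by simpa using h2)).C_mul (instVal I e)).mono ?_
    refine mul_le_of_le_one_left hb ?_
    rw [instVal]
    split_ifs <;> simp
  have h4 := (Reduces.sum (s := Finset.univ) fun e _ => h3 e).C_mul (-2)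
  have h5 := (h1.add h4).mono (M' := (obj - γ + (n : ℝ) ^ 2) * Reduces.bound n (2 * d)) (by
    rw [add_mul]
    refine add_le_add le_rfl ?_
    have hcard : (Fintype.card (Edge n) : ℝ) = (n.choose 2 : ℝ) := by
      have := card_edgesIn (Finset.univ : Finset (Fin n))
      rw [Finset.card_univ, Fintype.card_fin] at this
      rw [← this, ← Finset.card_univ]
      congr 2
      ext e
      simp [edgesIn]
    rw [Finset.sum_const, Finset.card_univ, nsmul_eq_mul, hcard, ← mul_assoc]
    refine mul_le_mul_of_nonneg_right ?_ hb
    simpa using choose_two_le_sq n)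
  convert h5 using 1
  rw [atInst_dks_ineq]
  simp only [setMono, Finset.prod_empty, Finset.prod_singleton, mul_one, C_sub, C_neg]
  rw [show (∑ e : Edge n, C (instVal I e) * (X e.1.1 * X e.1.2) : MvPolynomial (Fin n) ℝ) =
    ∑ e : Edge n, C (instVal I e) * X e.1.1 * X e.1.2 from
    Finset.sum_congr rfl fun e _ => (mul_assoc _ _ _).symm]
  ring

lemma numeric_bounds (hn : 2 ≤ n) (hd : 1 ≤ d) (hdn : 2 * d ≤ n) :
    ((n.choose d : ℝ) * (sliceFactor d * n)) ^ 2 ≤ (n : ℝ) ^ (8 * d) ∧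
    ((n : ℝ) ^ 2 + (n : ℝ) ^ 2 + (n : ℝ) ^ (8 * d)) * Reduces.bound n (2 * d) ≤
      (n : ℝ) ^ (15 * d) := by
  have h2 : (2 : ℝ) ≤ n := by exact_mod_cast hn
  have h1 : (1 : ℝ) ≤ n := by linarith
  have hsucc : (n : ℝ) + 1 ≤ (n : ℝ) ^ 2 := by nlinarith
  have hpow (m : ℕ) : ((n : ℝ) + 1) ^ m ≤ (n : ℝ) ^ (2 * m) := by
    rw [pow_mul]
    exact pow_le_pow_left₀ (by linarith) hsucc m
  have hup {a b : ℕ} (h : a ≤ b) : (n : ℝ) ^ a ≤ (n : ℝ) ^ b := pow_le_pow_right₀ h1 h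
  have hself (a : ℕ) : 2 * (n : ℝ) ^ a ≤ (n : ℝ) ^ (a + 1) := by
    rw [pow_succ, mul_comm]
    exact mul_le_mul_of_nonneg_left h2 (by positivity)
  constructor
  · have e1 : (n.choose d : ℝ) ≤ (n : ℝ) ^ d := by exact_mod_cast Nat.choose_le_pow n d
    have e2 := (sliceFactor_le hdn).trans (hpow d)
    have e3 : (n.choose d : ℝ) * (sliceFactor d * n) ≤
        (n : ℝ) ^ d * ((n : ℝ) ^ (2 * d) * (n : ℝ) ^ d) := by
      have := one_le_sliceFactor d
      have h3 : (n : ℝ) ≤ (n : ℝ) ^ d := le_self_pow₀ h1 (by omega)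
      gcongr
    calc _ ≤ ((n : ℝ) ^ d * ((n : ℝ) ^ (2 * d) * (n : ℝ) ^ d)) ^ 2 :=
          pow_le_pow_left₀ (by have := one_le_sliceFactor d; positivity) e3 2
      _ = (n : ℝ) ^ (8 * d) := by ring
  · have e1 : Reduces.bound n (2 * d) ≤ (n : ℝ) ^ (5 * d) := by
      rw [Reduces.bound]
      have e2 := hpow (2 * d)
      have e3 : ((2 * d : ℕ) : ℝ) ≤ (n : ℝ) ^ (2 * (2 * d)) := by
        refine le_trans (by exact_mod_cast hdn) (le_self_pow₀ h1 (by omega))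
      refine le_trans (by linarith) ((hself (2 * (2 * d))).trans (hup (by omega)))
    have e2 : (n : ℝ) ^ 2 + (n : ℝ) ^ 2 + (n : ℝ) ^ (8 * d) ≤ (n : ℝ) ^ (10 * d) := by
      have h3 : 2 * (n : ℝ) ^ 2 ≤ (n : ℝ) ^ (8 * d) := (hself 2).trans (hup (by omega))
      have h4 := (hself (8 * d)).trans (hup (by omega : 8 * d + 1 ≤ 10 * d))
      linarith
    calc _ ≤ (n : ℝ) ^ (10 * d) * (n : ℝ) ^ (5 * d) := by
          refine mul_le_mul e2 e1 ?_ (by positivity)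
          rw [Reduces.bound]
          positivity
      _ = (n : ℝ) ^ (15 * d) := by ring

lemma hasRefutation_of_hasCertificate (hn : 2 ≤ n) (hd : 1 ≤ d) (hk : k ≤ n) (h2dk : 2 * d ≤ k)
    (hkd : k + d ≤ n) (hobj : obj ≤ 2 * (k.choose 2 : ℝ)) (I : Edge n → Bool) {γ : ℝ}
    (hγ : 1 / (n : ℝ) ^ d ≤ γ) (hc : (dksSystem n k obj).HasCertificate d γ I) :
    (dksSystem n k obj).HasRefutation d ((n : ℝ) ^ (40 * d)) I := by
  classical
  obtain ⟨A, q, hA, hq, he⟩ := hc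
  have h1n : (1 : ℝ) ≤ n := by exact_mod_cast (by omega : 1 ≤ n)
  have hγ0 : 0 < γ := lt_of_lt_of_le (by positivity) hγ
  rw [sum_atInst_eqn_mul] at he
  have hmem : SliceIdeal' k (2 * d)
      ((∑ i, X i - C (k : ℝ)) * q none + ∑ i, (X i ^ 2 - X i) * q (some i)) := by
    refine ⟨q none, fun i => q (some i), .of_totalDegree ?_, fun i => .of_totalDegree ?_, rfl⟩
    · have := hq none
      have := one_le_degProg_card (n := n) (k := k) (obj := obj) (by omega)
      omega
    · have := hq (some i)
      have := two_le_degProg_bool (n := n) (k := k) (obj := obj) i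
      dsimp only
      omega
  have hk2 : obj ≤ (n : ℝ) ^ 2 := by
    refine (hobj.trans (choose_two_le_sq k)).trans ?_
    have : (k : ℝ) ≤ n := by exact_mod_cast hk
    gcongr
  have hval (x : Finset (Fin n)) (hx : x.card = k) :
      obj - γ - 2 * ∑ e ∈ edgesIn x, instVal I e = eval (indVec x) (gram A) := by
    have := congrArg (eval (indVec x)) he
    rw [map_add, hmem.eval_eq_zero hx, add_zero, map_sub, eval_C, eval_indVec_ineq] at this
    linarith
  have hinst (x : Finset (Fin n)) : 0 ≤ ∑ e ∈ edgesIn x, instVal I e :=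
    Finset.sum_nonneg fun e _ => by rw [instVal]; split_ifs <;> norm_num
  have hpos : 0 ≤ obj - γ := by
    obtain ⟨x, -, hx⟩ := Finset.exists_subset_card_eq
      (show k ≤ (Finset.univ : Finset (Fin n)).card by simpa using hk)
    have h1 := hval x hx
    have h2 := eval_gram_nonneg hA (indVec x)
    have h3 := hinst x
    linarith
  -- On the slice the sum of squares equals `obj - γ - xᵀAx ≤ obj ≤ n²`, so `M = n` works.
  obtain ⟨m, c, hcb, hcm⟩ := exists_bounded_gram (k := k) (by omega) hkd hA
    (Nat.cast_nonneg n) fun x hx => by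
      rw [← hval x hx]
      linarith [hinst x]
  obtain ⟨A', hA', hA'b, hA'g⟩ := exists_gram_eq c hcb
  obtain ⟨hnum1, hnum2⟩ := numeric_bounds hn hd (h2dk.trans hk)
  set G := ∑ S ∈ (Finset.univ : Finset (Fin n)).powersetCard d,
    ∑ T ∈ (Finset.univ : Finset (Fin n)).powersetCard d,
      C (inner ℝ (c S) (c T)) * (setMono S * setMono T) with hG
  have hredG : Reduces k (2 * d) ((n : ℝ) ^ (8 * d) * Reduces.bound n (2 * d)) (C (-1) * G) := by
    have hb : 0 ≤ Reduces.bound n (2 * d) := by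
      rw [Reduces.bound]
      positivity
    have h1 : Reduces k (2 * d) (∑ S ∈ (Finset.univ : Finset (Fin n)).powersetCard d,
        ∑ T ∈ (Finset.univ : Finset (Fin n)).powersetCard d,
          (sliceFactor d * n) ^ 2 * Reduces.bound n (2 * d)) G := by
      refine Reduces.sum fun S hS => Reduces.sum fun T hT => ?_
      rw [Finset.mem_powersetCard] at hS hT
      refine ((Reduces.setMono_mul h2dk (by omega)).C_mul _).mono
        (mul_le_mul_of_nonneg_right ?_ hb)
      rw [pow_two]
      exact (abs_real_inner_le_norm _ _).trans (mul_le_mul (hcb S hS.2) (hcb T hT.2)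
        (norm_nonneg _) ((norm_nonneg _).trans (hcb S hS.2)))
    refine (h1.C_mul (-1)).mono ?_
    simp only [Finset.sum_const, Finset.card_powersetCard, Finset.card_univ, Fintype.card_fin,
      nsmul_eq_mul, abs_neg, abs_one, one_mul]
    refine le_trans (le_of_eq ?_) (mul_le_mul_of_nonneg_right hnum1 hb)
    ring
  have hred := (reduces_ineq (obj := obj) (by omega) h2dk I hpos).add hredG
  have hsplit : C (-γ) - atInst I (dksSystem n k obj).ineq + C (-1) * G =
      (∑ i, X i - C (k : ℝ)) * q none + ∑ i, (X i ^ 2 - X i) * q (some i) + (gram A - G) := by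
    rw [he, C_neg, C_1]
    ring
  obtain ⟨h, hh⟩ := hred
  -- The reduced polynomial differs from the homogeneous remainder by an ideal element, and by the
  -- given certificate it is itself in the ideal truncated at `2d`. So the remainder is in the ideal
  -- and is zero. The unbounded multipliers `q` serve only as a proof of membership; the bounded
  -- ones come from the reduction.
  have hzero : ∀ S ∈ (Finset.univ : Finset (Fin n)).powersetCard (2 * d), h S = 0 := by
    intro S hS
    refine eq_zero_of_homogeneous_mem (k := k) h2dk ?_ (Finset.mem_powersetCard.1 hS).2
    have h1 := (hmem.add hcm).add (hh.toUnbounded.C_mul (-1))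
    rw [← hsplit] at h1
    convert h1 using 1
    rw [show (C (-1) : MvPolynomial (Fin n) ℝ) = -1 by simp]
    ring
  rw [Finset.sum_eq_zero fun S hS => by rw [hzero S hS, C_0, zero_mul], sub_zero] at hh
  have hbound : (obj - γ + (n : ℝ) ^ 2) * Reduces.bound n (2 * d) +
      (n : ℝ) ^ (8 * d) * Reduces.bound n (2 * d) ≤ (n : ℝ) ^ (15 * d) := by
    rw [← add_mul]
    refine le_trans (mul_le_mul_of_nonneg_right ?_ ?_) hnum2
    · linarith
    · rw [Reduces.bound]
      positivity
  obtain ⟨r₀, r, hr1, hr2, hr3, hr4, hr⟩ := (hh.mono le_rfl hbound).C_mul γ⁻¹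
  have hγinv : γ⁻¹ ≤ (n : ℝ) ^ d := by
    rw [inv_le_comm₀ hγ0 (by positivity), ← one_div]
    exact hγ
  have hγi0 : 0 ≤ γ⁻¹ := inv_nonneg.2 hγ0.le
  have hup {a b : ℕ} (h : a ≤ b) : (n : ℝ) ^ a ≤ (n : ℝ) ^ b := pow_le_pow_right₀ h1n h
  have hM : |γ⁻¹| * (n : ℝ) ^ (15 * d) ≤ (n : ℝ) ^ (40 * d) := by
    rw [abs_of_nonneg hγi0]
    calc γ⁻¹ * (n : ℝ) ^ (15 * d) ≤ (n : ℝ) ^ d * (n : ℝ) ^ (15 * d) := by gcongr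
      _ = (n : ℝ) ^ (16 * d) := by ring
      _ ≤ _ := hup (by omega)
  -- Dividing `-γ - h = G + ∑ g_j r_j` by `γ` gives a refutation in which the multiplier of the
  -- inequality is the constant `γ⁻¹`, a Gram matrix on the empty word; `γ⁻¹ ≤ n^d` keeps the
  -- numbers bounded.
  refine ⟨0, γ⁻¹ • A', fun _ _ => γ⁻¹, fun j => j.elim r₀ r, ?_, hA'.smul hγi0, ?_, ?_, ?_, ?_, ?_, ?_⟩
  · have := degProg_dks_ineq_le (n := n) (k := k) (obj := obj)
    omega
  · have : (fun _ _ => γ⁻¹ : Matrix (Word n 0) (Word n 0) ℝ) =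
        Matrix.vecMulVec (fun _ => √γ⁻¹) (star fun _ => √γ⁻¹) := by
      ext u v
      exact (Real.mul_self_sqrt hγi0).symm
    rw [this]
    exact Matrix.posSemidef_vecMulVec_self_star _
  · intro j
    cases j with
    | none =>
      have h1 := hr1.totalDegree_le (by omega)
      have h2 := degProg_dks_card_le (n := n) (k := k) (obj := obj)
      simp only [Option.elim]
      omega
    | some i =>
      have h1 := (hr2 i).totalDegree_le (by omega)
      have h2 := degProg_dks_bool_le (n := n) (k := k) (obj := obj) i
      simp only [Option.elim]
      omega
  · intro u v
    rw [Matrix.smul_apply, smul_eq_mul, abs_mul, abs_of_nonneg hγi0]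
    calc γ⁻¹ * |A' u v| ≤ (n : ℝ) ^ d * (n : ℝ) ^ (8 * d) :=
          mul_le_mul hγinv ((hA'b u v).trans hnum1) (abs_nonneg _) (by positivity)
      _ = (n : ℝ) ^ (9 * d) := by ring
      _ ≤ _ := hup (by omega)
  · intro u v
    rw [abs_of_nonneg hγi0]
    exact hγinv.trans (hup (by omega))
  · intro j s
    cases j with
    | none => exact (hr3 s).trans hM
    | some i => exact (hr4 i s).trans hM
  · rw [sum_atInst_eqn_mul, gram_smul, gram_zero_words]
    simp only [Option.elim]
    rw [hA'g, add_assoc, ← hr, C_neg, C_neg, C_1]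
    have : (C γ⁻¹ * C γ : MvPolynomial (Fin n) ℝ) = 1 := by
      rw [← C_mul, inv_mul_cancel₀ hγ0.ne', C_1]
    linear_combination this

end Certificate

/-! ### The largest non-negative eigenvalue -/

section LamMax

variable {m : Type} [Fintype m] [DecidableEq m]

open Matrix in
/-- The quadratic form of a matrix. -/
def quad (M : Matrix m m ℝ) (x : m → ℝ) : ℝ := x ⬝ᵥ (M *ᵥ x)

lemma quad_eq_sum (M : Matrix m m ℝ) (x : m → ℝ) :
    quad M x = ∑ u, ∑ v, M u v * (x u * x v) := by
  simp only [quad, dotProduct, Matrix.mulVec, Finset.mul_sum]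
  exact Finset.sum_congr rfl fun u _ => Finset.sum_congr rfl fun v _ => by ring

lemma spectrum_insert_bddAbove (M : Matrix m m ℝ) : BddAbove (insert 0 (spectrum ℝ M)) :=
  ((Matrix.finite_real_spectrum (A := M)).insert 0).bddAbove

lemma lamMaxPos_nonneg (M : Matrix m m ℝ) : 0 ≤ lamMaxPos M :=
  le_csSup (spectrum_insert_bddAbove M) (Set.mem_insert _ _)

lemma lamMaxPos_le {M : Matrix m m ℝ} {t : ℝ} (ht : 0 ≤ t)
    (h : ∀ x, quad M x ≤ t * ∑ u, x u ^ 2) : lamMaxPos M ≤ t := by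
  refine csSup_le (Set.insert_nonempty _ _) ?_
  rintro μ (rfl | hμ)
  · exact ht
  have hμ' : Module.End.HasEigenvalue (Matrix.toLin' M) μ := by
    rw [Module.End.hasEigenvalue_iff_mem_spectrum, Matrix.spectrum_toLin']
    exact hμ
  obtain ⟨x, hx⟩ := hμ'.exists_hasEigenvector
  have hx1 := hx.apply_eq_smul
  rw [Matrix.toLin'_apply] at hx1
  have h1 := h x
  have h2 : ∑ u, x u ^ 2 = dotProduct x x := by simp [dotProduct, pow_two]
  rw [quad, hx1, dotProduct_smul, smul_eq_mul, h2] at h1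
  have h3 : 0 < dotProduct x x := by
    rw [← h2]
    obtain ⟨u, hu⟩ := Function.ne_iff.1 hx.2
    exact Finset.sum_pos' (fun _ _ => sq_nonneg _) ⟨u, Finset.mem_univ _, pow_pos_of_ne hu⟩
  exact le_of_mul_le_mul_right h1 h3
where
  pow_pos_of_ne {a : ℝ} (h : a ≠ 0) : 0 < a ^ 2 := by positivity

lemma quad_le_lamMaxPos {M : Matrix m m ℝ} (hM : M.IsSymm) (x : m → ℝ) :
    quad M x ≤ lamMaxPos M * ∑ u, x u ^ 2 := by
  have hH : M.IsHermitian := by rwa [Matrix.IsHermitian, Matrix.conjTranspose_eq_transpose_of_trivial]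
  have hpsd : (algebraMap ℝ (Matrix m m ℝ) (lamMaxPos M) - M).PosSemidef := by
    rw [Matrix.posSemidef_iff_isHermitian_and_spectrum_nonneg]
    refine ⟨?_, ?_⟩
    · refine Matrix.IsHermitian.sub ?_ hH
      rw [Matrix.algebraMap_eq_diagonal]
      exact Matrix.isHermitian_diagonal _
    · rw [← spectrum.singleton_sub_eq]
      rintro y ⟨a, rfl, b, hb, rfl⟩
      exact sub_nonneg.2 (le_csSup (spectrum_insert_bddAbove M) (Set.mem_insert_of_mem _ hb))
  have h1 := hpsd.dotProduct_mulVec_nonneg x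
  have h2 : ∑ u, x u ^ 2 = dotProduct x x := by simp [dotProduct, pow_two]
  rw [Matrix.sub_mulVec, dotProduct_sub, star_trivial, Algebra.algebraMap_eq_smul_one,
    Matrix.smul_mulVec, Matrix.one_mulVec, dotProduct_smul, smul_eq_mul] at h1
  rw [quad, h2]
  linarith

/-- `λ⁺_max` of the symmetric part. -/
def lamSym (M : Matrix m m ℝ) : ℝ := lamMaxPos ((1 / 2 : ℝ) • (M + M.transpose))

lemma quad_symm_part (M : Matrix m m ℝ) (x : m → ℝ) :
    quad ((1 / 2 : ℝ) • (M + M.transpose)) x = quad M x := by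
  have h : ∑ u, ∑ v, M v u * (x u * x v) = ∑ u, ∑ v, M u v * (x u * x v) := by
    rw [Finset.sum_comm]
    exact Finset.sum_congr rfl fun u _ => Finset.sum_congr rfl fun v _ => by ring
  simp only [quad_eq_sum, Matrix.smul_apply, Matrix.add_apply, Matrix.transpose_apply, smul_eq_mul,
    add_mul, mul_add, Finset.sum_add_distrib]
  simp only [mul_assoc, ← Finset.mul_sum]
  rw [h]
  ring

lemma lamSym_nonneg (M : Matrix m m ℝ) : 0 ≤ lamSym M := lamMaxPos_nonneg _

lemma lamSym_le {M : Matrix m m ℝ} {t : ℝ} (ht : 0 ≤ t)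
    (h : ∀ x, quad M x ≤ t * ∑ u, x u ^ 2) : lamSym M ≤ t :=
  lamMaxPos_le ht fun x => (quad_symm_part M x).trans_le (h x)

lemma quad_le_lamSym (M : Matrix m m ℝ) (x : m → ℝ) :
    quad M x ≤ lamSym M * ∑ u, x u ^ 2 := by
  rw [← quad_symm_part M]
  refine quad_le_lamMaxPos ?_ x
  rw [Matrix.IsSymm, Matrix.transpose_smul, Matrix.transpose_add, Matrix.transpose_transpose,
    add_comm]

lemma quad_add (M N : Matrix m m ℝ) (x : m → ℝ) : quad (M + N) x = quad M x + quad N x := by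
  rw [quad, Matrix.add_mulVec, dotProduct_add]; rfl

lemma quad_smul (c : ℝ) (M : Matrix m m ℝ) (x : m → ℝ) : quad (c • M) x = c * quad M x := by
  rw [quad, Matrix.smul_mulVec, dotProduct_smul]; rfl

/-- Together with `lamSym_smul`, this is the sublinearity needed for the Hahn–Banach extension.
Passing to the symmetric part makes it available for all matrices. -/
lemma lamSym_add_le (M N : Matrix m m ℝ) : lamSym (M + N) ≤ lamSym M + lamSym N := by
  refine lamSym_le (add_nonneg (lamSym_nonneg _) (lamSym_nonneg _)) fun x => ?_
  rw [quad_add, add_mul]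
  exact add_le_add (quad_le_lamSym M x) (quad_le_lamSym N x)

lemma lamSym_smul_le {c : ℝ} (hc : 0 ≤ c) (M : Matrix m m ℝ) : lamSym (c • M) ≤ c * lamSym M := by
  refine lamSym_le (mul_nonneg hc (lamSym_nonneg _)) fun x => ?_
  rw [quad_smul, mul_assoc]
  exact mul_le_mul_of_nonneg_left (quad_le_lamSym M x) hc

lemma lamSym_smul {c : ℝ} (hc : 0 < c) (M : Matrix m m ℝ) : lamSym (c • M) = c * lamSym M := by
  refine le_antisymm (lamSym_smul_le hc.le M) ?_
  have := lamSym_smul_le (inv_nonneg.2 hc.le) (c • M)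
  rw [smul_smul, inv_mul_cancel₀ hc.ne', one_smul] at this
  rwa [← le_inv_mul_iff₀ hc]

/-- Bound by the Frobenius norm. -/
lemma lamSym_le_frobenius (M : Matrix m m ℝ) : lamSym M ≤ √(∑ u, ∑ v, M u v ^ 2) := by
  refine lamSym_le (Real.sqrt_nonneg _) fun x => ?_
  have h := Finset.sum_mul_sq_le_sq_mul_sq (Finset.univ : Finset (m × m)) (fun a => M a.1 a.2)
    (fun a => x a.1 * x a.2)
  have h1 : ∑ u, ∑ v, (x u * x v) ^ 2 = (∑ u, x u ^ 2) ^ 2 := by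
    rw [pow_two (∑ u, x u ^ 2), Finset.sum_mul_sum]
    simp only [mul_pow]
  have h2 : quad M x ^ 2 ≤ (∑ u, ∑ v, M u v ^ 2) * (∑ u, x u ^ 2) ^ 2 := by
    rw [quad_eq_sum, ← h1]
    simpa only [Fintype.sum_prod_type] using h
  refine (Real.le_sqrt_of_sq_le h2).trans_eq ?_
  have h0 : 0 ≤ ∑ u, ∑ v, M u v ^ 2 :=
    Finset.sum_nonneg fun u _ => Finset.sum_nonneg fun v _ => sq_nonneg _
  rw [Real.sqrt_mul h0,
    Real.sqrt_sq (Finset.sum_nonneg fun u _ => sq_nonneg _)]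

lemma lamMaxPos_eq_lamSym {M : Matrix m m ℝ} (hM : M.IsSymm) : lamMaxPos M = lamSym M := by
  rw [lamSym, hM]
  congr 1
  ext u v
  simp
  ring

end LamMax

/-! ### Noise and Fourier expansion on the biased cube -/

section Fourier

variable {ι : Type} [Fintype ι] [DecidableEq ι]

/-- The product weight with constant rate. -/
abbrev cubeWeight (ι : Type) [Fintype ι] (p : ℝ) : (ι → Bool) → ℝ := bernWeight fun _ => p

lemma cubeWeight_nonneg {p : ℝ} (h0 : 0 ≤ p) (h1 : p ≤ 1) (I : ι → Bool) : 0 ≤ cubeWeight ι p I :=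
  bernWeight_nonneg (fun _ => h0) (fun _ => h1) I

/-- Each coordinate is kept with probability `θ` and otherwise resampled with rate `p`. -/
def noiseKer (θ p : ℝ) (I J : ι → Bool) : ℝ :=
  ∏ e, ((if I e = J e then θ else 0) + (1 - θ) * bitWeight p (J e))

/-- The noise operator. -/
def noise (θ p : ℝ) (F : (ι → Bool) → ℝ) (I : ι → Bool) : ℝ := ∑ J, noiseKer θ p I J * F J

lemma noiseKer_nonneg {θ p : ℝ} (hθ : 0 ≤ θ) (hθ1 : θ ≤ 1) (hp : 0 ≤ p) (hp1 : p ≤ 1)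
    (I J : ι → Bool) : 0 ≤ noiseKer θ p I J := by
  refine Finset.prod_nonneg fun e _ => add_nonneg ?_
    (mul_nonneg (sub_nonneg.2 hθ1) (bitWeight_nonneg hp hp1 _))
  split_ifs
  exacts [hθ, le_rfl]

lemma sum_bernWeight_mul_noiseKer (r : ι → ℝ) (θ p : ℝ) (J : ι → Bool) :
    ∑ I, bernWeight r I * noiseKer θ p I J = bernWeight (fun e => θ * r e + (1 - θ) * p) J := by
  simp_rw [noiseKer]
  rw [sum_bernWeight_mul_prod r
    (fun e b => (if b = J e then θ else 0) + (1 - θ) * bitWeight p (J e)), bernWeight_eq]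
  refine Finset.prod_congr rfl fun e _ => ?_
  cases J e <;> simp <;> ring

lemma expect_noise (r : ι → ℝ) (θ p : ℝ) (F : (ι → Bool) → ℝ) :
    expect (bernWeight r) (noise θ p F) =
      expect (bernWeight fun e => θ * r e + (1 - θ) * p) F := by
  simp only [expect, noise, Finset.mul_sum, ← sum_bernWeight_mul_noiseKer, Finset.sum_mul]
  rw [Finset.sum_comm]
  exact Finset.sum_congr rfl fun J _ => Finset.sum_congr rfl fun I _ => by ring

lemma expect_cubeWeight_noise (θ p : ℝ) (F : (ι → Bool) → ℝ) :
    expect (cubeWeight ι p) (noise θ p F) = expect (cubeWeight ι p) F := by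
  rw [expect_noise]
  congr 2
  funext e
  ring

/-- An affine function of a bit before the noise that has a prescribed conditional expectation. -/
lemma expect_affine_mul_noise (r : ι → ℝ) {θ p a b : ℝ} (e₀ : ι)
    (h0 : r e₀ * (a + b) * ((1 - θ) * (1 - p)) + (1 - r e₀) * b * (θ + (1 - θ) * (1 - p)) = 0)
    (h1 : r e₀ * (a + b) * (θ + (1 - θ) * p) + (1 - r e₀) * b * ((1 - θ) * p) =
      θ * r e₀ + (1 - θ) * p) (F : (ι → Bool) → ℝ) :
    expect (bernWeight r) (fun I => (a * instVal I e₀ + b) * noise θ p F I) =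
      expect (bernWeight fun e => θ * r e + (1 - θ) * p) (fun J => instVal J e₀ * F J) := by
  -- Both weights factorize over coordinates. At `e₀` the hypotheses `h0` and `h1` are the cases of
  -- a false and a true noisy bit; together they say that `a I_{e₀} + b` has conditional expectation
  -- `J_{e₀}` given the noisy instance.
  have key (J : ι → Bool) : ∑ I, bernWeight r I * ((a * instVal I e₀ + b) * noiseKer θ p I J) =
      bernWeight (fun e => θ * r e + (1 - θ) * p) J * instVal J e₀ := by
    have h2 (I : ι → Bool) : (a * instVal I e₀ + b) * noiseKer θ p I J =
        ∏ e, (if e = e₀ then a * (if I e then 1 else 0) + b else 1) *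
          ((if I e = J e then θ else 0) + (1 - θ) * bitWeight p (J e)) := by
      rw [Finset.prod_mul_distrib, Finset.prod_ite_eq' Finset.univ e₀, if_pos (Finset.mem_univ _),
        noiseKer, instVal]
    have h3 : bernWeight (fun e => θ * r e + (1 - θ) * p) J * instVal J e₀ =
        ∏ e, bitWeight (θ * r e + (1 - θ) * p) (J e) *
          (if e = e₀ then (if J e then 1 else 0) else 1) := by
      rw [Finset.prod_mul_distrib, Finset.prod_ite_eq' Finset.univ e₀, if_pos (Finset.mem_univ _),
        bernWeight_eq, instVal]
    simp_rw [h2]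
    rw [sum_bernWeight_mul_prod r (fun e b' => (if e = e₀ then a * (if b' then 1 else 0) + b else 1) *
      ((if b' = J e then θ else 0) + (1 - θ) * bitWeight p (J e))), h3]
    refine Finset.prod_congr rfl fun e _ => ?_
    by_cases he : e = e₀
    · subst he
      cases J e
      · simp only [if_true, bitWeight_false, Bool.false_eq_true, if_false]
        simp only [Bool.true_eq_false, if_false]
        linear_combination h0
      · simp only [if_true, bitWeight_true, Bool.false_eq_true, if_false]
        linear_combination h1
    · cases J e <;> simp [he] <;> ring
  simp only [expect, noise]
  calc _ = ∑ J, (∑ I, bernWeight r I * ((a * instVal I e₀ + b) * noiseKer θ p I J)) * F J := by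
        simp only [Finset.mul_sum, Finset.sum_mul]
        rw [Finset.sum_comm]
        exact Finset.sum_congr rfl fun J _ => Finset.sum_congr rfl fun I _ => by ring
    _ = _ := Finset.sum_congr rfl fun J _ => by rw [key]; ring

/-- `I` on the coordinates chosen by `b`, and `I'` elsewhere. -/
def mixBits (b I I' : ι → Bool) : ι → Bool := fun e => if b e then I e else I' e

lemma noise_eq_expect_mixBits (θ p : ℝ) (F : (ι → Bool) → ℝ) (I : ι → Bool) :
    noise θ p F I = expect (bernWeight fun _ => θ) fun b => expect (cubeWeight ι p) fun I' =>
      F (mixBits b I I') := by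
  have := sum_sum_prod_comp (fun _ : ι => bitWeight θ) (fun _ : ι => bitWeight p)
    (fun e a b => if a then I e else b) F
  simp only [expect, bernWeight_eq, Finset.mul_sum, noise]
  refine Eq.trans (Finset.sum_congr rfl fun J _ => ?_) (this.symm.trans
    (Finset.sum_congr rfl fun b _ => Finset.sum_congr rfl fun I' _ => ?_))
  · congr 1
    refine Finset.prod_congr rfl fun e _ => ?_
    cases I e <;> cases J e <;> simp <;> ring
  · rw [mul_assoc]; rfl

/-- The normalized bit. -/
def bitChar (p : ℝ) (b : Bool) : ℝ := ((if b then 1 else 0) - p) / √(p * (1 - p))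

/-- The Fourier basis of the biased cube. -/
def chi (p : ℝ) (α : Finset ι) (I : ι → Bool) : ℝ := ∏ e ∈ α, bitChar p (I e)

/-- Fourier coefficient. -/
def fcoeff (p : ℝ) (F : (ι → Bool) → ℝ) (α : Finset ι) : ℝ :=
  expect (cubeWeight ι p) fun I => F I * chi p α I

lemma chi_eq_prod (p : ℝ) (α : Finset ι) (I : ι → Bool) :
    chi p α I = ∏ e, if e ∈ α then bitChar p (I e) else 1 := by
  rw [chi, Finset.prod_ite_mem, Finset.univ_inter]

variable {p : ℝ}

lemma noise_add (θ : ℝ) (F G : (ι → Bool) → ℝ) :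
    noise θ p (fun I => F I + G I) = fun I => noise θ p F I + noise θ p G I := by
  funext I
  simp [noise, mul_add, Finset.sum_add_distrib]

lemma noise_const_mul (θ c : ℝ) (F : (ι → Bool) → ℝ) :
    noise θ p (fun I => c * F I) = fun I => c * noise θ p F I := by
  funext I
  simp only [noise, Finset.mul_sum]
  exact Finset.sum_congr rfl fun J _ => by ring

lemma noise_sum {β : Type} (θ : ℝ) (s : Finset β) (F : β → (ι → Bool) → ℝ) :
    noise θ p (fun I => ∑ b ∈ s, F b I) = fun I => ∑ b ∈ s, noise θ p (F b) I := by
  funext I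
  simp only [noise, Finset.mul_sum]
  rw [Finset.sum_comm]

lemma fcoeff_add (F G : (ι → Bool) → ℝ) (α : Finset ι) :
    fcoeff p (fun I => F I + G I) α = fcoeff p F α + fcoeff p G α := by
  simp [fcoeff, add_mul, expect_add]

lemma fcoeff_const_mul (c : ℝ) (F : (ι → Bool) → ℝ) (α : Finset ι) :
    fcoeff p (fun I => c * F I) α = c * fcoeff p F α := by
  simp only [fcoeff, mul_assoc, expect_const_mul]

lemma fcoeff_sub (F G : (ι → Bool) → ℝ) (α : Finset ι) :
    fcoeff p (fun I => F I - G I) α = fcoeff p F α - fcoeff p G α := by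
  have := fcoeff_add (p := p) F (fun I => (-1) * G I) α
  rw [fcoeff_const_mul] at this
  simpa [sub_eq_add_neg] using this

/-! ### Orthonormal expansion, truncation and noise for `0 < p < 1`. -/

section Interior

variable (hp : 0 < p) (hp1 : p < 1)
include hp hp1

lemma sd_pos : 0 < √(p * (1 - p)) := Real.sqrt_pos.2 (mul_pos hp (sub_pos.2 hp1))

lemma sd_sq : √(p * (1 - p)) ^ 2 = p * (1 - p) :=
  Real.sq_sqrt (mul_pos hp (sub_pos.2 hp1)).le

lemma bitChar_mean : p * bitChar p true + (1 - p) * bitChar p false = 0 := by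
  have := (sd_pos hp hp1).ne'
  simp only [bitChar, if_true, Bool.false_eq_true, if_false]
  field_simp
  ring

lemma bitChar_var : p * bitChar p true ^ 2 + (1 - p) * bitChar p false ^ 2 = 1 := by
  have h := (sd_pos hp hp1).ne'
  have h2 := sd_sq hp hp1
  simp only [bitChar, if_true, Bool.false_eq_true, if_false, div_pow, h2]
  have hp0 := hp.ne'
  have hq0 : 1 - p ≠ 0 := (sub_pos.2 hp1).ne'
  field_simp
  ring

lemma expect_chi_mul_chi (α β : Finset ι) :
    expect (cubeWeight ι p) (fun I => chi p α I * chi p β I) = if α = β then 1 else 0 := by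
  have h1 := bitChar_mean hp hp1
  have h2 := bitChar_var hp hp1
  simp only [expect, chi_eq_prod, ← Finset.prod_mul_distrib]
  rw [sum_bernWeight_mul_prod (fun _ => p) (fun e b => (if e ∈ α then bitChar p b else 1) *
    (if e ∈ β then bitChar p b else 1))]
  split_ifs with h
  · subst h
    refine Finset.prod_eq_one fun e _ => ?_
    split_ifs
    · rw [← pow_two, ← pow_two]; exact h2
    · ring
  · obtain ⟨e, he⟩ : ∃ e, ¬ (e ∈ α ↔ e ∈ β) := by
      by_contra h3
      push Not at h3
      exact h (Finset.ext h3)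
    refine Finset.prod_eq_zero (Finset.mem_univ e) ?_
    by_cases h3 : e ∈ α <;> by_cases h4 : e ∈ β <;> simp only [h3, h4, if_true, if_false] at he ⊢
    · exact absurd trivial he
    · simpa using h1
    · simpa using h1
    · exact absurd trivial he

lemma sum_chi_mul_chi (I J : ι → Bool) :
    (∑ α : Finset ι, chi p α I * chi p α J) * cubeWeight ι p J = if I = J then 1 else 0 := by
  have h1 : ∑ α : Finset ι, chi p α I * chi p α J =
      ∏ e, (1 + bitChar p (I e) * bitChar p (J e)) := by
    rw [Finset.prod_one_add, Finset.powerset_univ]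
    exact Finset.sum_congr rfl fun α _ => by rw [chi, chi, Finset.prod_mul_distrib]
  have hs := (sd_pos hp hp1).ne'
  have hs2 := sd_sq hp hp1
  have h3 : p * (1 - p) ≠ 0 := (mul_pos hp (sub_pos.2 hp1)).ne'
  have h2 (a b : Bool) : (1 + bitChar p a * bitChar p b) * bitWeight p b = if a = b then 1 else 0 := by
    have h4 : bitChar p a * bitChar p b =
        ((if a then 1 else 0) - p) * ((if b then 1 else 0) - p) / (p * (1 - p)) := by
      rw [bitChar, bitChar, div_mul_div_comm, ← pow_two, hs2]
    rw [h4]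
    have hp0 := hp.ne'
    have hq0 : 1 - p ≠ 0 := (sub_pos.2 hp1).ne'
    cases a <;> cases b <;> simp [hp0, hq0] <;> field_simp <;> ring
  rw [h1, show cubeWeight ι p J = ∏ e, bitWeight p (J e) from bernWeight_eq _ _,
    ← Finset.prod_mul_distrib]
  simp_rw [h2]
  rw [Finset.prod_ite_zero]
  simp [funext_iff]

lemma fourier_inversion (F : (ι → Bool) → ℝ) (I : ι → Bool) :
    F I = ∑ α, fcoeff p F α * chi p α I := by
  have h1 : ∑ α, fcoeff p F α * chi p α I =
      ∑ J, F J * ((∑ α : Finset ι, chi p α I * chi p α J) * cubeWeight ι p J) := by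
    simp only [fcoeff, expect, Finset.sum_mul, Finset.mul_sum]
    rw [Finset.sum_comm]
    exact Finset.sum_congr rfl fun J _ => Finset.sum_congr rfl fun α _ => by ring
  rw [h1]
  simp_rw [sum_chi_mul_chi hp hp1]
  simp

lemma fcoeff_sum_chi (c : Finset ι → ℝ) (β : Finset ι) :
    fcoeff p (fun I => ∑ α, c α * chi p α I) β = c β := by
  simp only [fcoeff, Finset.sum_mul]
  rw [expect_sum]
  simp_rw [mul_assoc, expect_const_mul, expect_chi_mul_chi hp hp1]
  simp

lemma parseval (F : (ι → Bool) → ℝ) :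
    expect (cubeWeight ι p) (fun I => F I ^ 2) = ∑ α, fcoeff p F α ^ 2 := by
  have h (I : ι → Bool) : F I ^ 2 = ∑ α, fcoeff p F α * (F I * chi p α I) := by
    conv_lhs => rw [pow_two]; arg 2; rw [fourier_inversion hp hp1 F I]
    rw [Finset.mul_sum]
    exact Finset.sum_congr rfl fun α _ => by ring
  simp_rw [h]
  rw [expect_sum]
  refine Finset.sum_congr rfl fun α _ => ?_
  rw [expect_const_mul, pow_two]
  rfl

lemma noise_chi (θ : ℝ) (α : Finset ι) :
    noise θ p (chi p α) = fun I => θ ^ α.card * chi p α I := by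
  funext I
  have h1 := bitChar_mean hp hp1
  simp only [noise, chi_eq_prod, noiseKer, ← Finset.prod_mul_distrib]
  rw [sum_prod_pi (fun e b => ((if I e = b then θ else 0) + (1 - θ) * bitWeight p b) *
    (if e ∈ α then bitChar p b else 1))]
  have h2 : θ ^ α.card = ∏ e, if e ∈ α then θ else 1 := by
    rw [Finset.prod_ite_mem, Finset.univ_inter, Finset.prod_const]
  rw [h2, ← Finset.prod_mul_distrib]
  refine Finset.prod_congr rfl fun e _ => ?_
  rw [Fintype.sum_bool]
  by_cases he : e ∈ α
  · simp only [he, if_true, bitWeight_true, bitWeight_false]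
    cases I e
    · simp only [Bool.false_eq_true, if_false, if_true]
      linear_combination (1 - θ) * h1
    · simp only [Bool.true_eq_false, if_false, if_true]
      linear_combination (1 - θ) * h1
  · simp only [he, if_false, bitWeight_true, bitWeight_false]
    cases I e <;> simp <;> ring

lemma fcoeff_noise (θ : ℝ) (F : (ι → Bool) → ℝ) (α : Finset ι) :
    fcoeff p (noise θ p F) α = θ ^ α.card * fcoeff p F α := by
  have h : noise θ p F = fun I => ∑ β, (θ ^ β.card * fcoeff p F β) * chi p β I := by
    conv_lhs => rw [show F = fun I => ∑ β, fcoeff p F β * chi p β I from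
      funext (fourier_inversion hp hp1 F)]
    rw [noise_sum]
    funext I
    refine Finset.sum_congr rfl fun β _ => ?_
    rw [noise_const_mul, noise_chi hp hp1]
    ring
  rw [h, fcoeff_sum_chi hp hp1]

/-- The part of degree at most `m`. -/
def trunc (p : ℝ) (m : ℕ) (F : (ι → Bool) → ℝ) (I : ι → Bool) : ℝ :=
  ∑ α, (if α.card ≤ m then fcoeff p F α else 0) * chi p α I

lemma fcoeff_trunc (m : ℕ) (F : (ι → Bool) → ℝ) (α : Finset ι) :
    fcoeff p (trunc p m F) α = if α.card ≤ m then fcoeff p F α else 0 :=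
  fcoeff_sum_chi hp hp1 _ α

/-- Noise multiplies the coefficient of `α` by `θ^{|α|}`, which is at most `θ^m` on the levels
present in `F`. -/
lemma expect_noise_sq_le {θ : ℝ} (hθ : 0 ≤ θ) (hθ1 : θ ≤ 1) (m : ℕ) (F : (ι → Bool) → ℝ)
    (hF : ∀ α : Finset ι, α.card < m → fcoeff p F α = 0) :
    expect (cubeWeight ι p) (fun I => noise θ p F I ^ 2) ≤
      (θ ^ m) ^ 2 * expect (cubeWeight ι p) (fun I => F I ^ 2) := by
  rw [parseval hp hp1, parseval hp hp1, Finset.mul_sum]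
  refine Finset.sum_le_sum fun α _ => ?_
  rw [fcoeff_noise hp hp1, mul_pow]
  by_cases h : α.card < m
  · simp [hF α h]
  · refine mul_le_mul_of_nonneg_right ?_ (sq_nonneg _)
    exact pow_le_pow_left₀ (by positivity) (pow_le_pow_of_le_one hθ hθ1 (not_lt.1 h)) 2

lemma expect_trunc_sq_le (m : ℕ) (F : (ι → Bool) → ℝ) :
    expect (cubeWeight ι p) (fun I => trunc p m F I ^ 2) ≤
      expect (cubeWeight ι p) (fun I => F I ^ 2) := by
  rw [parseval hp hp1, parseval hp hp1]
  refine Finset.sum_le_sum fun α _ => ?_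
  rw [fcoeff_trunc hp hp1]
  split_ifs
  · exact le_rfl
  · simpa using sq_nonneg _

lemma expect_sub_trunc_sq_le (m : ℕ) (F : (ι → Bool) → ℝ) :
    expect (cubeWeight ι p) (fun I => (F I - trunc p m F I) ^ 2) ≤
      expect (cubeWeight ι p) (fun I => F I ^ 2) := by
  rw [parseval hp hp1, parseval hp hp1]
  refine Finset.sum_le_sum fun α _ => ?_
  rw [fcoeff_sub, fcoeff_trunc hp hp1]
  split_ifs
  · simpa using sq_nonneg _
  · simp

lemma fcoeff_sub_trunc (m : ℕ) (F : (ι → Bool) → ℝ) {α : Finset ι} (h : α.card ≤ m) :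
    fcoeff p (fun I => F I - trunc p m F I) α = 0 := by
  rw [fcoeff_sub, fcoeff_trunc hp hp1, if_pos h, sub_self]

/-- Multiplication by a bit moves a character by at most one level. This is why truncation and
multiplication commute except on the two levels next to the cutoff. -/
lemma instVal_mul_chi (e : ι) (β : Finset ι) (I : ι → Bool) :
    instVal I e * chi p β I = if e ∈ β then
      (1 - p) * chi p β I + √(p * (1 - p)) * chi p (β.erase e) I else
      p * chi p β I + √(p * (1 - p)) * chi p (insert e β) I := by
  have hs := (sd_pos hp hp1).ne'
  have hs2 := sd_sq hp hp1
  split_ifs with h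
  · rw [show chi p β I = bitChar p (I e) * chi p (β.erase e) I from
      (Finset.mul_prod_erase β (fun e => bitChar p (I e)) h).symm]
    have : instVal I e * bitChar p (I e) = (1 - p) * bitChar p (I e) + √(p * (1 - p)) := by
      rw [instVal, bitChar]
      cases I e <;> simp <;> field_simp <;> rw [hs2] <;> ring
    linear_combination chi p (β.erase e) I * this
  · rw [show chi p (insert e β) I = bitChar p (I e) * chi p β I by
      rw [chi, chi, Finset.prod_insert h]]
    have : instVal I e = p + √(p * (1 - p)) * bitChar p (I e) := by
      rw [instVal, bitChar, mul_div_cancel₀ _ hs]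
      ring
    linear_combination chi p β I * this

lemma fcoeff_instVal_mul (e : ι) (F : (ι → Bool) → ℝ) (β : Finset ι) :
    fcoeff p (fun I => instVal I e * F I) β = if e ∈ β then
      (1 - p) * fcoeff p F β + √(p * (1 - p)) * fcoeff p F (β.erase e) else
      p * fcoeff p F β + √(p * (1 - p)) * fcoeff p F (insert e β) := by
  have h (I : ι → Bool) : instVal I e * F I * chi p β I = F I * (instVal I e * chi p β I) := by ring
  simp only [fcoeff, h, instVal_mul_chi hp hp1]
  split_ifs
  · rw [← expect_const_mul, ← expect_const_mul, ← expect_add]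
    congr 1
    funext I
    ring
  · rw [← expect_const_mul, ← expect_const_mul, ← expect_add]
    congr 1
    funext I
    ring

/-- The commutator of truncation and multiplication by a bit. -/
def truncComm (p : ℝ) (m : ℕ) (e : ι) (F : (ι → Bool) → ℝ) (I : ι → Bool) : ℝ :=
  instVal I e * trunc p m F I - trunc p m (fun I => instVal I e * F I) I

/-- Below level `m`, every coefficient entering either product has level at most `m` and is
untouched by truncation. With `fcoeff_truncComm_of_gt`, the commutator is confined to the levels `m`
and `m + 1`: low enough for the spectral bound and high enough to be damped by noise. -/
lemma fcoeff_truncComm_of_lt (m : ℕ) (e : ι) (F : (ι → Bool) → ℝ) {β : Finset ι}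
    (h : β.card < m) : fcoeff p (truncComm p m e F) β = 0 := by
  have h1 : fcoeff p (truncComm p m e F) β = _ := fcoeff_sub _ _ β
  rw [h1, fcoeff_trunc hp hp1, if_pos h.le, fcoeff_instVal_mul hp hp1,
    fcoeff_instVal_mul hp hp1]
  split_ifs with he
  · rw [fcoeff_trunc hp hp1, fcoeff_trunc hp hp1, if_pos h.le,
      if_pos ((Finset.card_erase_le).trans h.le), sub_self]
  · rw [fcoeff_trunc hp hp1, fcoeff_trunc hp hp1, if_pos h.le,
      if_pos ((Finset.card_insert_le _ _).trans (by omega)), sub_self]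

lemma fcoeff_truncComm_of_gt (m : ℕ) (e : ι) (F : (ι → Bool) → ℝ) {β : Finset ι}
    (h : m + 1 < β.card) : fcoeff p (truncComm p m e F) β = 0 := by
  have h1 : fcoeff p (truncComm p m e F) β = _ := fcoeff_sub _ _ β
  rw [h1, fcoeff_trunc hp hp1, if_neg (by omega), fcoeff_instVal_mul hp hp1]
  split_ifs with he
  · have := Finset.card_erase_add_one he
    rw [fcoeff_trunc hp hp1, fcoeff_trunc hp hp1, if_neg (by omega), if_neg (by omega)]
    ring
  · have := Finset.card_insert_of_notMem he
    rw [fcoeff_trunc hp hp1, fcoeff_trunc hp hp1, if_neg (by omega), if_neg (by omega)]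
    ring

lemma expect_instVal_mul_sq_le (e : ι) (F : (ι → Bool) → ℝ) :
    expect (cubeWeight ι p) (fun I => (instVal I e * F I) ^ 2) ≤
      expect (cubeWeight ι p) (fun I => F I ^ 2) := by
  refine expect_mono (cubeWeight_nonneg hp.le hp1.le) fun I => ?_
  rw [instVal]
  split_ifs
  · simp
  · simpa using sq_nonneg _

lemma expect_truncComm_sq_le (m : ℕ) (e : ι) (F : (ι → Bool) → ℝ) :
    expect (cubeWeight ι p) (fun I => truncComm p m e F I ^ 2) ≤
      4 * expect (cubeWeight ι p) (fun I => F I ^ 2) := by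
  have h1 := (expect_instVal_mul_sq_le hp hp1 e (trunc p m F)).trans
    (expect_trunc_sq_le hp hp1 m F)
  have h2 := (expect_trunc_sq_le hp hp1 m (fun I => instVal I e * F I)).trans
    (expect_instVal_mul_sq_le hp hp1 e F)
  have h3 : expect (cubeWeight ι p) (fun I => truncComm p m e F I ^ 2) ≤
      expect (cubeWeight ι p) (fun I => 2 * (instVal I e * trunc p m F I) ^ 2 +
        2 * trunc p m (fun I => instVal I e * F I) I ^ 2) := by
    refine expect_mono (cubeWeight_nonneg hp.le hp1.le) fun I => ?_
    rw [truncComm]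
    nlinarith [sq_nonneg (instVal I e * trunc p m F I + trunc p m (fun I => instVal I e * F I) I)]
  rw [expect_add, expect_const_mul, expect_const_mul] at h3
  linarith

end Interior

/-! ### Polynomials of bounded degree in the instance -/

/-- `F` is a polynomial of degree at most `m` in the bits. -/
def LowDeg (m : ℕ) (F : (ι → Bool) → ℝ) : Prop :=
  ∃ P : MvPolynomial ι ℝ, P.totalDegree ≤ m ∧ ∀ I, F I = eval (instVal I) P

namespace LowDeg

variable {m m' : ℕ} {F G : (ι → Bool) → ℝ}

lemma mono (h : LowDeg m F) (hm : m ≤ m') : LowDeg m' F := by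
  obtain ⟨P, hP, hF⟩ := h
  exact ⟨P, hP.trans hm, hF⟩

lemma const (m : ℕ) (c : ℝ) : LowDeg m (fun _ : ι → Bool => c) :=
  ⟨C c, by simp, fun I => by simp⟩

lemma add (hF : LowDeg m F) (hG : LowDeg m G) : LowDeg m (fun I => F I + G I) := by
  obtain ⟨P, hP, hF⟩ := hF
  obtain ⟨Q, hQ, hG⟩ := hG
  exact ⟨P + Q, (totalDegree_add _ _).trans (max_le hP hQ), fun I => by simp only [hF, hG, map_add]⟩

lemma mul (hF : LowDeg m F) (hG : LowDeg m' G) : LowDeg (m + m') (fun I => F I * G I) := by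
  obtain ⟨P, hP, hF⟩ := hF
  obtain ⟨Q, hQ, hG⟩ := hG
  exact ⟨P * Q, (totalDegree_mul _ _).trans (add_le_add hP hQ), fun I => by simp only [hF, hG, map_mul]⟩

lemma const_mul (c : ℝ) (hF : LowDeg m F) : LowDeg m (fun I => c * F I) := by
  simpa using (const 0 c).mul hF

lemma sum {β : Type} (s : Finset β) {F : β → (ι → Bool) → ℝ} (h : ∀ b ∈ s, LowDeg m (F b)) :
    LowDeg m (fun I => ∑ b ∈ s, F b I) := by
  classical
  induction s using Finset.induction_on with
  | empty => simpa using const m 0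
  | insert a s ha ih =>
    simp only [Finset.sum_insert ha]
    exact (h a (by simp)).add (ih fun b hb => h b (by simp [hb]))

lemma chi (α : Finset ι) : LowDeg α.card (chi p α) := by
  refine ⟨∏ e ∈ α, C (√(p * (1 - p)))⁻¹ * (X e - C p), ?_, fun I => ?_⟩
  · refine (totalDegree_finsetProd _ _).trans ?_
    rw [Finset.card_eq_sum_ones]
    refine Finset.sum_le_sum fun e _ => (totalDegree_mul _ _).trans ?_
    rw [totalDegree_C, zero_add]
    refine (totalDegree_sub _ _).trans ?_
    simp
  · simp only [_root_.chi, map_prod, map_mul, eval_C, map_sub, eval_X]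
    exact Finset.prod_congr rfl fun e _ => by rw [bitChar, instVal, div_eq_inv_mul]

lemma of_fcoeff (hp : 0 < p) (hp1 : p < 1) (h : ∀ α : Finset ι, m < α.card → fcoeff p F α = 0) :
    LowDeg m F := by
  rw [show F = fun I => ∑ α, fcoeff p F α * _root_.chi p α I from
    funext (fourier_inversion hp hp1 F)]
  refine sum _ fun α _ => ?_
  by_cases hα : m < α.card
  · simpa [h α hα] using const m 0
  · exact ((chi α).mono (not_lt.1 hα)).const_mul _

/-- Fixing some bits does not raise the degree, so a spectral bound for low-degree matrices may be
applied after a partial resampling. -/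
lemma comp_mixBits (h : LowDeg m F) (b I' : ι → Bool) : LowDeg m (fun I => F (mixBits b I I')) := by
  obtain ⟨P, hP, hF⟩ := h
  let g : ι → MvPolynomial ι ℝ := fun e => if b e then X e else C (instVal I' e)
  have hg (e : ι) : (g e).totalDegree ≤ 1 := by
    simp only [g]
    split_ifs <;> simp
  refine ⟨aeval g P, ?_, fun I => ?_⟩
  · rw [aeval_def, eval₂_eq]
    refine totalDegree_finsetSum_le fun s hs => ?_
    refine (totalDegree_mul _ _).trans ?_
    rw [algebraMap_eq, totalDegree_C, zero_add]
    refine (totalDegree_finsetProd _ _).trans (le_trans ?_ ((le_totalDegree hs).trans hP))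
    refine Finset.sum_le_sum fun e _ => (totalDegree_pow _ _).trans ?_
    simpa using Nat.mul_le_mul_left (s e) (hg e)
  · simp only [hF]
    rw [← aeval_eq_eval, ← aeval_eq_eval]
    have : aeval (instVal I) (aeval g P) = aeval (fun e => aeval (instVal I) (g e)) P := by
      rw [← comp_aeval_apply]
    rw [this]
    congr 2
    funext e
    simp only [g, mixBits, instVal]
    split_ifs <;> simp [instVal, *]

end LowDeg

end Fourier

/-! ### The vector of monomials of a vertex set -/

section WordVec

variable {n d : ℕ}

/-- The values of the monomials on the indicator vector of `K`. -/
def wordVec (d : ℕ) (K : Finset (Fin n)) (w : Word n d) : ℝ := eval (indVec K) w.mono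

/-- The empty word. -/
def emptyWord (n d : ℕ) : Word n d := ⟨0, Fin.elim0⟩

lemma wordVec_emptyWord (K : Finset (Fin n)) : wordVec d K (emptyWord n d) = 1 := by
  simp only [wordVec, Word.mono, map_prod]
  exact Fin.prod_univ_zero _

lemma wordVec_nonneg (K : Finset (Fin n)) (w : Word n d) : 0 ≤ wordVec d K w := by
  simp only [wordVec, Word.mono, map_prod, eval_X, indVec]
  exact Finset.prod_nonneg fun i _ => by split_ifs <;> norm_num

lemma wordVec_le_one (K : Finset (Fin n)) (w : Word n d) : wordVec d K w ≤ 1 := by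
  simp only [wordVec, Word.mono, map_prod, eval_X, indVec]
  exact Finset.prod_le_one (fun i _ => by split_ifs <;> norm_num)
    fun i _ => by split_ifs <;> norm_num

lemma abs_wordVec_le_one (K : Finset (Fin n)) (w : Word n d) : |wordVec d K w| ≤ 1 := by
  rw [abs_of_nonneg (wordVec_nonneg K w)]
  exact wordVec_le_one K w

lemma card_word_le (hn : 2 ≤ n) (hd : 1 ≤ d) : (Fintype.card (Word n d) : ℝ) ≤ (n : ℝ) ^ (2 * d) := by
  have h1 : Fintype.card (Word n d) = ∑ j : Fin (d + 1), n ^ (j : ℕ) := by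
    simp [Fintype.card_sigma]
  have h2 : ∑ j : Fin (d + 1), n ^ (j : ℕ) < n ^ (d + 1) := by
    rw [Fin.sum_univ_eq_sum_range (fun j => n ^ j)]
    have := Nat.geomSum_lt (m := n) (n := d + 1) (s := Finset.range (d + 1)) hn
      (fun k hk => Finset.mem_range.1 hk)
    exact this
  have h3 : Fintype.card (Word n d) ≤ n ^ (2 * d) := by
    rw [h1]
    exact h2.le.trans (Nat.pow_le_pow_right (by omega) (by omega))
  exact_mod_cast h3

end WordVec

/-! ### Quadratic forms at vectors with entries in `[-1, 1]`. -/

section Quad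

variable {m : Type} [Fintype m] [DecidableEq m]

/-- The Frobenius norm. -/
def frob (M : Matrix m m ℝ) : ℝ := √(∑ u, ∑ v, M u v ^ 2)

lemma sum_sq_le_card {x : m → ℝ} (hx : ∀ u, |x u| ≤ 1) : ∑ u, x u ^ 2 ≤ Fintype.card m := by
  refine (Finset.sum_le_sum fun u _ => (sq_le_one_iff_abs_le_one (x u)).2 (hx u)).trans ?_
  simp

lemma quad_le_card_mul_lamSym (M : Matrix m m ℝ) {x : m → ℝ} (hx : ∀ u, |x u| ≤ 1) :
    quad M x ≤ Fintype.card m * lamSym M := by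
  rw [mul_comm]
  exact (quad_le_lamSym M x).trans
    (mul_le_mul_of_nonneg_left (sum_sq_le_card hx) (lamSym_nonneg M))

lemma abs_quad_le (M : Matrix m m ℝ) {x : m → ℝ} (hx : ∀ u, |x u| ≤ 1) :
    |quad M x| ≤ Fintype.card m * frob M := by
  have h (N : Matrix m m ℝ) : quad N x ≤ Fintype.card m * frob N :=
    (quad_le_card_mul_lamSym N hx).trans
      (mul_le_mul_of_nonneg_left (lamSym_le_frobenius N) (Nat.cast_nonneg _))
  refine abs_le'.2 ⟨h M, ?_⟩
  have h1 := h ((-1 : ℝ) • M)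
  rw [quad_smul] at h1
  have h2 : frob ((-1 : ℝ) • M) = frob M := by simp [frob]
  rw [h2] at h1
  linarith

/-- The matrix with one diagonal entry. -/
def diagUnit (u : m) (c : ℝ) : Matrix m m ℝ := fun i j => if i = u ∧ j = u then c else 0

lemma quad_diagUnit (u : m) (c : ℝ) (x : m → ℝ) : quad (diagUnit u c) x = c * x u ^ 2 := by
  rw [quad_eq_sum, Finset.sum_eq_single u, Finset.sum_eq_single u]
  · simp [diagUnit, pow_two]
  · intro v _ hv; simp [diagUnit, hv]
  · simp
  · intro v _ hv; simp [diagUnit, hv]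
  · simp

lemma lamSym_diagUnit (u : m) {c : ℝ} (hc : 0 ≤ c) : lamSym (diagUnit u c) = c := by
  refine le_antisymm (lamSym_le hc fun x => ?_) ?_
  · rw [quad_diagUnit]
    exact mul_le_mul_of_nonneg_left
      (Finset.single_le_sum (f := fun u => x u ^ 2) (fun _ _ => sq_nonneg _) (Finset.mem_univ u)) hc
  · have := quad_le_lamSym (diagUnit u c) (fun v => if v = u then 1 else 0)
    rw [quad_diagUnit] at this
    simpa using this

end Quad

/-! ### The joint distribution of the planted set and the graph -/

section Joint

variable {n k d : ℕ} {p q s : ℝ}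

/-- The joint distribution of the planted set and the graph. -/
def plantJoint (n k : ℕ) (p q s : ℝ) (x : Finset (Fin n) × (Edge n → Bool)) : ℝ :=
  if x.1.card = k then plantCond p q s x.1 x.2 / (n.choose k : ℝ) else 0

lemma expect_plantJoint (f : Finset (Fin n) × (Edge n → Bool) → ℝ) :
    expect (plantJoint n k p q s) f =
      avgK n k fun K => expect (plantCond p q s K) fun I => f (K, I) := by
  have h : (Finset.univ : Finset (Fin n)).powersetCard k =
      Finset.univ.filter fun K => K.card = k := by
    ext K; simp [Finset.mem_powersetCard]
  simp only [expect, avgK, Fintype.sum_prod_type, plantJoint]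
  rw [h, Finset.sum_filter, Finset.sum_div]
  refine Finset.sum_congr rfl fun K _ => ?_
  split_ifs
  · rw [Finset.sum_div]
    exact Finset.sum_congr rfl fun I _ => by ring
  · simp

lemma sum_plantJoint (hk : k ≤ n) : ∑ x, plantJoint n k p q s x = 1 := by
  have h := expect_plantJoint (n := n) (k := k) (p := p) (q := q) (s := s) (fun _ => 1)
  have h1 (K : Finset (Fin n)) : expect (plantCond p q s K) (fun _ => (1 : ℝ)) = 1 :=
    expect_const (sum_bernWeight _) 1
  simp only [h1, avgK_const hk] at h
  simpa [expect] using h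

lemma plantJoint_nonneg (hp : 0 ≤ p) (hp1 : p ≤ 1) (hq : 0 ≤ q) (hq1 : q ≤ 1) (hs : 0 ≤ s)
    (hs1 : s ≤ 1) (x : Finset (Fin n) × (Edge n → Bool)) : 0 ≤ plantJoint n k p q s x := by
  rw [plantJoint]
  split_ifs
  · exact div_nonneg (bernWeight_nonneg (plantRate_nonneg hp hp1 hq hs)
      (plantRate_le_one hp1 hq hq1 hs1) _) (Nat.cast_nonneg _)
  · exact le_rfl

/-- Noise pulls each rate towards `p`, so the excess `s q (1-p)` inside the planted set is
multiplied by `θ` and the background is unchanged. -/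
lemma expect_plantJoint_noise (θ : ℝ) (f : Finset (Fin n) → (Edge n → Bool) → ℝ) :
    expect (plantJoint n k p q s) (fun x => noise θ p (f x.1) x.2) =
      expect (plantJoint n k p q (θ * s)) (fun x => f x.1 x.2) := by
  rw [expect_plantJoint, expect_plantJoint]
  refine avgK_congr fun K _ => ?_
  refine (expect_noise (plantRate p q s K) θ p (f K)).trans ?_
  rw [plantCond]
  congr 2
  funext e
  simp only [plantRate]
  split_ifs <;> ring

lemma expect_plantedWeight_eq_joint (f : (Edge n → Bool) → ℝ) :
    expect (plantedWeight n k p q) f = expect (plantJoint n k p q 1) fun x => f x.2 := by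
  rw [expect_plantedWeight, expect_plantJoint]

end Joint

/-! ### Low-degree matrices that do not distinguish the distributions -/

section SpectralBound

variable {n k d D : ℕ} {p q r : ℝ}

/-- No matrix polynomial of degree at most `2D` has a much larger top eigenvalue under the planted
distribution. -/
def SpectralBound (n k d D : ℕ) (p q r : ℝ) : Prop :=
  ∀ F : (Edge n → Bool) → Matrix (Word n d) (Word n d) ℝ,
    (∀ u v, LowDeg (2 * D) fun I => F I u v) →
      expect (plantedWeight n k p q) (fun I => lamSym (F I)) ≤
        r * expect (erWeight n p) (fun I => lamSym (F I))

/-- A ratio can only be formed when the expectation under `ν` is positive. If it is zero, full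
support (`0 < p < 1`) forces `lamSym (F I) = 0` for every `I`, and the bound is trivial. -/
lemma spectralBound_of_not_hasSpectralDistinguisher (hp : 0 < p) (hp1 : p < 1)
    (h : ¬ HasSpectralDistinguisher n d (2 * D) (plantedWeight n k p q) (erWeight n p) r) :
    SpectralBound n k d D p q r := by
  intro F hF
  choose P hP hPF using hF
  let Q : Matrix (Word n d) (Word n d) (MvPolynomial (Edge n) ℝ) :=
    fun u v => C (1 / 2 : ℝ) * (P u v + P v u)
  have hQ (I : Edge n → Bool) : lamMaxPos (evalMat Q I) = lamSym (F I) := by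
    rw [lamSym]
    congr 1
    ext u v
    have h1 : evalMat Q I u v = eval (instVal I) (C (1 / 2 : ℝ) * (P u v + P v u)) := rfl
    rw [h1, map_mul, map_add, eval_C, ← hPF, ← hPF]
    rfl
  have hQs : Q.IsSymm := by
    refine Matrix.ext fun u v => ?_
    change C (1 / 2 : ℝ) * (P v u + P u v) = C (1 / 2 : ℝ) * (P u v + P v u)
    rw [add_comm]
  have hQd (u v) : (Q u v).totalDegree ≤ 2 * D := by
    refine (totalDegree_mul _ _).trans ?_
    rw [totalDegree_C, zero_add]
    exact (totalDegree_add _ _).trans (max_le (hP u v) (hP v u))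
  have h0 (I : Edge n → Bool) : 0 < erWeight n p I := by
    refine Finset.prod_pos fun e _ => ?_
    split_ifs
    exacts [hp, sub_pos.2 hp1]
  by_contra hlt
  refine h ⟨Q, hQs, hQd, ?_⟩
  simp only [hQ]
  have hpos : 0 < expect (erWeight n p) fun I => lamSym (F I) := by
    refine lt_of_le_of_ne (expect_nonneg (fun I => (h0 I).le) fun I => lamSym_nonneg _) fun he => ?_
    have h1 (I : Edge n → Bool) : lamSym (F I) = 0 := by
      have := (Finset.sum_eq_zero_iff_of_nonneg (fun I _ =>
        mul_nonneg (h0 I).le (lamSym_nonneg (F I)))).1 he.symm I (Finset.mem_univ I)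
      exact (mul_eq_zero.1 this).resolve_left (h0 I).ne'
    simp [h1, expect] at hlt
  exact ⟨hpos, (le_div_iff₀ hpos).2 (not_le.1 hlt).le⟩

/-- Invariance of the product distribution under partial resampling. -/
lemma expect_plantJoint_le_of_mixBits (hp : 0 ≤ p) (hp1 : p ≤ 1) {s : ℝ} (hs : 0 ≤ s) (hs1 : s ≤ 1)
    (G : (Edge n → Bool) → ℝ)
    (h : ∀ b I', expect (plantedWeight n k p q) (fun I => G (mixBits b I I')) ≤
      r * expect (erWeight n p) (fun I => G (mixBits b I I'))) :
    expect (plantJoint n k p q s) (fun x => G x.2) ≤ r * expect (erWeight n p) G := by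
  -- The thinned planted law is the noise of rate `s` applied to the planted law, and noise is a
  -- mixture of the maps `mixBits b · I'`. The assumed inequality is averaged over `b` and `I'`; the
  -- noise leaves `ν` invariant.
  have h1 := expect_plantJoint_noise (n := n) (k := k) (p := p) (q := q) (s := 1) s (fun _ => G)
  rw [mul_one] at h1
  have h2 (w : (Edge n → Bool) → ℝ) : expect w (noise s p G) =
      expect (bernWeight fun _ => s) fun b => expect (cubeWeight (Edge n) p) fun I' =>
        expect w fun I => G (mixBits b I I') := by
    simp only [show noise s p G = fun I => _ from funext (noise_eq_expect_mixBits s p G)]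
    simp only [expect, Finset.mul_sum]
    rw [Finset.sum_comm]
    refine Finset.sum_congr rfl fun b _ => ?_
    rw [Finset.sum_comm]
    exact Finset.sum_congr rfl fun I' _ => Finset.sum_congr rfl fun I _ => by ring
  have h3 : expect (erWeight n p) G = expect (erWeight n p) (noise s p G) :=
    (expect_cubeWeight_noise s p G).symm
  rw [← h1, ← expect_plantedWeight_eq_joint, h3, h2, h2, ← expect_const_mul]
  refine expect_mono (bernWeight_nonneg (fun _ => hs) fun _ => hs1) fun b => ?_
  rw [← expect_const_mul]
  exact expect_mono (cubeWeight_nonneg hp hp1) fun I' => h b I'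

namespace SpectralBound

variable (h : SpectralBound n k d D p q r) (hp : 0 ≤ p) (hp1 : p ≤ 1)
include h hp hp1

lemma expect_lamSym_le {s : ℝ} (hs : 0 ≤ s) (hs1 : s ≤ 1)
    {F : (Edge n → Bool) → Matrix (Word n d) (Word n d) ℝ}
    (hF : ∀ u v, LowDeg (2 * D) fun I => F I u v) :
    expect (plantJoint n k p q s) (fun x => lamSym (F x.2)) ≤
      r * expect (erWeight n p) (fun I => lamSym (F I)) :=
  expect_plantJoint_le_of_mixBits hp hp1 hs hs1 (fun I => lamSym (F I)) fun b I' =>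
    h (fun I => F (mixBits b I I')) fun u v => (hF u v).comp_mixBits b I'

/-- The spectral bound applied to the matrix with the single diagonal entry `f²`. This squaring is
why the bound is assumed up to degree `2D` while the functionals live on degree `D`. -/
lemma expect_sq_le {s : ℝ} (hs : 0 ≤ s) (hs1 : s ≤ 1) {f : (Edge n → Bool) → ℝ}
    (hf : LowDeg D f) : expect (plantJoint n k p q s) (fun x => f x.2 ^ 2) ≤
      r * expect (erWeight n p) (fun I => f I ^ 2) := by
  have h1 : ∀ u v, LowDeg (2 * D) fun I =>
      diagUnit (emptyWord n d) (f I ^ 2) u v := fun u v => by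
    by_cases huv : u = emptyWord n d ∧ v = emptyWord n d
    · simp only [diagUnit, huv, and_self, if_true, pow_two, two_mul]
      exact hf.mul hf
    · simp only [diagUnit, huv, if_false]
      exact LowDeg.const _ 0
  have := h.expect_lamSym_le hp hp1 hs hs1 h1
  simpa only [lamSym_diagUnit _ (sq_nonneg _)] using this

end SpectralBound

end SpectralBound

/-! ### The L² norm of a random matrix -/

section L2

variable {ι m : Type} [Fintype ι] [DecidableEq ι] [Fintype m] [DecidableEq m] {p : ℝ}

/-- The L² norm of a random matrix. -/
def l2Norm (p : ℝ) (F : (ι → Bool) → Matrix m m ℝ) : ℝ :=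
  √(expect (cubeWeight ι p) fun I => ∑ u, ∑ v, F I u v ^ 2)

lemma l2Norm_nonneg (F : (ι → Bool) → Matrix m m ℝ) : 0 ≤ l2Norm p F := Real.sqrt_nonneg _

variable (hp : 0 ≤ p) (hp1 : p ≤ 1)
include hp hp1

lemma l2Norm_sq (F : (ι → Bool) → Matrix m m ℝ) :
    l2Norm p F ^ 2 = expect (cubeWeight ι p) fun I => ∑ u, ∑ v, F I u v ^ 2 :=
  Real.sq_sqrt (expect_nonneg (cubeWeight_nonneg hp hp1) fun _ =>
    Finset.sum_nonneg fun _ _ => Finset.sum_nonneg fun _ _ => sq_nonneg _)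

lemma l2Norm_eq_norm (F : (ι → Bool) → Matrix m m ℝ) :
    l2Norm p F = ‖WithLp.toLp 2 fun x : (ι → Bool) × m × m =>
      √(cubeWeight ι p x.1) * F x.1 x.2.1 x.2.2‖ := by
  rw [l2Norm, EuclideanSpace.norm_eq]
  congr 1
  simp only [expect, Fintype.sum_prod_type, Real.norm_eq_abs, sq_abs, mul_pow,
    Real.sq_sqrt (cubeWeight_nonneg hp hp1 _), Finset.mul_sum]

lemma l2Norm_add_le (F G : (ι → Bool) → Matrix m m ℝ) :
    l2Norm p (F + G) ≤ l2Norm p F + l2Norm p G := by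
  rw [l2Norm_eq_norm hp hp1, l2Norm_eq_norm hp hp1, l2Norm_eq_norm hp hp1]
  refine le_trans (le_of_eq ?_) (norm_add_le _ _)
  congr 1
  ext x
  simp [mul_add]

lemma l2Norm_smul (c : ℝ) (F : (ι → Bool) → Matrix m m ℝ) :
    l2Norm p (c • F) = |c| * l2Norm p F := by
  rw [l2Norm_eq_norm hp hp1, l2Norm_eq_norm hp hp1, ← Real.norm_eq_abs, ← norm_smul]
  congr 1
  ext x
  simp only [Pi.smul_apply, Matrix.smul_apply, smul_eq_mul, PiLp.smul_apply]
  ring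

lemma expect_lamSym_le_l2Norm (F : (ι → Bool) → Matrix m m ℝ) :
    expect (cubeWeight ι p) (fun I => lamSym (F I)) ≤ l2Norm p F := by
  have h := expect_abs_le_sqrt (cubeWeight_nonneg hp hp1) (sum_bernWeight fun _ : ι => p)
    fun I => frob (F I)
  have h1 (I : ι → Bool) : frob (F I) ^ 2 = ∑ u, ∑ v, F I u v ^ 2 :=
    Real.sq_sqrt (Finset.sum_nonneg fun _ _ => Finset.sum_nonneg fun _ _ => sq_nonneg _)
  simp only [h1] at h
  refine le_trans (expect_mono (cubeWeight_nonneg hp hp1) fun I => ?_) h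
  exact (lamSym_le_frobenius (F I)).trans (le_abs_self _)

lemma l2Norm_le {F : (ι → Bool) → Matrix m m ℝ} {b : ℝ} (hb : 0 ≤ b)
    (h : ∀ u v, expect (cubeWeight ι p) (fun I => F I u v ^ 2) ≤ b ^ 2) :
    l2Norm p F ≤ Fintype.card m * b := by
  refine Real.sqrt_le_iff.2 ⟨by positivity, ?_⟩
  rw [expect_sum]
  simp_rw [expect_sum]
  refine (Finset.sum_le_sum fun u _ => Finset.sum_le_sum fun v _ => h u v).trans ?_
  simp only [Finset.sum_const, Finset.card_univ, nsmul_eq_mul]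
  exact le_of_eq (by ring)

end L2

/-! ### Extending planted expectations to matrices of unbounded degree -/

section Extension

variable {n k d D : ℕ} {p q r θ G δ : ℝ}

/-- The matrices all of whose entries have degree at most `D`. -/
def lowDegMatrices (ι m : Type) [Fintype ι] [DecidableEq ι] (p : ℝ) (D : ℕ) :
    Submodule ℝ ((ι → Bool) → Matrix m m ℝ) where
  carrier := {F | ∀ u v, ∀ α : Finset ι, D < α.card → fcoeff p (fun I => F I u v) α = 0}
  add_mem' {F H} hF hH u v α hα := by
    have := fcoeff_add (p := p) (fun I => F I u v) (fun I => H I u v) α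
    rw [hF u v α hα, hH u v α hα, add_zero] at this
    exact this
  zero_mem' u v α _ := by simp [fcoeff, expect]
  smul_mem' c F hF u v α hα := by
    have := fcoeff_const_mul (p := p) c (fun I => F I u v) α
    rw [hF u v α hα, mul_zero] at this
    exact this

/-- The planted expectation of a quadratic form with weight `g`. -/
def plantedForm (n k d : ℕ) (p q s : ℝ) (g : Finset (Fin n) → (Edge n → Bool) → ℝ) :
    ((Edge n → Bool) → Matrix (Word n d) (Word n d) ℝ) →ₗ[ℝ] ℝ where
  toFun F := expect (plantJoint n k p q s) fun x => g x.1 x.2 * quad (F x.2) (wordVec d x.1)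
  map_add' F H := by
    simp only [Pi.add_apply, quad_add, mul_add, expect_add]
  map_smul' c F := by
    simp only [Pi.smul_apply, quad_smul, RingHom.id_apply, smul_eq_mul, ← expect_const_mul]
    congr 1
    funext x
    ring

/-- Where `g ≥ 0`, the form is at most `G |x_K|² λ⁺(F)`, and the spectral bound passes to `ν`. Where
`g < 0`, only the Frobenius norm is available; Cauchy–Schwarz pairs it with the small probability
`δ` of this event, and `expect_sq_le` moves its second moment to `ν`. -/
lemma plantedForm_le (hp : 0 < p) (hp1 : p < 1) (hq : 0 ≤ q) (hq1 : q ≤ 1) (hθ : 0 ≤ θ)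
    (hθ1 : θ ≤ 1) (hk : k ≤ n) (hr : 0 ≤ r) (hδ : 0 ≤ δ) (h : SpectralBound n k d D p q r)
    {g : Finset (Fin n) → (Edge n → Bool) → ℝ} (hg : ∀ K I, |g K I| ≤ G)
    (hneg : ∀ K : Finset (Fin n), K.card = k →
      prob (plantCond p q θ K) (fun I => g K I < 0) ≤ δ)
    {F : (Edge n → Bool) → Matrix (Word n d) (Word n d) ℝ}
    (hF : F ∈ lowDegMatrices (Edge n) (Word n d) p D) :
    plantedForm n k d p q θ g F ≤ G * Fintype.card (Word n d) *
      (r * expect (erWeight n p) (fun I => lamSym (F I)) + √(δ * r) * l2Norm p F) := by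
  classical
  set V : ℝ := (Fintype.card (Word n d) : ℝ) with hV
  have hV0 : 0 ≤ V := Nat.cast_nonneg _
  have hG : 0 ≤ G := (abs_nonneg _).trans (hg ∅ fun _ => false)
  have hFD (u v) : LowDeg D fun I => F I u v := LowDeg.of_fcoeff hp hp1 (hF u v)
  have hw := plantJoint_nonneg (n := n) (k := k) hp.le hp1.le hq hq1 hθ hθ1
  let ind : Finset (Fin n) × (Edge n → Bool) → ℝ := fun x => if g x.1 x.2 < 0 then 1 else 0
  have h1 (x : Finset (Fin n) × (Edge n → Bool)) :
      g x.1 x.2 * quad (F x.2) (wordVec d x.1) ≤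
        G * V * lamSym (F x.2) + G * V * (ind x * frob (F x.2)) := by
    have ha := quad_le_card_mul_lamSym (F x.2) (abs_wordVec_le_one (d := d) x.1)
    have hb := abs_quad_le (F x.2) (abs_wordVec_le_one (d := d) x.1)
    have hc := abs_le.1 (hg x.1 x.2)
    have hl := mul_nonneg hV0 (lamSym_nonneg (F x.2))
    simp only [ind]
    split_ifs with h0
    · have := (le_abs_self _).trans_eq (abs_mul (g x.1 x.2) (quad (F x.2) (wordVec d x.1)))
      have := mul_le_mul (hg x.1 x.2) hb (abs_nonneg _) hG
      have := mul_nonneg hG hl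
      linarith
    · rw [zero_mul, mul_zero, add_zero]
      push Not at h0
      have := mul_le_mul_of_nonneg_left ha h0
      have := mul_le_mul_of_nonneg_right hc.2 hl
      linarith
  have h2 := expect_mono hw h1
  rw [expect_add, expect_const_mul, expect_const_mul] at h2
  have h3 := h.expect_lamSym_le hp.le hp1.le hθ hθ1 fun u v => (hFD u v).mono (by omega : D ≤ 2 * D)
  have h4 : expect (plantJoint n k p q θ) (fun x => ind x ^ 2) ≤ δ := by
    rw [expect_plantJoint, ← avgK_const hk δ]
    refine avgK_mono fun K hK => ?_
    refine le_trans (le_of_eq ?_) (hneg K hK)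
    rw [prob_eq_expect]
    congr 1
    funext I
    simp only [ind]
    split_ifs <;> norm_num
  have h5 : expect (plantJoint n k p q θ) (fun x => frob (F x.2) ^ 2) ≤ r * l2Norm p F ^ 2 := by
    have hf (I : Edge n → Bool) : frob (F I) ^ 2 = ∑ u, ∑ v, F I u v ^ 2 :=
      Real.sq_sqrt (Finset.sum_nonneg fun _ _ => Finset.sum_nonneg fun _ _ => sq_nonneg _)
    rw [l2Norm_sq hp.le hp1.le]
    simp only [hf]
    simp_rw [expect_sum, Finset.mul_sum]
    exact Finset.sum_le_sum fun u _ => Finset.sum_le_sum fun v _ =>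
      h.expect_sq_le hp.le hp1.le hθ hθ1 (hFD u v)
  have h6 : expect (plantJoint n k p q θ) (fun x => ind x * frob (F x.2)) ≤
      √(δ * r) * l2Norm p F := by
    refine le_of_abs_le (abs_le_of_sq_le_sq ?_ (mul_nonneg (Real.sqrt_nonneg _) (l2Norm_nonneg _)))
    rw [mul_pow, Real.sq_sqrt (mul_nonneg hδ hr), mul_assoc]
    refine (expect_mul_sq_le hw _ _).trans (mul_le_mul h4 h5 ?_ hδ)
    exact expect_nonneg hw fun _ => sq_nonneg _
  calc _ ≤ _ := h2
    _ ≤ G * V * (r * expect (erWeight n p) (fun I => lamSym (F I))) +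
        G * V * (√(δ * r) * l2Norm p F) :=
        add_le_add (mul_le_mul_of_nonneg_left h3 (mul_nonneg hG hV0))
          (mul_le_mul_of_nonneg_left h6 (mul_nonneg hG hV0))
    _ = _ := by ring

/-- The planted form on matrices of bounded degree has a dominated extension to all matrices. -/
lemma exists_extension_plantedForm (hp : 0 < p) (hp1 : p < 1) (hq : 0 ≤ q) (hq1 : q ≤ 1)
    (hθ : 0 ≤ θ) (hθ1 : θ ≤ 1) (hk : k ≤ n) (hr : 0 ≤ r) (hδ : 0 ≤ δ)
    (h : SpectralBound n k d D p q r)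
    {g : Finset (Fin n) → (Edge n → Bool) → ℝ} (hg : ∀ K I, |g K I| ≤ G)
    (hneg : ∀ K : Finset (Fin n), K.card = k →
      prob (plantCond p q θ K) (fun I => g K I < 0) ≤ δ) :
    ∃ ℓ : ((Edge n → Bool) → Matrix (Word n d) (Word n d) ℝ) →ₗ[ℝ] ℝ,
      (∀ F ∈ lowDegMatrices (Edge n) (Word n d) p D, ℓ F = plantedForm n k d p q θ g F) ∧
      ∀ F, ℓ F ≤ G * Fintype.card (Word n d) *
        (r * expect (erWeight n p) (fun I => lamSym (F I)) + √(δ * r) * l2Norm p F) := by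
  have hG : 0 ≤ G := (abs_nonneg _).trans (hg ∅ fun _ => false)
  have hGV : 0 ≤ G * (Fintype.card (Word n d) : ℝ) := mul_nonneg hG (Nat.cast_nonneg _)
  -- Hahn–Banach: the dominating expression is sublinear on all matrix-valued functions, while the
  -- planted form is dominated by it only on the low-degree subspace.
  obtain ⟨ℓ, h1, h2⟩ := exists_extension_of_le_sublinear
    ⟨lowDegMatrices (Edge n) (Word n d) p D,
      (plantedForm n k d p q θ g).comp (lowDegMatrices (Edge n) (Word n d) p D).subtype⟩
    (fun F => G * Fintype.card (Word n d) *
      (r * expect (erWeight n p) (fun I => lamSym (F I)) + √(δ * r) * l2Norm p F))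
    (fun c hc F => by
      simp only [Pi.smul_apply, lamSym_smul hc, expect_const_mul, l2Norm_smul hp.le hp1.le,
        abs_of_pos hc]
      ring)
    (fun F H => by
      have ha : expect (erWeight n p) (fun I => lamSym ((F + H) I)) ≤
          expect (erWeight n p) (fun I => lamSym (F I)) +
            expect (erWeight n p) (fun I => lamSym (H I)) := by
        rw [← expect_add]
        exact expect_mono (cubeWeight_nonneg hp.le hp1.le) fun I => lamSym_add_le _ _
      have hb := l2Norm_add_le hp.le hp1.le F H
      rw [← mul_add]
      refine mul_le_mul_of_nonneg_left ?_ hGV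
      have := mul_le_mul_of_nonneg_left ha hr
      have := mul_le_mul_of_nonneg_left hb (Real.sqrt_nonneg (δ * r))
      linarith)
    (fun F => plantedForm_le hp hp1 hq hq1 hθ hθ1 hk hr hδ h hg hneg F.2)
  exact ⟨ℓ, fun F hF => h1 ⟨F, hF⟩, h2⟩

end Extension

/-! ### Lifting the objective through the noise -/

/-- A planted bit has rate `t` before the noise and `w` after it. `P` is the conditional probability
that the bit was `1` given that the noisy bit is `0`, and `a (I_e - P)` is the affine function whose
conditional expectation is the noisy bit. The bound `a ≤ 3` comes from `1 - w ≤ (1+θ)(1-t)`, `w ≤ t`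
and `θ ≥ 1/2`. -/
lemma exists_lift_parameters {p q θ : ℝ} (hp : 0 < p) (hp1 : p < 1) (hq : 0 < q) (hq1 : q ≤ 1)
    (hθ0 : 0 < θ) (hθ1 : θ < 1) (hθ2 : 1 + θ ≤ 3 * θ) :
    ∃ t w a P : ℝ, t = p + θ * (q * (1 - p)) ∧ w = p + θ * θ * (q * (1 - p)) ∧
      0 < t ∧ t < 1 ∧ 0 < a ∧ a ≤ 3 ∧ 0 ≤ P ∧ P ≤ 1 ∧ w = θ * t + (1 - θ) * p ∧
      P * (1 - w) = t * (1 - θ) * (1 - p) ∧ a * (t - P) = w := by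
  obtain ⟨t, ht⟩ : ∃ t, t = p + θ * (q * (1 - p)) := ⟨_, rfl⟩
  obtain ⟨w, hw⟩ : ∃ w, w = p + θ * θ * (q * (1 - p)) := ⟨_, rfl⟩
  have hq1' : θ * q < 1 := by nlinarith
  have ht1 : 1 - t = (1 - p) * (1 - θ * q) := by rw [ht]; ring
  have hw1 : 1 - w = (1 - p) * (1 - θ * θ * q) := by rw [hw]; ring
  have htlt : 0 < 1 - t := by rw [ht1]; exact mul_pos (by linarith) (by linarith)
  have hx0 : 0 ≤ q * (1 - p) := mul_nonneg hq.le (by linarith)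
  have htw : w ≤ t := by
    rw [ht, hw]
    nlinarith [mul_nonneg hθ0.le hx0]
  have hpw : p ≤ w := by
    rw [hw]
    nlinarith [mul_nonneg (mul_nonneg hθ0.le hθ0.le) hx0]
  have hwlt : 0 < 1 - w := by linarith
  have ht0 : 0 < t := by linarith
  have hw0 : 0 < w := by linarith
  have hwt : w = θ * t + (1 - θ) * p := by rw [ht, hw]; ring
  have hww : 1 - w = (1 - θ) * (1 - p) + (1 - t) * θ := by rw [hwt]; ring
  obtain ⟨a, ha⟩ : ∃ a, a = w * (1 - w) / (θ * t * (1 - t)) := ⟨_, rfl⟩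
  obtain ⟨P, hP⟩ : ∃ P, P = t * (1 - θ) * (1 - p) / (1 - w) := ⟨_, rfl⟩
  have ha0 : 0 < a := by rw [ha]; positivity
  have ha3 : a ≤ 3 := by
    rw [ha, div_le_iff₀ (by positivity)]
    have h1 : 1 - w ≤ (1 + θ) * (1 - t) := by
      rw [ht1, hw1]
      have : 0 ≤ (1 - p) * (θ * (1 - q)) :=
        mul_nonneg (by linarith) (mul_nonneg hθ0.le (by linarith))
      nlinarith
    calc w * (1 - w) ≤ t * ((3 * θ) * (1 - t)) :=
          mul_le_mul htw (h1.trans (mul_le_mul_of_nonneg_right hθ2 htlt.le)) hwlt.le ht0.le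
      _ = 3 * (θ * t * (1 - t)) := by ring
  have hP0 : 0 ≤ P := by
    rw [hP]
    exact div_nonneg (mul_nonneg (mul_nonneg ht0.le (by linarith)) (by linarith)) hwlt.le
  have hP1 : P ≤ 1 := by
    rw [hP, div_le_one hwlt]
    have h1 : 0 ≤ (1 - θ) * (1 - p) := mul_nonneg (by linarith) (by linarith)
    have h2 : 0 ≤ (1 - t) * θ := mul_nonneg htlt.le hθ0.le
    nlinarith
  have hPw : P * (1 - w) = t * (1 - θ) * (1 - p) := by rw [hP, div_mul_cancel₀ _ hwlt.ne']
  have haP : a * (t - P) = w := by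
    have h1 : (t - P) * (1 - w) = θ * t * (1 - t) := by
      rw [sub_mul, hPw, hww]; ring
    have h2 : a * (θ * t * (1 - t)) = w * (1 - w) := by
      rw [ha, div_mul_cancel₀]
      positivity
    refine mul_right_cancel₀ hwlt.ne' ?_
    rw [mul_assoc, h1, h2]
  exact ⟨t, w, a, P, ht, hw, ht0, by linarith, ha0, ha3, hP0, hP1, hwt, hPw, haP⟩

namespace Regime

variable {n k d D : ℕ} {p q ε obj : ℝ} (h : Regime n k d D p q ε obj)
include h

lemma obj_pos (hR : dksRefutable n k d (40 * d) p obj) : 0 < obj := by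
  classical
  by_contra hobj
  have h1 (I : Edge n → Bool) : ¬ (dksSystem n k obj).HasRefutation d ((n : ℝ) ^ (40 * d)) I := by
    obtain ⟨K, -, hK⟩ := Finset.exists_subset_card_eq
      (show k ≤ (Finset.univ : Finset (Fin n)).card by simpa using h.k_le_n)
    refine fun hI => hI.not_feasible (indVec K) (feasible_indVec I hK ?_)
    refine (not_lt.1 hobj).trans (mul_nonneg zero_le_two (Finset.sum_nonneg fun e _ => ?_))
    rw [instVal]
    split_ifs <;> norm_num
  have h2 : 1 < (n : ℝ) ^ (8 * (40 * d)) :=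
    one_lt_pow₀ h.one_lt_n (by have := h.one_le_d; omega)
  simp only [dksRefutable, prob, h1, if_false, Finset.sum_const_zero] at hR
  have h3 : 1 / (n : ℝ) ^ (8 * (40 * d)) < 1 := (div_lt_one (by linarith)).2 h2
  linarith

/-- An affine change of the bits through which the objective constraint passes to the noisy
instance. -/
lemma exists_lift (hp : 0 < p) (hR : dksRefutable n k d (40 * d) p obj) :
    ∃ a b : ℝ, |a| ≤ 3 ∧ |b| ≤ 3 ∧
      (∀ K : Finset (Fin n), ∀ e ∈ edgesIn K, ∀ F : (Edge n → Bool) → ℝ,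
        expect (plantCond p q (sampleRate n d D) K)
            (fun I => (a * instVal I e + b) * noise (sampleRate n d D) p F I) =
          expect (plantCond p q (sampleRate n d D * sampleRate n d D) K)
            (fun J => instVal J e * F J)) ∧
      ∀ K : Finset (Fin n), K.card = k →
        prob (plantCond p q (sampleRate n d D) K)
            (fun I => 2 * ∑ e ∈ edgesIn K, (a * instVal I e + b) - obj < 0) ≤
          1 / (n : ℝ) ^ (8 * (40 * d)) := by
  have hobj := h.obj_pos hR
  have hp1 := h.p_lt_one
  have hq := h.q_pos
  have hq1 := h.q_le_one
  have hε := h.eps_pos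
  have hN := h.choose_pos
  have hη := tailEta_le
  have hη0 := tailEta_pos
  have hε1 : ε < 1 := by
    by_contra hε1
    have := mul_nonneg (mul_nonneg (sub_nonneg.2 (not_lt.1 hε1)) (add_pos hp hq).le) hN.le
    have := h.obj_le
    nlinarith
  have hθ0 := h.sampleRate_pos
  have hθ1 := h.sampleRate_lt_one
  have hθε := h.one_sub_sampleRate_le
  have hρ := h.gap_le (s := sampleRate n d D * sampleRate n d D) (by nlinarith)
  set θ := sampleRate n d D with hθ
  obtain ⟨t, w, a, P, ht, hw, ht0, ht1, ha0, ha3, hP0, hP1, hwt, hPw, haP⟩ :=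
    exists_lift_parameters hp hp1 hq hq1 hθ0 hθ1 (by nlinarith)
  have hx0 : 0 ≤ q * (1 - p) := mul_nonneg hq.le (by linarith)
  refine ⟨a, -(a * P), by rw [abs_of_pos ha0]; exact ha3, ?_, ?_, ?_⟩
  · rw [abs_neg, abs_of_nonneg (mul_nonneg ha0.le hP0)]
    nlinarith
  · intro K e he F
    have he' : plantRate p q θ K e = t := by rw [plantRate_of_mem he, ht]
    have h0 : t * (a + -(a * P)) * ((1 - θ) * (1 - p)) +
        (1 - t) * -(a * P) * (θ + (1 - θ) * (1 - p)) = 0 := by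
      linear_combination (-a) * hPw - a * P * hwt
    have h1 := expect_affine_mul_noise (plantRate p q θ K) (θ := θ) (p := p) (a := a)
      (b := -(a * P)) e (by rw [he']; exact h0) (by
        rw [he']
        linear_combination haP - h0 + hwt) F
    rw [plantCond, h1, plantCond]
    congr 2
    funext e'
    simp only [plantRate]
    split_ifs <;> ring
  · intro K hK
    have hc : ((edgesIn K).card : ℝ) = (k.choose 2 : ℝ) := by rw [card_edgesIn, hK]
    have hr0 := plantRate_nonneg (K := K) hp.le hp1.le hq.le hθ0.le
    have hr1 := plantRate_le_one (K := K) (p := p) (q := q) (s := θ) hp1.le hq.le hq1 hθ1.le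
    refine le_trans (prob_mono (bernWeight_nonneg hr0 hr1) fun I hI => ?_)
      (h.prob_edgesIn_lt_le (Or.inl hR) hK hr0 hr1 (r₀ := t) (x := obj / (2 * a) +
        P * (k.choose 2 : ℝ))
        (fun e he => by rw [plantRate_of_mem he, ht]) ht0.le (by linarith) ?_ ?_ ?_)
    · rw [Finset.sum_add_distrib, ← Finset.mul_sum, Finset.sum_const, nsmul_eq_mul, hc] at hI
      rw [← sub_lt_iff_lt_add, lt_div_iff₀ (by positivity)]
      linarith
    · rw [ht]
      have : θ * (q * (1 - p)) ≤ 1 * (q * 1) :=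
        mul_le_mul hθ1.le (mul_le_mul_of_nonneg_left (by linarith) hq.le) hx0 zero_le_one
      linarith
    · have ht2 : 1 - t = (1 - p) * (1 - θ * q) := by rw [ht]; ring
      rw [ht2]
      have h1 : (1 - p) * ((1 - θ) * q) ≤ 1 * ((1 - θ) * 1) :=
        mul_le_mul (by linarith) (mul_le_mul_of_nonneg_left hq1 (by linarith))
          (mul_nonneg (by linarith) hq.le) zero_le_one
      have h2 : (1 - p) * (1 - q) ≤ (1 - p) * (1 - p) :=
        mul_le_mul_of_nonneg_left (by linarith [h.p_lt_q]) (by linarith)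
      nlinarith
    -- A negative lifted objective means that the edge count is below `obj/(2a) + P (k choose 2)`.
    -- The margin in `gap_le` is `3y`, where `y` is the margin of the tail bound; as `a ≤ 3`,
    -- dividing by `a` leaves at least `y`.
    · have h2 : θ * θ * (p + q * (1 - p)) ≤ w := by
        have hθθ : θ * θ ≤ 1 := by nlinarith
        rw [hw]
        linarith [mul_le_mul_of_nonneg_right hθθ hp.le]
      obtain ⟨y, hy⟩ : ∃ y, y = (p + q) / 2 / 6 * ((1 - p) + ε) := ⟨_, rfl⟩
      have hy0 : 0 ≤ y := by
        rw [hy]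
        exact mul_nonneg (by linarith) (by linarith)
      have h3 : obj ≤ 2 * (w - 3 * y) * (k.choose 2 : ℝ) :=
        h.obj_le.trans (mul_le_mul_of_nonneg_right (by linarith) hN.le)
      have h4 : a * y ≤ 3 * y := mul_le_mul_of_nonneg_right ha3 hy0
      have h5 : obj / (2 * a) ≤ (t - P - y) * (k.choose 2 : ℝ) := by
        rw [div_le_iff₀ (by positivity)]
        have h6 : 2 * (w - 3 * y) ≤ 2 * (a * (t - P) - a * y) := by linarith
        have h7 := mul_le_mul_of_nonneg_right h6 hN.le
        linarith
      rw [← hy]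
      linarith

end Regime

/-! ### The matrices of the refutations -/

section Matrices

variable {n k d : ℕ} {obj R : ℝ}

/-- A word as a word of larger maximal length. -/
def wordCast {l : ℕ} (hl : l ≤ d) (w : Word n l) : Word n d :=
  ⟨Fin.castLE (by omega) w.1, w.2⟩

lemma wordCast_injective {l : ℕ} (hl : l ≤ d) :
    Function.Injective (wordCast hl : Word n l → Word n d) := by
  rintro ⟨⟨i, hi⟩, f⟩ ⟨⟨j, hj⟩, g⟩ h
  simp only [wordCast, Fin.castLE_mk, Sigma.mk.injEq, Fin.mk.injEq] at h
  obtain ⟨rfl, h⟩ := h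
  rw [eq_of_heq h]

lemma exists_extend_matrix {l : ℕ} (hl : l ≤ d) (hR : 0 ≤ R)
    {B : Matrix (Word n l) (Word n l) ℝ} (hB : ∀ u v, |B u v| ≤ R) :
    ∃ B' : Matrix (Word n d) (Word n d) ℝ, (∀ u v, |B' u v| ≤ R) ∧
      ∀ x, quad B' x = quad B (x ∘ wordCast hl) := by
  have hi := wordCast_injective (n := n) hl
  refine ⟨Matrix.of fun u v => Function.extend (wordCast hl)
    (fun u' => Function.extend (wordCast hl) (fun v' => B u' v') 0 v) 0 u, fun u v => ?_, fun x => ?_⟩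
  · rw [Matrix.of_apply]
    by_cases hu : ∃ u', wordCast hl u' = u
    · obtain ⟨u, rfl⟩ := hu
      rw [hi.extend_apply]
      by_cases hv : ∃ v', wordCast hl v' = v
      · obtain ⟨v, rfl⟩ := hv
        rw [hi.extend_apply]
        exact hB u v
      · rw [Function.extend_apply' _ _ _ hv]
        simpa using hR
    · rw [Function.extend_apply' _ _ _ hu]
      simpa using hR
  · rw [quad_eq_sum, quad_eq_sum]
    simp only [Matrix.of_apply]
    refine (Fintype.sum_of_injective (wordCast hl) hi _ _ (fun u hu => ?_) fun u => ?_).symm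
    · refine Finset.sum_eq_zero fun v _ => ?_
      rw [Function.extend_apply' _ _ _ (by simpa using hu)]
      simp
    · refine Fintype.sum_of_injective (wordCast hl) hi _ _ (fun v hv => ?_) fun v => ?_
      · rw [hi.extend_apply, Function.extend_apply' _ _ _ (by simpa using hv)]
        simp
      · rw [hi.extend_apply, hi.extend_apply]
        rfl

lemma Matrix.PosSemidef.quad_nonneg {m : Type} [Fintype m] [DecidableEq m] {M : Matrix m m ℝ}
    (h : M.PosSemidef) (x : m → ℝ) : 0 ≤ quad M x := h.dotProduct_mulVec_nonneg x

/-- The `-1` of the refutation is moved into the first matrix as the diagonal entry of the empty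
word, whose monomial is `1`. So `quad A` dominates the square of that coordinate. The equality
constraints disappear on the slice. -/
lemma exists_matrices_of_hasRefutation (hR : 0 ≤ R) {I : Edge n → Bool}
    (h : (dksSystem n k obj).HasRefutation d R I) :
    ∃ A B : Matrix (Word n d) (Word n d) ℝ, (∀ x, x (emptyWord n d) ^ 2 ≤ quad A x) ∧
      (∀ x, 0 ≤ quad B x) ∧ (∀ u v, |A u v| ≤ R + 1) ∧ (∀ u v, |B u v| ≤ R + 1) ∧
      ∀ K : Finset (Fin n), K.card = k → quad A (wordVec d K) +
        (2 * ∑ e ∈ edgesIn K, instVal I e - obj) * quad B (wordVec d K) = 0 := by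
  obtain ⟨l, A, B, q, hl, hA, hB, -, hAR, hBR, -, he⟩ := h
  have hld : l ≤ d := by omega
  obtain ⟨B', hB'R, hB'⟩ := exists_extend_matrix hld hR hBR
  refine ⟨diagUnit (emptyWord n d) 1 + A, B', fun x => ?_, fun x => ?_, fun u v => ?_, fun u v => ?_,
    fun K hK => ?_⟩
  · rw [quad_add, quad_diagUnit]
    have := hA.quad_nonneg x
    linarith
  · rw [hB']
    exact hB.quad_nonneg _
  · rw [Matrix.add_apply, add_comm]
    refine (abs_add_le _ _).trans (add_le_add (hAR u v) ?_)
    rw [diagUnit]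
    split_ifs <;> simp
  · linarith [hB'R u v]
  · have h1 := congrArg (eval (indVec K)) he
    simp only [map_neg, map_one, map_add, map_mul, map_sum, eval_indVec_eqn I hK, zero_mul,
      Finset.sum_const_zero, add_zero, eval_indVec_ineq, eval_gram] at h1
    rw [quad_add, quad_diagUnit, wordVec_emptyWord, hB', quad_eq_sum A, quad_eq_sum B]
    have h2 (u : Word n l) : (wordVec d K ∘ wordCast hld) u = eval (indVec K) u.mono := rfl
    simp only [h2]
    simp only [wordVec]
    linarith

/-- The matrices of refutations, chosen for every refutable instance and zero elsewhere. -/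
lemma exists_refuting_matrices (n k d : ℕ) (obj : ℝ) (hR : 0 ≤ R) :
    ∃ F₁ F₂ : (Edge n → Bool) → Matrix (Word n d) (Word n d) ℝ,
      (∀ I, (dksSystem n k obj).HasRefutation d R I →
        ∀ x, x (emptyWord n d) ^ 2 ≤ quad (F₁ I) x) ∧
      (∀ I x, 0 ≤ quad (F₁ I) x) ∧ (∀ I x, 0 ≤ quad (F₂ I) x) ∧
      (∀ I u v, |F₁ I u v| ≤ R + 1) ∧ (∀ I u v, |F₂ I u v| ≤ R + 1) ∧
      ∀ K : Finset (Fin n), K.card = k → ∀ I, quad (F₁ I) (wordVec d K) +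
        (2 * ∑ e ∈ edgesIn K, instVal I e - obj) * quad (F₂ I) (wordVec d K) = 0 := by
  have h (I : Edge n → Bool) : ∃ A B : Matrix (Word n d) (Word n d) ℝ,
      ((dksSystem n k obj).HasRefutation d R I → ∀ x, x (emptyWord n d) ^ 2 ≤ quad A x) ∧
      (∀ x, 0 ≤ quad A x) ∧ (∀ x, 0 ≤ quad B x) ∧ (∀ u v, |A u v| ≤ R + 1) ∧
      (∀ u v, |B u v| ≤ R + 1) ∧
      ∀ K : Finset (Fin n), K.card = k → quad A (wordVec d K) +
        (2 * ∑ e ∈ edgesIn K, instVal I e - obj) * quad B (wordVec d K) = 0 := by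
    by_cases hI : (dksSystem n k obj).HasRefutation d R I
    · obtain ⟨A, B, h1, h2, h3, h4, h5⟩ := exists_matrices_of_hasRefutation hR hI
      exact ⟨A, B, fun _ => h1, fun x => (sq_nonneg _).trans (h1 x), h2, h3, h4, h5⟩
    · have h0 : |(0 : ℝ)| ≤ R + 1 := by rw [abs_zero]; linarith
      exact ⟨0, 0, fun hI' => absurd hI' hI, by simp [quad], by simp [quad], fun _ _ => h0,
        fun _ _ => h0, by simp [quad]⟩
  choose F₁ F₂ h1 h2 h3 h4 h5 h6 using h
  exact ⟨F₁, F₂, h1, h2, h3, h4, h5, fun K hK I => h6 I K hK⟩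

end Matrices

/-! ### Noise and truncation of random matrices -/

section RandomMatrix

variable {ι m : Type} [Fintype ι] [DecidableEq ι] [Fintype m] [DecidableEq m] {p θ : ℝ}

lemma fcoeff_sum {β : Type} (s : Finset β) (F : β → (ι → Bool) → ℝ) (α : Finset ι) :
    fcoeff p (fun I => ∑ b ∈ s, F b I) α = ∑ b ∈ s, fcoeff p (F b) α := by
  simp only [fcoeff, Finset.sum_mul, expect_sum]

lemma trunc_add (N : ℕ) (F G : (ι → Bool) → ℝ) (I : ι → Bool) :
    trunc p N (fun I => F I + G I) I = trunc p N F I + trunc p N G I := by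
  simp only [trunc, fcoeff_add, ← Finset.sum_add_distrib]
  refine Finset.sum_congr rfl fun α _ => ?_
  split_ifs <;> ring

lemma trunc_const_mul (N : ℕ) (c : ℝ) (F : (ι → Bool) → ℝ) (I : ι → Bool) :
    trunc p N (fun I => c * F I) I = c * trunc p N F I := by
  simp only [trunc, fcoeff_const_mul, Finset.mul_sum]
  refine Finset.sum_congr rfl fun α _ => ?_
  split_ifs <;> ring

lemma trunc_sum {β : Type} (N : ℕ) (s : Finset β) (F : β → (ι → Bool) → ℝ) (I : ι → Bool) :
    trunc p N (fun I => ∑ b ∈ s, F b I) I = ∑ b ∈ s, trunc p N (F b) I := by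
  simp only [trunc, fcoeff_sum]
  rw [Finset.sum_comm]
  refine Finset.sum_congr rfl fun α _ => ?_
  split_ifs
  · rw [Finset.sum_mul]
  · simp

/-- The noise operator on each entry. -/
def noiseMat (θ p : ℝ) (F : (ι → Bool) → Matrix m m ℝ) (I : ι → Bool) : Matrix m m ℝ :=
  Matrix.of fun u v => noise θ p (fun J => F J u v) I

/-- Truncation of each entry. -/
def truncMat (p : ℝ) (N : ℕ) (F : (ι → Bool) → Matrix m m ℝ) (I : ι → Bool) : Matrix m m ℝ :=
  Matrix.of fun u v => trunc p N (fun J => F J u v) I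

lemma quad_noiseMat (F : (ι → Bool) → Matrix m m ℝ) (I : ι → Bool) (x : m → ℝ) :
    quad (noiseMat θ p F I) x = noise θ p (fun J => quad (F J) x) I := by
  simp only [quad_eq_sum, noiseMat, Matrix.of_apply, noise_sum]
  refine Finset.sum_congr rfl fun u _ => Finset.sum_congr rfl fun v _ => ?_
  simp only [mul_comm (F _ u v), noise_const_mul]
  ring

lemma quad_truncMat (N : ℕ) (F : (ι → Bool) → Matrix m m ℝ) (I : ι → Bool) (x : m → ℝ) :
    quad (truncMat p N F I) x = trunc p N (fun J => quad (F J) x) I := by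
  simp only [quad_eq_sum, truncMat, Matrix.of_apply, trunc_sum]
  refine Finset.sum_congr rfl fun u _ => Finset.sum_congr rfl fun v _ => ?_
  simp only [mul_comm (F _ u v), trunc_const_mul]
  ring

lemma truncComm_quad (N : ℕ) (e : ι) (F : (ι → Bool) → Matrix m m ℝ) (I : ι → Bool) (x : m → ℝ) :
    truncComm p N e (fun J => quad (F J) x) I =
      ∑ u, ∑ v, truncComm p N e (fun J => F J u v) I * (x u * x v) := by
  have h : (fun J => instVal J e * quad (F J) x) = fun J =>
      ∑ u, ∑ v, x u * x v * (instVal J e * F J u v) := by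
    funext J
    simp only [quad_eq_sum, Finset.mul_sum]
    exact Finset.sum_congr rfl fun u _ => Finset.sum_congr rfl fun v _ => by ring
  rw [truncComm, h, ← quad_truncMat]
  simp only [quad_eq_sum, truncMat, Matrix.of_apply, trunc_sum, trunc_const_mul, truncComm,
    Finset.mul_sum, ← Finset.sum_sub_distrib]
  exact Finset.sum_congr rfl fun u _ => Finset.sum_congr rfl fun v _ => by ring

lemma noiseMat_add (F G : (ι → Bool) → Matrix m m ℝ) :
    noiseMat θ p (F + G) = noiseMat θ p F + noiseMat θ p G := by
  funext I
  refine Matrix.ext fun u v => ?_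
  exact congrFun (noise_add θ (fun J => F J u v) fun J => G J u v) I

section Interior

variable (hp : 0 < p) (hp1 : p < 1)
include hp hp1

lemma noise_one (I : ι → Bool) : noise θ p (fun _ => 1) I = 1 := by
  have h1 := congrFun (noise_chi (ι := ι) hp hp1 θ ∅) I
  have h2 : chi p (∅ : Finset ι) = fun _ => 1 := by funext I; simp [chi]
  simpa [h2] using h1

lemma fcoeff_const (c : ℝ) {α : Finset ι} (hα : α.Nonempty) :
    fcoeff p (fun _ : ι → Bool => c) α = 0 := by
  have := expect_chi_mul_chi (ι := ι) hp hp1 ∅ α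
  rw [if_neg hα.ne_empty.symm] at this
  simp only [chi, Finset.prod_empty, one_mul] at this
  rw [fcoeff, expect_const_mul]
  exact mul_eq_zero_of_right _ this

lemma l2Norm_noiseMat_le (hθ : 0 ≤ θ) (hθ1 : θ ≤ 1) (N : ℕ) {F : (ι → Bool) → Matrix m m ℝ}
    (hF : ∀ u v, ∀ α : Finset ι, α.card < N → fcoeff p (fun I => F I u v) α = 0) :
    l2Norm p (noiseMat θ p F) ≤ θ ^ N * l2Norm p F := by
  refine Real.sqrt_le_iff.2 ⟨mul_nonneg (pow_nonneg hθ _) (l2Norm_nonneg _), ?_⟩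
  rw [mul_pow, l2Norm_sq hp.le hp1.le]
  simp_rw [expect_sum, Finset.mul_sum]
  exact Finset.sum_le_sum fun u _ => Finset.sum_le_sum fun v _ =>
    expect_noise_sq_le hp hp1 hθ hθ1 N _ (hF u v)

lemma l2Norm_sub_truncMat_le (N : ℕ) (F : (ι → Bool) → Matrix m m ℝ) :
    l2Norm p (F - truncMat p N F) ≤ l2Norm p F := by
  refine Real.sqrt_le_sqrt ?_
  simp_rw [expect_sum]
  exact Finset.sum_le_sum fun u _ => Finset.sum_le_sum fun v _ =>
    expect_sub_trunc_sq_le hp hp1 N fun I => F I u v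

lemma noiseMat_truncMat_mem {N D : ℕ} (hND : N ≤ D) (F : (ι → Bool) → Matrix m m ℝ) :
    noiseMat θ p (truncMat p N F) ∈ lowDegMatrices ι m p D := by
  intro u v α hα
  refine (fcoeff_noise hp hp1 θ (trunc p N fun J => F J u v) α).trans ?_
  rw [fcoeff_trunc hp hp1, if_neg (by omega), mul_zero]

/-- A dominated functional is almost determined by truncations of noisy matrices. -/
lemma apply_noiseMat_le (hθ : 0 ≤ θ) (hθ1 : θ ≤ 1) {c r s : ℝ} (hc : 0 ≤ c) (hr : 0 ≤ r)
    (hs : 0 ≤ s) (ℓ : ((ι → Bool) → Matrix m m ℝ) →ₗ[ℝ] ℝ)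
    (hℓ : ∀ F, ℓ F ≤ c * (r * expect (cubeWeight ι p) (fun I => lamSym (F I)) + s * l2Norm p F))
    (N : ℕ) (F : (ι → Bool) → Matrix m m ℝ) :
    ℓ (noiseMat θ p F) ≤ ℓ (noiseMat θ p (truncMat p N F)) +
      c * ((r + s) * (θ ^ N * l2Norm p F)) := by
  -- The part above level `N` loses a factor `θ^N` in L² under noise, and both terms of the
  -- dominating functional are controlled by the L² norm.
  have h1 : F = truncMat p N F + (F - truncMat p N F) := by abel
  have h2 : l2Norm p (noiseMat θ p (F - truncMat p N F)) ≤ θ ^ N * l2Norm p F := by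
    refine (l2Norm_noiseMat_le hp hp1 hθ hθ1 N fun u v α hα => ?_).trans
      (mul_le_mul_of_nonneg_left (l2Norm_sub_truncMat_le hp hp1 N F) (pow_nonneg hθ _))
    exact fcoeff_sub_trunc hp hp1 N (fun I => F I u v) hα.le
  conv_lhs => rw [h1, noiseMat_add, map_add]
  refine add_le_add le_rfl ((hℓ _).trans (mul_le_mul_of_nonneg_left ?_ hc))
  have h3 := expect_lamSym_le_l2Norm hp.le hp1.le (noiseMat θ p (F - truncMat p N F))
  have h4 := mul_le_mul_of_nonneg_left (h3.trans h2) hr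
  have h5 := mul_le_mul_of_nonneg_left h2 hs
  linarith

lemma expect_noise_truncComm_sq_le (hθ : 0 ≤ θ) (hθ1 : θ ≤ 1) (N : ℕ) (e : ι)
    (F : (ι → Bool) → ℝ) {b : ℝ} (hF : expect (cubeWeight ι p) (fun I => F I ^ 2) ≤ b ^ 2) :
    expect (cubeWeight ι p) (fun I => noise θ p (truncComm p N e F) I ^ 2) ≤
      (2 * θ ^ N * b) ^ 2 := by
  refine (expect_noise_sq_le hp hp1 hθ hθ1 N _ fun α hα =>
    fcoeff_truncComm_of_lt hp hp1 N e F hα).trans ?_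
  calc _ ≤ (θ ^ N) ^ 2 * (4 * b ^ 2) := by
        refine mul_le_mul_of_nonneg_left ((expect_truncComm_sq_le hp hp1 N e F).trans ?_)
          (sq_nonneg _)
        linarith
    _ = _ := by ring

lemma lowDeg_noise_truncComm (N : ℕ) (e : ι) (F : (ι → Bool) → ℝ) :
    LowDeg (N + 1) (noise θ p (truncComm p N e F)) :=
  LowDeg.of_fcoeff hp hp1 fun α hα => by
    rw [fcoeff_noise hp hp1, fcoeff_truncComm_of_gt hp hp1 N e F hα, mul_zero]

end Interior

end RandomMatrix

/-! ### Refutations contradict the spectral bound -/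

section Contradiction

variable {n k d D : ℕ} {p q r θ δ obj a b S : ℝ}

lemma expect_plantCond_noise (s : ℝ) (K : Finset (Fin n)) (f : (Edge n → Bool) → ℝ) :
    expect (plantCond p q s K) (noise θ p f) = expect (plantCond p q (θ * s) K) f := by
  refine (expect_noise (plantRate p q s K) θ p f).trans ?_
  rw [plantCond]
  congr 2
  funext e
  simp only [plantRate]
  split_ifs <;> ring

/-- The lifted objective. -/
def liftScore (a b obj : ℝ) (K : Finset (Fin n)) (I : Edge n → Bool) : ℝ :=
  2 * ∑ e ∈ edgesIn K, (a * instVal I e + b) - obj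

lemma abs_liftScore_le (ha : |a| ≤ 3) (hb : |b| ≤ 3) (K : Finset (Fin n)) (I : Edge n → Bool) :
    |liftScore a b obj K I| ≤ 12 * (n : ℝ) ^ 2 + |obj| := by
  have h1 (e : Edge n) : |a * instVal I e + b| ≤ 6 := by
    refine (abs_add_le _ _).trans ?_
    rw [abs_mul]
    have : |instVal I e| ≤ 1 := by rw [instVal]; split_ifs <;> simp
    nlinarith [abs_nonneg a, abs_nonneg (instVal I e)]
  have h2 : ((edgesIn K).card : ℝ) ≤ (n : ℝ) ^ 2 := by
    have : (edgesIn K).card ≤ n ^ 2 := by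
      refine (Finset.card_le_univ _).trans ((Fintype.card_subtype_le _).trans ?_)
      simp [pow_two]
    exact_mod_cast this
  have h3 : |∑ e ∈ edgesIn K, (a * instVal I e + b)| ≤ (edgesIn K).card * 6 := by
    refine (Finset.abs_sum_le_sum_abs _ _).trans ((Finset.sum_le_sum fun e _ => h1 e).trans ?_)
    simp
  refine (abs_sub _ _).trans (add_le_add ?_ le_rfl)
  rw [abs_mul, abs_two]
  linarith

/-- For a fixed planted set only commutators of truncation and multiplication survive. -/
lemma expect_noise_trunc_add (K : Finset (Fin n)) (N : ℕ)
    (hlift : ∀ e ∈ edgesIn K, ∀ F : (Edge n → Bool) → ℝ,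
      expect (plantCond p q θ K) (fun I => (a * instVal I e + b) * noise θ p F I) =
        expect (plantCond p q (θ * θ) K) (fun J => instVal J e * F J))
    {f₁ f₂ : (Edge n → Bool) → ℝ}
    (hf : ∀ I, f₁ I + (2 * ∑ e ∈ edgesIn K, instVal I e - obj) * f₂ I = 0) :
    expect (plantCond p q θ K) (fun I => noise θ p (trunc p N f₁) I) +
        expect (plantCond p q θ K)
          (fun I => liftScore a b obj K I * noise θ p (trunc p N f₂) I) =
      expect (plantCond p q θ K)
        (fun I => ∑ e ∈ edgesIn K, 2 * noise θ p (truncComm p N e f₂) I) := by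
  -- The refutation identity expresses `f₁` through the products `I_e f₂`. After truncation these
  -- products are cut as a whole, whereas the lifted objective multiplies the truncation of `f₂`.
  have h1 : trunc p N f₁ = fun I => ∑ e ∈ edgesIn K, (-2) * trunc p N (fun J => instVal J e * f₂ J) I
      + obj * trunc p N f₂ I := by
    have : f₁ = fun I => ∑ e ∈ edgesIn K, (-2) * (instVal I e * f₂ I) + obj * f₂ I := by
      funext I
      have := hf I
      rw [← Finset.mul_sum, ← Finset.sum_mul]
      linarith
    conv_lhs => rw [this]
    funext I
    rw [trunc_add, trunc_sum, trunc_const_mul]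
    simp only [trunc_const_mul]
  have h2 (F : (Edge n → Bool) → ℝ) : expect (plantCond p q θ K)
      (fun I => liftScore a b obj K I * noise θ p F I) =
      ∑ e ∈ edgesIn K, 2 * expect (plantCond p q (θ * θ) K) (fun J => instVal J e * F J) +
        (-obj) * expect (plantCond p q (θ * θ) K) F := by
    rw [← expect_plantCond_noise, ← expect_const_mul]
    have h3 : ∑ e ∈ edgesIn K, 2 * expect (plantCond p q (θ * θ) K) (fun J => instVal J e * F J) =
        expect (plantCond p q θ K)
          (fun I => ∑ e ∈ edgesIn K, 2 * ((a * instVal I e + b) * noise θ p F I)) := by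
      rw [expect_sum]
      refine Finset.sum_congr rfl fun e he => ?_
      rw [expect_const_mul, hlift e he]
    rw [h3, ← expect_add]
    congr 1
    funext I
    rw [liftScore, ← Finset.mul_sum, ← Finset.sum_mul]
    ring
  have h4 : expect (plantCond p q θ K) (fun I => noise θ p (trunc p N f₁) I) =
      expect (plantCond p q (θ * θ) K) (trunc p N f₁) := expect_plantCond_noise θ K _
  rw [h2, h4, h1, expect_add, expect_sum, expect_const_mul, expect_sum]
  have h5 (e : Edge n) : expect (plantCond p q θ K)
      (fun I => 2 * noise θ p (truncComm p N e f₂) I) =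
      2 * expect (plantCond p q (θ * θ) K) (fun J => instVal J e * trunc p N f₂ J) +
        expect (plantCond p q (θ * θ) K)
          (fun I => (-2) * trunc p N (fun J => instVal J e * f₂ J) I) := by
    have h6 : expect (plantCond p q θ K) (fun I => noise θ p (truncComm p N e f₂) I) =
      expect (plantCond p q (θ * θ) K) (truncComm p N e f₂) := expect_plantCond_noise θ K _
    rw [expect_const_mul, h6, ← expect_const_mul, ← expect_const_mul, ← expect_add]
    congr 1
    funext I
    rw [truncComm]
    ring
  simp only [h5, Finset.sum_add_distrib]
  have h7 : expect (plantCond p q (θ * θ) K) (trunc p N f₂) =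
    expect (plantCond p q (θ * θ) K) (fun I => trunc p N f₂ I) := rfl
  rw [h7]
  ring

/-- The truncated parts of the refutation nearly cancel. -/
lemma plantedForm_truncMat_le (hp : 0 < p) (hp1 : p < 1) (hq : 0 ≤ q) (hq1 : q ≤ 1)
    (hθ : 0 ≤ θ) (hθ1 : θ ≤ 1) (hk : k ≤ n) (hr : 0 ≤ r) (hS : 0 ≤ S)
    (h : SpectralBound n k d D p q r) {N : ℕ} (hND : N + 1 ≤ D)
    (hlift : ∀ K : Finset (Fin n), ∀ e ∈ edgesIn K, ∀ F : (Edge n → Bool) → ℝ,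
      expect (plantCond p q θ K) (fun I => (a * instVal I e + b) * noise θ p F I) =
        expect (plantCond p q (θ * θ) K) (fun J => instVal J e * F J))
    {F₁ F₂ : (Edge n → Bool) → Matrix (Word n d) (Word n d) ℝ}
    (hF : ∀ K : Finset (Fin n), K.card = k → ∀ I, quad (F₁ I) (wordVec d K) +
        (2 * ∑ e ∈ edgesIn K, instVal I e - obj) * quad (F₂ I) (wordVec d K) = 0)
    (hF₂ : ∀ u v, expect (cubeWeight (Edge n) p) (fun I => F₂ I u v ^ 2) ≤ S ^ 2) :
    plantedForm n k d p q θ (fun _ _ => 1) (noiseMat θ p (truncMat p N F₁)) +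
        plantedForm n k d p q θ (liftScore a b obj) (noiseMat θ p (truncMat p N F₂)) ≤
      Fintype.card (Edge n) * ((Fintype.card (Word n d) : ℝ) ^ 2 * (4 * √r * θ ^ N * S)) := by
  have hw := plantJoint_nonneg (n := n) (k := k) hp.le hp1.le hq hq1 hθ hθ1
  let c : Edge n → Word n d → Word n d → (Edge n → Bool) → ℝ := fun e u v =>
    noise θ p (truncComm p N e fun J => F₂ J u v)
  have h1 : plantedForm n k d p q θ (fun _ _ => 1) (noiseMat θ p (truncMat p N F₁)) +
        plantedForm n k d p q θ (liftScore a b obj) (noiseMat θ p (truncMat p N F₂)) =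
      expect (plantJoint n k p q θ) (fun x => ∑ e ∈ edgesIn x.1,
        2 * ∑ u, ∑ v, wordVec d x.1 u * wordVec d x.1 v * c e u v x.2) := by
    change expect _ _ + expect _ _ = _
    rw [← expect_add, expect_plantJoint, expect_plantJoint]
    refine avgK_congr fun K hK => ?_
    have h2 := expect_noise_trunc_add K N (hlift K) (hF K hK)
    rw [← expect_add] at h2
    simp only [quad_noiseMat, quad_truncMat, one_mul]
    refine h2.trans ?_
    congr 1
    funext I
    refine Finset.sum_congr rfl fun e _ => ?_
    have h3 : truncComm p N e (fun J => quad (F₂ J) (wordVec d K)) = fun I => ∑ u, ∑ v,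
        wordVec d K u * wordVec d K v * truncComm p N e (fun J => F₂ J u v) I := by
      funext I
      rw [truncComm_quad]
      exact Finset.sum_congr rfl fun u _ => Finset.sum_congr rfl fun v _ => by ring
    rw [h3, noise_sum]
    simp only [noise_sum, noise_const_mul, c]
  have h2 : expect (plantJoint n k p q θ) (fun x => ∑ e ∈ edgesIn x.1,
        2 * ∑ u, ∑ v, wordVec d x.1 u * wordVec d x.1 v * c e u v x.2) ≤
      expect (plantJoint n k p q θ) (fun x => ∑ e, ∑ u, ∑ v, 2 * |c e u v x.2|) := by
    refine expect_mono hw fun x => ?_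
    have h3 (e : Edge n) : 2 * ∑ u, ∑ v, wordVec d x.1 u * wordVec d x.1 v * c e u v x.2 ≤
        ∑ u, ∑ v, 2 * |c e u v x.2| := by
      simp only [Finset.mul_sum]
      refine Finset.sum_le_sum fun u _ => Finset.sum_le_sum fun v _ => ?_
      refine mul_le_mul_of_nonneg_left ((le_abs_self _).trans ?_) zero_le_two
      rw [abs_mul, abs_mul]
      refine mul_le_of_le_one_left (abs_nonneg _) ?_
      exact mul_le_one₀ (abs_wordVec_le_one _ _) (abs_nonneg _) (abs_wordVec_le_one _ _)
    refine (Finset.sum_le_sum fun e _ => h3 e).trans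
      (Finset.sum_le_sum_of_subset_of_nonneg (Finset.subset_univ _) fun e _ _ => ?_)
    exact Finset.sum_nonneg fun _ _ => Finset.sum_nonneg fun _ _ => by positivity
  -- The noisy commutator has degree at most `N + 1 ≤ D`, so its second moment transfers from the
  -- planted law to `ν` at the cost `r`; there it is of order `θ^N S`.
  have h3 (e : Edge n) (u v : Word n d) :
      expect (plantJoint n k p q θ) (fun x => 2 * |c e u v x.2|) ≤ 4 * √r * θ ^ N * S := by
    rw [expect_const_mul]
    have h4 := expect_abs_le_sqrt hw (sum_plantJoint hk) fun x => c e u v x.2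
    have h5 := h.expect_sq_le hp.le hp1.le hθ hθ1
      ((lowDeg_noise_truncComm (θ := θ) hp hp1 N e fun J => F₂ J u v).mono hND)
    have h6 := expect_noise_truncComm_sq_le hp hp1 hθ hθ1 N e _ (hF₂ u v)
    have h7 : √(expect (plantJoint n k p q θ) fun x => c e u v x.2 ^ 2) ≤
        √r * (2 * θ ^ N * S) := by
      rw [← Real.sqrt_sq (show 0 ≤ 2 * θ ^ N * S by positivity), ← Real.sqrt_mul hr]
      exact Real.sqrt_le_sqrt (h5.trans (mul_le_mul_of_nonneg_left h6 hr))
    linarith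
  rw [h1]
  refine h2.trans ?_
  simp_rw [expect_sum]
  refine (Finset.sum_le_sum fun e _ => Finset.sum_le_sum fun u _ => Finset.sum_le_sum fun v _ =>
    h3 e u v).trans (le_of_eq ?_)
  simp only [Finset.sum_const, Finset.card_univ, nsmul_eq_mul]
  ring

end Contradiction

section Distinguisher

variable {n k d D : ℕ} {p q r θ δ obj S ε : ℝ}

/-- The first matrix of a refutation keeps its mass under a dominated functional. -/
lemma one_sub_le_apply_noiseMat (hp : 0 < p) (hp1 : p < 1) (hθ : 0 ≤ θ) (hθ1 : θ ≤ 1)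
    (hk : k ≤ n) (hr : 0 ≤ r)
    {ℓ : ((Edge n → Bool) → Matrix (Word n d) (Word n d) ℝ) →ₗ[ℝ] ℝ}
    (hℓ : ∀ F ∈ lowDegMatrices (Edge n) (Word n d) p D,
      ℓ F = plantedForm n k d p q θ (fun _ _ => 1) F)
    (hℓ' : ∀ F, ℓ F ≤ Fintype.card (Word n d) *
      (r * expect (erWeight n p) (fun I => lamSym (F I))))
    {E : (Edge n → Bool) → Prop} (hE : 1 - δ ≤ prob (erWeight n p) E)
    {F : (Edge n → Bool) → Matrix (Word n d) (Word n d) ℝ}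
    (hF : ∀ I x, 0 ≤ quad (F I) x) (hFE : ∀ I, E I → ∀ x, x (emptyWord n d) ^ 2 ≤ quad (F I) x) :
    1 - Fintype.card (Word n d) * (r * δ) ≤ ℓ (noiseMat θ p F) := by
  classical
  -- The constant matrix with a single `1` at the empty word has degree `0`, so `ℓ` takes its
  -- planted value `1` there. It remains to bound `ℓ (H - noiseMat θ p F)` from above.
  let H : (Edge n → Bool) → Matrix (Word n d) (Word n d) ℝ := fun _ => diagUnit (emptyWord n d) 1
  have hH : ℓ H = 1 := by
    rw [hℓ H fun u v α hα => fcoeff_const hp hp1 _ (Finset.card_pos.1 (by omega))]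
    change expect _ _ = 1
    simp only [H, quad_diagUnit, wordVec_emptyWord, one_pow, mul_one]
    exact expect_const (sum_plantJoint hk) 1
  let g : (Edge n → Bool) → ℝ := fun J => if E J then 0 else 1
  have hg0 (J : Edge n → Bool) : 0 ≤ g J := by simp only [g]; split_ifs <;> norm_num
  have hker := noiseKer_nonneg (ι := Edge n) hθ hθ1 hp.le hp1.le
  -- On refutable instances `F` dominates `H`, and elsewhere it is still positive semidefinite. So
  -- the excess of `H` over the noisy `F` is at most the noisy indicator of failure, whose mean
  -- under `ν` is at most `δ`.
  have h1 (I : Edge n → Bool) : lamSym ((H - noiseMat θ p F) I) ≤ noise θ p g I := by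
    have hN : 0 ≤ noise θ p g I := Finset.sum_nonneg fun J _ => mul_nonneg (hker I J) (hg0 J)
    refine lamSym_le hN fun x => ?_
    have h2 : quad ((H - noiseMat θ p F) I) x =
        x (emptyWord n d) ^ 2 - noise θ p (fun J => quad (F J) x) I := by
      have : (H - noiseMat θ p F) I = diagUnit (emptyWord n d) 1 + (-1 : ℝ) • noiseMat θ p F I := by
        rw [neg_one_smul, ← sub_eq_add_neg]
        rfl
      rw [this, quad_add, quad_smul, quad_diagUnit, quad_noiseMat]
      ring
    have h3 : x (emptyWord n d) ^ 2 = noise θ p (fun _ => x (emptyWord n d) ^ 2 * 1) I := by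
      rw [congrFun (noise_const_mul θ _ _) I, noise_one hp hp1, mul_one]
    have h4 : x (emptyWord n d) ^ 2 - noise θ p (fun J => quad (F J) x) I ≤
        noise θ p (fun J => x (emptyWord n d) ^ 2 * g J) I := by
      rw [sub_le_iff_le_add, ← congrFun (noise_add θ _ _) I]
      conv_lhs => rw [h3]
      refine Finset.sum_le_sum fun J _ => mul_le_mul_of_nonneg_left ?_ (hker I J)
      simp only [g]
      split_ifs with hJ
      · have := hFE J hJ x
        linarith
      · have := hF J x
        linarith
    rw [congrFun (noise_const_mul θ _ _) I, mul_comm] at h4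
    rw [h2]
    exact h4.trans (mul_le_mul_of_nonneg_left
      (Finset.single_le_sum (f := fun u => x u ^ 2) (fun _ _ => sq_nonneg _)
        (Finset.mem_univ (emptyWord n d))) hN)
  have h5 : expect (erWeight n p) (fun I => lamSym ((H - noiseMat θ p F) I)) ≤ δ := by
    refine (expect_mono (cubeWeight_nonneg hp.le hp1.le) h1).trans ?_
    have h6 : expect (erWeight n p) (fun I => noise θ p g I) = expect (erWeight n p) g :=
      expect_cubeWeight_noise θ p g
    have h7 := prob_add_prob_not (w := erWeight n p) E
    rw [show ∑ a, erWeight n p a = 1 from sum_bernWeight _, prob_eq_expect (fun a => ¬ E a)] at h7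
    have h8 : expect (erWeight n p) g = expect (erWeight n p) fun a => if ¬ E a then 1 else 0 := by
      congr 1
      funext J
      simp only [g]
      split_ifs <;> simp_all
    change expect (erWeight n p) (fun I => noise θ p g I) ≤ δ
    linarith
  have h9 := (hℓ' (H - noiseMat θ p F)).trans
    (mul_le_mul_of_nonneg_left (mul_le_mul_of_nonneg_left h5 hr) (Nat.cast_nonneg _))
  rw [map_sub, hH] at h9
  linarith

/-- The quantitative form of the contradiction. -/
lemma Regime.one_le_of_spectralBound (h : Regime n k d D p q ε obj) (hp : 0 < p)
    (hR : dksRefutable n k d (40 * d) p obj) (hr : 0 ≤ r) (hB : SpectralBound n k d D p q r)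
    (hδ : δ = 1 / (n : ℝ) ^ (8 * (40 * d))) (hS : S = (n : ℝ) ^ (40 * d) + 1) {V M G : ℝ}
    (hV : V = Fintype.card (Word n d)) (hM : M = Fintype.card (Edge n))
    (hG : G = 12 * (n : ℝ) ^ 2 + |obj|) :
    1 ≤ V * (r * δ) + G * V * (√(δ * r) * (V * S)) + V * (r * (δ * (V * S))) +
      G * V * ((r + √(δ * r)) * (δ * (V * S))) + M * (V ^ 2 * (4 * √r * δ * S)) := by
  have hp1 := h.p_lt_one
  have hq := h.q_pos.le
  have hq1 := h.q_le_one
  have hθ := h.sampleRate_pos.le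
  have hθ1 := h.sampleRate_lt_one.le
  have hk := h.k_le_n
  have hD := h.d_lt_D
  have hθm : sampleRate n d D ^ (D - 1) ≤ δ := by
    rw [hδ]
    exact h.sampleRate_pow_le (by have := h.one_le_d; omega)
  have hn0 : (0 : ℝ) ≤ (n : ℝ) ^ (40 * d) := by positivity
  have hS0 : 0 ≤ S := by rw [hS]; linarith
  have hδ0 : 0 ≤ δ := by rw [hδ]; positivity
  have hV0 : 0 ≤ V := by rw [hV]; positivity
  have hG0 : 0 ≤ G := by rw [hG]; positivity
  have hM0 : 0 ≤ M := by rw [hM]; positivity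
  obtain ⟨a, b, ha, hb, hlift, hneg⟩ := h.exists_lift hp hR
  obtain ⟨F₁, F₂, hF₁E, hF₁, hF₂, hF₁S, hF₂S, hF⟩ := exists_refuting_matrices n k d obj hn0
  rw [← hS] at hF₁S hF₂S
  rw [← hδ] at hneg
  -- The weight `1` is never negative, so `δ = 0` may be used here and `ℓ₁` carries no L² error
  -- term.
  obtain ⟨ℓ₁, h1, h1'⟩ := exists_extension_plantedForm (d := d) (D := D) (k := k) (G := 1) (δ := 0)
    (g := fun _ _ => 1) hp hp1 hq hq1 hθ hθ1 hk hr le_rfl hB (by simp) fun K _ => by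
      simp only [prob, show ¬ (1 : ℝ) < 0 by norm_num, if_false, Finset.sum_const_zero, le_rfl]
  obtain ⟨ℓ₂, h2, h2'⟩ := exists_extension_plantedForm (d := d) (D := D) (k := k) (δ := δ)
    (g := liftScore a b obj) hp hp1 hq hq1 hθ hθ1 hk hr hδ0 hB
    (fun K I => abs_liftScore_le (obj := obj) ha hb K I) hneg
  rw [← hV, ← hG] at h2'
  simp only [← hV] at h1'
  set θ := sampleRate n d D
  set s := √(δ * r) with hs
  have hs0 : 0 ≤ s := Real.sqrt_nonneg _
  have hsq {F : (Edge n → Bool) → Matrix (Word n d) (Word n d) ℝ} (hFS : ∀ I u v, |F I u v| ≤ S)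
      (u v : Word n d) : expect (cubeWeight (Edge n) p) (fun I => F I u v ^ 2) ≤ S ^ 2 := by
    rw [← expect_const (sum_bernWeight (fun _ : Edge n => p)) (S ^ 2)]
    exact expect_mono (cubeWeight_nonneg hp.le hp1.le) fun I => sq_le_sq' (abs_le.1 (hFS I u v)).1
      (abs_le.1 (hFS I u v)).2
  have hl1 : l2Norm p F₁ ≤ V * S := hV ▸ l2Norm_le hp.le hp1.le hS0 (hsq hF₁S)
  have hl2 : l2Norm p F₂ ≤ V * S := hV ▸ l2Norm_le hp.le hp1.le hS0 (hsq hF₂S)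
  have hlow1 : 1 - V * (r * δ) ≤ ℓ₁ (noiseMat θ p F₁) := by
    rw [hV]
    refine one_sub_le_apply_noiseMat hp hp1 hθ hθ1 hk hr h1 (fun F => ?_) (hδ ▸ hR) hF₁ hF₁E
    have := h1' F
    rw [zero_mul, Real.sqrt_zero, zero_mul, add_zero, one_mul, hV] at this
    exact this
  -- Domination is applied to `-noise F₂`, which is negative semidefinite. The spectral term then
  -- contributes nothing, and only the error from the event that the lifted objective is negative
  -- remains.
  have hlow2 : -(G * V * (s * (V * S))) ≤ ℓ₂ (noiseMat θ p F₂) := by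
    have h3 := h2' ((-1 : ℝ) • noiseMat θ p F₂)
    rw [map_smul, l2Norm_smul hp.le hp1.le, abs_neg, abs_one, one_mul, smul_eq_mul] at h3
    have h4 : expect (erWeight n p) (fun I => lamSym (((-1 : ℝ) • noiseMat θ p F₂) I)) ≤ 0 := by
      refine Finset.sum_nonpos fun I _ => mul_nonpos_of_nonneg_of_nonpos
        (cubeWeight_nonneg hp.le hp1.le I) (lamSym_le le_rfl fun x => ?_)
      rw [Pi.smul_apply, quad_smul, quad_noiseMat, zero_mul]
      have : 0 ≤ noise θ p (fun J => quad (F₂ J) x) I := Finset.sum_nonneg fun J _ =>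
        mul_nonneg (noiseKer_nonneg hθ hθ1 hp.le hp1.le I J) (hF₂ J x)
      linarith
    have h5 : l2Norm p (noiseMat θ p F₂) ≤ V * S := by
      refine (l2Norm_noiseMat_le hp hp1 hθ hθ1 0 fun u v α hα => absurd hα (by omega)).trans ?_
      rw [pow_zero, one_mul]
      exact hl2
    have h6 : G * V * (r * expect (erWeight n p)
        (fun I => lamSym (((-1 : ℝ) • noiseMat θ p F₂) I)) + s * l2Norm p (noiseMat θ p F₂)) ≤
        G * V * (s * (V * S)) := by
      refine mul_le_mul_of_nonneg_left ?_ (mul_nonneg hG0 hV0)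
      have := mul_nonpos_of_nonneg_of_nonpos hr h4
      have := mul_le_mul_of_nonneg_left h5 hs0
      linarith
    linarith
  have hup1 := apply_noiseMat_le hp hp1 hθ hθ1 (c := 1 * V) (by linarith) hr
    (Real.sqrt_nonneg _) ℓ₁ h1' (D - 1) F₁
  have hup2 := apply_noiseMat_le hp hp1 hθ hθ1 (mul_nonneg hG0 hV0) hr hs0 ℓ₂ h2' (D - 1) F₂
  rw [h1 _ (noiseMat_truncMat_mem hp hp1 (by omega) F₁), zero_mul, Real.sqrt_zero, add_zero,
    one_mul] at hup1
  rw [h2 _ (noiseMat_truncMat_mem hp hp1 (by omega) F₂)] at hup2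
  -- The cutoff `D - 1` leaves room for the extra degree of the commutator and is at least `D - 3d`,
  -- so `θ^{D-1} ≤ δ`.
  have hmid := plantedForm_truncMat_le hp hp1 hq hq1 hθ hθ1 hk hr hS0 hB (N := D - 1)
    (by omega) hlift hF (hsq hF₂S)
  rw [← hV, ← hM] at hmid
  have e1 : V * (r * (θ ^ (D - 1) * l2Norm p F₁)) ≤ V * (r * (δ * (V * S))) := by
    gcongr
    exact l2Norm_nonneg _
  have e2 : G * V * ((r + s) * (θ ^ (D - 1) * l2Norm p F₂)) ≤
      G * V * ((r + s) * (δ * (V * S))) := by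
    gcongr
    exact l2Norm_nonneg _
  have e3 : M * (V ^ 2 * (4 * √r * θ ^ (D - 1) * S)) ≤ M * (V ^ 2 * (4 * √r * δ * S)) := by
    gcongr
  linarith

lemma pow_mul_one_div_pow_le {y : ℝ} (hy : 2 ≤ y) {i j : ℕ} (hij : i + 6 ≤ j) :
    y ^ i * (1 / y ^ j) ≤ 1 / 64 := by
  obtain ⟨l, rfl⟩ := Nat.exists_eq_add_of_le hij
  have h0 : 0 < y := by linarith
  have h1 : (64 : ℝ) ≤ y ^ 6 :=
    (by norm_num : (64 : ℝ) ≤ 2 ^ 6).trans (pow_le_pow_left₀ (by norm_num) hy 6)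
  have h2 : 1 ≤ y ^ l := one_le_pow₀ (by linarith)
  rw [mul_one_div, div_le_div_iff₀ (by positivity) (by norm_num), one_mul, pow_add, pow_add,
    mul_assoc]
  refine mul_le_mul_of_nonneg_left ?_ (by positivity)
  nlinarith

/-- With `y = n^d` one has `r = y^20`, `δ = y^{-320}`, `√(δr) = y^{-150}`, `S ≤ y^41`, `V, M ≤ y²`
and `G ≤ y^6`. Every error term is a large negative power of `y ≥ 2`; in total they are at most
`9/64 < 1`. -/
lemma Regime.not_spectralBound (h : Regime n k d D p q ε obj) (hp : 0 < p)
    (hR : dksRefutable n k d (40 * d) p obj) :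
    ¬ SpectralBound n k d D p q ((n : ℝ) ^ (20 * d)) := by
  intro hB
  have hn2 : (2 : ℝ) ≤ n := by exact_mod_cast h.two_le_n
  have hd := h.one_le_d
  have key := h.one_le_of_spectralBound hp hR (by positivity) hB rfl rfl rfl rfl rfl
  obtain ⟨y, hy⟩ : ∃ y : ℝ, y = (n : ℝ) ^ d := ⟨_, rfl⟩
  have hny : (n : ℝ) ≤ y := by
    rw [hy]
    exact le_self_pow₀ (by linarith) (by omega)
  have hy2 : 2 ≤ y := hn2.trans hny
  have hy0 : 0 < y := by linarith
  have hpow (i : ℕ) : (n : ℝ) ^ (i * d) = y ^ i := by rw [hy, ← pow_mul, mul_comm]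
  have hn2y : (n : ℝ) ^ 2 ≤ y ^ 2 := pow_le_pow_left₀ (by linarith) hny 2
  rw [show 8 * (40 * d) = 320 * d by ring, hpow, hpow, hpow] at key
  have hV : (Fintype.card (Word n d) : ℝ) ≤ y ^ 2 := by
    rw [← hpow]
    exact card_word_le h.two_le_n hd
  have hM : (Fintype.card (Edge n) : ℝ) ≤ y ^ 2 := by
    refine le_trans ?_ hn2y
    have : Fintype.card (Edge n) ≤ n ^ 2 := by
      refine (Fintype.card_subtype_le _).trans ?_
      simp [pow_two]
    exact_mod_cast this
  have hG : 12 * (n : ℝ) ^ 2 + |obj| ≤ y ^ 6 := by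
    have h1 : |obj| ≤ (n : ℝ) ^ 2 := by
      rw [abs_of_pos (h.obj_pos hR)]
      refine h.obj_le_two_mul.trans ((choose_two_le_sq k).trans ?_)
      exact pow_le_pow_left₀ (Nat.cast_nonneg _) (by exact_mod_cast h.k_le_n) 2
    have h2 : (16 : ℝ) ≤ y ^ 4 :=
      (by norm_num : (16 : ℝ) ≤ 2 ^ 4).trans (pow_le_pow_left₀ (by norm_num) hy2 4)
    have h3 : 16 * y ^ 2 ≤ y ^ 6 := by
      rw [show y ^ 6 = y ^ 4 * y ^ 2 by ring]
      exact mul_le_mul_of_nonneg_right h2 (by positivity)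
    have : 0 ≤ y ^ 2 := by positivity
    linarith
  have hS : y ^ 40 + 1 ≤ y ^ 41 := by
    have : 1 ≤ y ^ 40 := one_le_pow₀ (by linarith)
    rw [pow_succ y 40]
    nlinarith
  have hsr : √(y ^ 20) = y ^ 10 := by
    rw [show y ^ 20 = (y ^ 10) ^ 2 by ring, Real.sqrt_sq (by positivity)]
  have hsδ : √(1 / y ^ 320 * y ^ 20) = 1 / y ^ 150 := by
    rw [show 1 / y ^ 320 * y ^ 20 = (1 / y ^ 150) ^ 2 by field_simp, Real.sqrt_sq (by positivity)]
  rw [hsr, hsδ] at key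
  obtain ⟨V, hVe⟩ : ∃ V : ℝ, V = Fintype.card (Word n d) := ⟨_, rfl⟩
  obtain ⟨M, hMe⟩ : ∃ M : ℝ, M = Fintype.card (Edge n) := ⟨_, rfl⟩
  obtain ⟨G, hGe⟩ : ∃ G : ℝ, G = 12 * (n : ℝ) ^ 2 + |obj| := ⟨_, rfl⟩
  obtain ⟨S, hSe⟩ : ∃ S : ℝ, S = y ^ 40 + 1 := ⟨_, rfl⟩
  have hV0 : 0 ≤ V := by rw [hVe]; positivity
  have hM0 : 0 ≤ M := by rw [hMe]; positivity
  have hG0 : 0 ≤ G := by rw [hGe]; positivity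
  have hS0 : 0 ≤ S := by rw [hSe]; positivity
  rw [← hVe, ← hMe, ← hGe, ← hSe] at key
  rw [← hVe] at hV
  rw [← hMe] at hM
  rw [← hGe] at hG
  rw [← hSe] at hS
  have hyy : 1 / y ^ 150 ≤ y ^ 20 := by
    have : 1 ≤ y ^ 20 * y ^ 150 :=
      one_le_mul_of_one_le_of_one_le (one_le_pow₀ (by linarith)) (one_le_pow₀ (by linarith))
    rwa [div_le_iff₀ (by positivity)]
  have b1 : V * (y ^ 20 * (1 / y ^ 320)) ≤ 1 / 64 := by
    calc V * (y ^ 20 * (1 / y ^ 320)) ≤ y ^ 2 * (y ^ 20 * (1 / y ^ 320)) := by gcongr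
      _ = y ^ 22 * (1 / y ^ 320) := by ring
      _ ≤ 1 / 64 := pow_mul_one_div_pow_le hy2 (by norm_num)
  have b2 : G * V * (1 / y ^ 150 * (V * S)) ≤ 1 / 64 := by
    calc G * V * (1 / y ^ 150 * (V * S)) ≤ y ^ 6 * y ^ 2 * (1 / y ^ 150 * (y ^ 2 * y ^ 41)) := by
          gcongr
      _ = y ^ 51 * (1 / y ^ 150) := by ring
      _ ≤ 1 / 64 := pow_mul_one_div_pow_le hy2 (by norm_num)
  have b3 : V * (y ^ 20 * (1 / y ^ 320 * (V * S))) ≤ 1 / 64 := by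
    calc V * (y ^ 20 * (1 / y ^ 320 * (V * S))) ≤
          y ^ 2 * (y ^ 20 * (1 / y ^ 320 * (y ^ 2 * y ^ 41))) := by gcongr
      _ = y ^ 65 * (1 / y ^ 320) := by ring
      _ ≤ 1 / 64 := pow_mul_one_div_pow_le hy2 (by norm_num)
  have b4 : G * V * ((y ^ 20 + 1 / y ^ 150) * (1 / y ^ 320 * (V * S))) ≤ 2 * (1 / 64) := by
    calc G * V * ((y ^ 20 + 1 / y ^ 150) * (1 / y ^ 320 * (V * S))) ≤
          y ^ 6 * y ^ 2 * ((y ^ 20 + y ^ 20) * (1 / y ^ 320 * (y ^ 2 * y ^ 41))) := by gcongr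
      _ = 2 * (y ^ 71 * (1 / y ^ 320)) := by ring
      _ ≤ 2 * (1 / 64) := mul_le_mul_of_nonneg_left
          (pow_mul_one_div_pow_le hy2 (by norm_num)) zero_le_two
  have b5 : M * (V ^ 2 * (4 * y ^ 10 * (1 / y ^ 320) * S)) ≤ 4 * (1 / 64) := by
    calc M * (V ^ 2 * (4 * y ^ 10 * (1 / y ^ 320) * S)) ≤
          y ^ 2 * ((y ^ 2) ^ 2 * (4 * y ^ 10 * (1 / y ^ 320) * y ^ 41)) := by gcongr
      _ = 4 * (y ^ 57 * (1 / y ^ 320)) := by ring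
      _ ≤ 4 * (1 / 64) := mul_le_mul_of_nonneg_left
          (pow_mul_one_div_pow_le hy2 (by norm_num)) (by norm_num)
  linarith

/-- Without background edges the number of edges is a distinguisher. -/
lemma Regime.hasSpectralDistinguisher_zero (h : Regime n k d D 0 q ε obj) (hr : 0 < r) :
    HasSpectralDistinguisher n d (2 * D) (plantedWeight n k 0 q) (erWeight n 0) r := by
  classical
  have hN := h.choose_pos
  have hq := h.q_pos
  -- The constant added to the edge count makes the expectation under `ν`, the empty graph,
  -- positive. It is exactly the planted mean inside `K` divided by the desired ratio.
  have hc : 0 < q * k.choose 2 / r := by positivity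
  obtain ⟨c, hce⟩ : ∃ c : ℝ, c = q * k.choose 2 / r := ⟨_, rfl⟩
  rw [← hce] at hc
  let P : MvPolynomial (Edge n) ℝ := C c + ∑ e, X e
  let f : (Edge n → Bool) → ℝ := fun I => c + ∑ e, instVal I e
  have hP (I : Edge n → Bool) : eval (instVal I) P = f I := by simp [P, f]
  have hi (I : Edge n → Bool) (e : Edge n) : 0 ≤ instVal I e := by
    rw [instVal]; split_ifs <;> norm_num
  have hf (I : Edge n → Bool) : 0 ≤ f I := add_nonneg hc.le (Finset.sum_nonneg fun e _ => hi I e)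
  let Q : Matrix (Word n d) (Word n d) (MvPolynomial (Edge n) ℝ) := Matrix.of fun u v =>
    if u = emptyWord n d ∧ v = emptyWord n d then P else 0
  have hQ (I : Edge n → Bool) : evalMat Q I = diagUnit (emptyWord n d) (f I) := by
    refine Matrix.ext fun u v => ?_
    simp only [evalMat, Matrix.map_apply, Q, Matrix.of_apply, diagUnit, ← hP]
    split_ifs <;> simp
  have hQs : Q.IsSymm := by
    refine Matrix.ext fun u v => ?_
    simp only [Matrix.transpose_apply, Q, Matrix.of_apply, and_comm]
  have hlam (I : Edge n → Bool) : lamMaxPos (evalMat Q I) = f I := by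
    rw [lamMaxPos_eq_lamSym, hQ, lamSym_diagUnit _ (hf I)]
    rw [hQ]
    refine Matrix.ext fun u v => ?_
    simp only [Matrix.transpose_apply, diagUnit, and_comm]
  have hmean (r' : Edge n → ℝ) : expect (bernWeight r') f = c + ∑ e, r' e := by
    simp only [f]
    rw [expect_add, expect_const (sum_bernWeight _), expect_sum]
    congr 1
    refine Finset.sum_congr rfl fun e _ => ?_
    have := sum_bernWeight_mul_prod_finset r' {e} (fun b => if b then 1 else 0)
    simpa [expect, instVal] using this
  have hν : expect (erWeight n 0) f = c := by
    rw [erWeight, hmean]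
    simp
  have hμ : q * k.choose 2 ≤ expect (plantedWeight n k 0 q) f := by
    rw [expect_plantedWeight, ← avgK_const h.k_le_n (q * k.choose 2)]
    refine avgK_mono fun K hK => ?_
    rw [plantCond, hmean]
    have h1 : ∑ e ∈ edgesIn K, plantRate 0 q 1 K e = q * k.choose 2 := by
      rw [Finset.sum_congr rfl fun e he => plantRate_of_mem he, Finset.sum_const, card_edgesIn, hK,
        nsmul_eq_mul]
      ring
    have h2 : ∑ e ∈ edgesIn K, plantRate 0 q 1 K e ≤ ∑ e, plantRate 0 q 1 K e :=
      Finset.sum_le_sum_of_subset_of_nonneg (Finset.subset_univ _) fun e _ _ =>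
        plantRate_nonneg le_rfl zero_le_one hq.le zero_le_one e
    linarith
  refine ⟨Q, hQs, fun u v => ?_, ?_, ?_⟩
  · simp only [Q, Matrix.of_apply]
    split_ifs
    · refine (totalDegree_add _ _).trans (max_le (by simp) ?_)
      refine totalDegree_finsetSum_le fun e _ => ?_
      rw [totalDegree_X]
      have := h.d_lt_D
      omega
    · simp
  · simp only [hlam, hν]
    exact hc
  · simp only [hlam, hν]
    rw [le_div_iff₀ hc]
    refine le_trans (le_of_eq ?_) hμ
    rw [hce]
    field_simp

/-- The case `p = 0` is separate: the normalized bits are undefined and `ν` lacks full support, but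
every edge then reveals the planted graph. -/
lemma Regime.hasSpectralDistinguisher (h : Regime n k d D p q ε obj)
    (hR : dksRefutable n k d (40 * d) p obj) :
    HasSpectralDistinguisher n d (2 * D) (plantedWeight n k p q) (erWeight n p)
      ((n : ℝ) ^ (20 * d)) := by
  rcases h.p_nonneg.eq_or_lt with rfl | hp
  · exact h.hasSpectralDistinguisher_zero (pow_pos (by linarith [h.one_lt_n]) _)
  · by_contra hD
    exact h.not_spectralBound hp hR
      (spectralBound_of_not_hasSpectralDistinguisher hp h.p_lt_one hD)

end Distinguisher

end

/-! ### Choice of the constants and assembly. -/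

theorem mainTheorem9 :
    ∃ (c₁ : ℕ) (c C : ℝ), 1 < c₁ ∧ 0 < c ∧ 0 < C ∧
      ∀ (n k d D B : ℕ) (p q ε obj : ℝ),
        2 ≤ n → k ≤ n → 1 ≤ d → 3 * d < D → B = c₁ * d →
        0 ≤ p → p < q → q ≤ 1 →
        C * (d * Real.log n) ≤ (k : ℝ) ^ 2 * (p + q) →
        c * d * Real.log n / ((D : ℝ) - 3 * d) < ε →
        obj ≤ (1 - ε) * (p + q) * (k.choose 2 : ℝ) →
        -- degrees of the program in the program variables and in the instance variables
        ((∀ j, degProg ((dksSystem n k obj).eqn j) ≤ 2 * d ∧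
            degInst ((dksSystem n k obj).eqn j) ≤ 1) ∧
          degProg (dksSystem n k obj).ineq ≤ 2 * d ∧
          degInst (dksSystem n k obj).ineq ≤ 1) ∧
        -- robust inference, with a subsampling distribution that rarely contains large sets
        ((dksRefutable n k d B p obj ∨
            C * (d * Real.log n) ≤ (k : ℝ) ^ 2 * (p + q) * (ε + (1 - p))) →
          ∃ Θ ∈ stdSimplex ℝ (Finset (Edge n)),
            (dksSystem n k obj).RobustlyInferable (plantedWeight n k p q) (erWeight n p) Θ
              (1 / (n : ℝ) ^ (8 * B)) ∧
            ∀ α : Finset (Edge n), D - 3 * d ≤ α.card →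
              prob Θ (fun T => α ⊆ T) ≤ 1 / (n : ℝ) ^ (8 * B)) ∧
        -- sum-of-squares certificates yield refutations with bounded numbers
        (2 * d ≤ k → k + d ≤ n → ∀ (I : Edge n → Bool) (γ : ℝ), 1 / (n : ℝ) ^ d ≤ γ →
          (dksSystem n k obj).HasCertificate d γ I →
          (dksSystem n k obj).HasRefutation d ((n : ℝ) ^ B) I) ∧
        -- the resulting spectral distinguisher
        (dksRefutable n k d B p obj →
          HasSpectralDistinguisher n d (2 * D) (plantedWeight n k p q) (erWeight n p)
            ((n : ℝ) ^ ((B : ℝ) / 2))) := by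
  have hη := tailEta_pos
  refine ⟨40, 640 / tailEta, 368640 / tailEta ^ 2, by norm_num, by positivity, by positivity, ?_⟩
  rintro n k d D _ p q ε obj hn hk hd hD rfl hp hpq hq hden hε hobj
  have h : Regime n k d D p q ε obj := ⟨hn, hk, hd, hD, hp, hpq, hq, hden, hε, hobj⟩
  refine ⟨⟨fun j => ⟨?_, degInst_dks_eqn_le j⟩, degProg_dks_ineq_le.trans (by omega),
    degInst_dks_ineq_le⟩, fun hR => ?_, fun h2d hkd I γ hγ hc => ?_, fun hR => ?_⟩
  · cases j with
    | none => exact degProg_dks_card_le.trans (by omega)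
    | some i => exact (degProg_dks_bool_le i).trans (by omega)
  · refine ⟨sampleWeight (sampleRate n d D),
      sampleWeight_mem_stdSimplex h.sampleRate_pos.le h.sampleRate_lt_one.le,
      h.robustlyInferable hR, fun α hα => ?_⟩
    rw [prob_sampleWeight_subset]
    exact h.sampleRate_pow_le hα
  · exact hasRefutation_of_hasCertificate hn hd hk h2d hkd h.obj_le_two_mul I hγ hc
  · have := h.hasSpectralDistinguisher hR
    rwa [← Real.rpow_natCast, show ((20 * d : ℕ) : ℝ) = ((40 * d : ℕ) : ℝ) / 2 by
      push_cast; ring] at this
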